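/- Let $\alpha>0$ be real and $\Lambda=(-1,1)$. For $v:\Lambda\to\mathbb C$ let $\tilde v$ be its extension by zero to $\mathbb R$, and write $\widehat w(\xi)=\int_{\mathbb R}w(x)e^{-i\xi x}\,dx$. Let $$H^\alpha_*(\Lambda)=\Big\{v\in L^2(\Lambda):\ \int_{\mathbb R}(1+|\xi|^2)^{\alpha}\,|\widehat{\tilde v}(\xi)|^2\,d\xi<\infty\Big\},\qquad |v|_{\alpha,*}=\Big(\frac1{2\pi}\int_{\mathbb R}|\xi|^{2\alpha}\,|\widehat{\tilde v}(\xi)|^2\,d\xi\Big)^{1/2},$$ $$\|v\|_{\omega^{-\alpha,-\alpha}}=\Big(\int_{-1}^1|v(x)|^2(1-x^2)^{-\alpha}\,dx\Big)^{1/2},\qquad \|v\|=\Big(\int_{-1}^1|v(x)|^2\,dx\Big)^{1/2}.$$ (Poincaré inequality) For every nonzero $u\in H^\alpha_*(\Lambda)$ the norm $\|u\|_{\omega^{-\alpha,-\alpha}}$ is finite and $$|u|_{\alpha,*}\ \ge\ \sqrt{\Gamma(2\alpha+1)}\,\|u\|_{\omega^{-\alpha,-\alpha}}\ >\ \sqrt{\Gamma(2\alpha+1)}\,\|u\|,$$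 where the first inequality is strict unless $u(x)=c\,(1-x^2)^{\alpha}$ almost everywhere on $\Lambda$ for some constant $c\in\mathbb C$, and in that case it is an equality. Consequently, let $D^\alpha v\in L^2(\mathbb R)$ be the Riesz fractional derivative of $v\in H^\alpha_*(\Lambda)$, whose Fourier transform is $(-1)^{\lfloor(\alpha+1)/2\rfloor}|\xi|^{\alpha}\,\widehat{\tilde v}(\xi)$, and call $\lambda\in\mathbb R$ an eigenvalue if there is a nonzero $u\in H^\alpha_*(\Lambda)$ with $$\int_{\mathbb R}D^\alpha u\,\overline{D^\alpha v}\,dx=\lambda\int_{-1}^{1}u\,\overline v\,dx\qquad\text{for all }v\in H^\alpha_*(\Lambda).$$ Then there is a smallest eigenvalue $\lambda_1$, and $\lambda_1>\Gamma(2\alpha+1)$. -/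

import Mathlib

open MeasureTheory Set
open scoped FourierTransform ComplexConjugate

noncomputable section

namespace RieszEigen

/-- The interval `Λ = (-1, 1)`. -/
def Lam : Set ℝ := Ioo (-1) 1

/-- Zero extension to the real line of a function given on `Λ`. -/
def zeroExt (v : ℝ → ℂ) : ℝ → ℂ := Lam.indicator v

/-- The Fourier transform `v̂(ξ) = ∫ v(x) e^{-iξx} dx`. -/
def hat (v : ℝ → ℂ) (ξ : ℝ) : ℂ := ∫ x : ℝ, v x * Complex.exp (-(Complex.I * ξ * x))

/-- Membership in `H^s_*(Λ)`, for `s ≥ 0`: the function `v` on `Λ` is square integrable and its zero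
extension lies in `H^s(ℝ)`, that is `∫ (1 + |ξ|²)^s |ṽ^(ξ)|² dξ < ∞`. Functions are given on the
whole line, but only their restriction to `Λ`, up to null sets, matters. -/
structure MemHStar (s : ℝ) (v : ℝ → ℂ) : Prop where
  memLp : MemLp v 2 (volume.restrict Lam)
  finite : Integrable (fun ξ : ℝ => (1 + |ξ| ^ 2) ^ s * ‖hat (zeroExt v) ξ‖ ^ 2)

/-- The seminorm `|v|_{s,*} = ((2π)⁻¹ ∫ |ξ|^{2s} |ṽ^(ξ)|² dξ)^{1/2}`. -/
def seminormStar (s : ℝ) (v : ℝ → ℂ) : ℝ :=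
  √((1 / (2 * Real.pi)) * ∫ ξ : ℝ, |ξ| ^ (2 * s) * ‖hat (zeroExt v) ξ‖ ^ 2)

/-- The Jacobi weight `ω^{a,b}(x) = (1 - x)^a (1 + x)^b`. -/
def weight (a b x : ℝ) : ℝ := (1 - x) ^ a * (1 + x) ^ b

/-- The norm of `L²_{ω^{a,b}}(Λ)`. -/
def weightedNorm (a b : ℝ) (v : ℝ → ℂ) : ℝ := √(∫ x in Lam, ‖v x‖ ^ 2 * weight a b x)

/-- The norm of `L²(Λ)`. -/
def l2Norm (v : ℝ → ℂ) : ℝ := √(∫ x in Lam, ‖v x‖ ^ 2)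

/-- The Fourier transform `(-1)^{⌊(s+1)/2⌋} |ξ|^s ṽ^(ξ)` of the Riesz derivative of order `s`. -/
def rieszSymbol (s : ℝ) (v : ℝ → ℂ) (ξ : ℝ) : ℂ :=
  (-1 : ℂ) ^ ⌊(s + 1) / 2⌋ * ((|ξ| ^ s : ℝ) : ℂ) * hat (zeroExt v) ξ

theorem continuous_hat {v : ℝ → ℂ} (hv : Integrable v) : Continuous (hat v) := by
  refine continuous_of_dominated (bound := fun x => ‖v x‖) ?_ ?_ hv.norm ?_
  · intro ξ
    exact hv.aestronglyMeasurable.mul (by fun_prop)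
  · intro ξ
    refine Filter.Eventually.of_forall fun x => ?_
    have : -(Complex.I * (ξ : ℂ) * (x : ℂ)) = ((-(ξ * x) : ℝ) : ℂ) * Complex.I := by
      push_cast; ring
    rw [norm_mul, this, Complex.norm_exp_ofReal_mul_I, mul_one]
  · exact Filter.Eventually.of_forall fun x => by fun_prop

theorem MemHStar.integrable_zeroExt {s : ℝ} {v : ℝ → ℂ} (hv : MemHStar s v) :
    Integrable (zeroExt v) := by
  have : IsFiniteMeasure (volume.restrict Lam) :=
    ⟨by simp [Lam]⟩
  exact (integrable_indicator_iff measurableSet_Ioo).2 (hv.memLp.integrable (by norm_num))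

theorem MemHStar.memLp_rieszSymbol {s : ℝ} (hs : 0 ≤ s) {v : ℝ → ℂ} (hv : MemHStar s v) :
    MemLp (fun ξ : ℝ => rieszSymbol s v (2 * Real.pi * ξ)) 2 := by
  have hc := continuous_hat hv.integrable_zeroExt
  have hm : Continuous (rieszSymbol s v) := by
    unfold rieszSymbol
    have : Continuous fun ξ : ℝ => |ξ| ^ s := continuous_abs.rpow_const fun _ => Or.inr hs
    fun_prop
  rw [memLp_two_iff_integrable_sq_norm (by fun_prop)]
  refine Integrable.comp_mul_left' (g := fun ξ => ‖rieszSymbol s v ξ‖ ^ 2) ?_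
    (by positivity)
  refine hv.finite.mono' (by fun_prop) (Filter.Eventually.of_forall fun ξ => ?_)
  have h1 : ‖rieszSymbol s v ξ‖ = |ξ| ^ s * ‖hat (zeroExt v) ξ‖ := by
    simp [rieszSymbol, abs_of_nonneg (Real.rpow_nonneg (abs_nonneg ξ) s)]
  rw [h1, Real.norm_of_nonneg (by positivity), mul_pow]
  gcongr
  rw [← Real.rpow_mul_natCast (abs_nonneg ξ), mul_comm s, Real.rpow_mul (abs_nonneg ξ),
    Real.rpow_natCast]
  gcongr
  linarith

/-- The Riesz derivative `D^s v ∈ L²(ℝ)` of `v ∈ H^s_*(Λ)`: the square integrable function on the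
line whose Fourier transform is `(-1)^{⌊(s+1)/2⌋} |ξ|^s ṽ^(ξ)`. The inverse transform of Mathlib
uses the kernel `e^{2πixξ}`, whence the dilation by `2π`. -/
def rieszDeriv {s : ℝ} (hs : 0 ≤ s) {v : ℝ → ℂ} (hv : MemHStar s v) :
    Lp ℂ 2 (volume : Measure ℝ) :=
  𝓕⁻ (hv.memLp_rieszSymbol hs).toLp

/-- The form `a(u, v) = (D^α u, D^α v)`. -/
def formA {α : ℝ} (hα : 0 ≤ α) {u v : ℝ → ℂ} (hu : MemHStar α u) (hv : MemHStar α v) : ℂ :=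
  ∫ x : ℝ, rieszDeriv hα hu x * conj (rieszDeriv hα hv x)

/-- The form `b(u, v) = (u, v)` of `L²(Λ)`. -/
def formB (u v : ℝ → ℂ) : ℂ := ∫ x in Lam, u x * conj (v x)

/-- `lam` is an eigenvalue of the weak Riesz eigenvalue problem of order `2α`: there is a nonzero
`u ∈ H^α_*(Λ)` with `a(u, v) = lam b(u, v)` for all `v ∈ H^α_*(Λ)`. -/
def IsEigenvalue {α : ℝ} (hα : 0 ≤ α) (lam : ℝ) : Prop :=
  ∃ (u : ℝ → ℂ) (hu : MemHStar α u), ¬ u =ᵐ[volume.restrict Lam] 0 ∧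
    ∀ (v : ℝ → ℂ) (hv : MemHStar α v), formA hα hu hv = (lam : ℂ) * formB u v

end RieszEigen

end

noncomputable section

namespace RieszEigen

/-! The form $(D^\alpha u, D^\alpha v)$ is diagonalised by weighted polynomials. Put
$w=(1-x^2)^\alpha$. The operator $p\mapsto(-\Delta)^\alpha(wp)$ on $\Lambda$ sends $x^n$ to a
polynomial of degree $n$ with leading coefficient $\lambda_n=\Gamma(2\alpha+1+n)/n!$, and it is
symmetric for $\int_\Lambda w\,p\,\bar q$. Being triangular and symmetric, it has the orthonormal
polynomials $P_n$ of the weight $w$ as eigenvectors, with eigenvalues $\lambda_n$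
(`exists_orthonormal_eigenpolynomials`). These increase strictly to infinity from
$\lambda_0=\Gamma(2\alpha+1)$.

Polynomiality comes from `integral_symbol_mul_hat`. Damping $|\xi|^{2\alpha}$ by
$e^{-\varepsilon|\xi|}$ gives a symbol whose transform is
$2\Gamma(2\alpha+1)\,\mathrm{Re}\,(\varepsilon+it)^{-2\alpha-1}$. Its convolution with $w\,y^n$ is
the real part of an integral of a function holomorphic in the upper half plane. As $\varepsilon\to0$
that function becomes purely imaginary on the real line outside $[-1,1]$, so only a large half
circle contributes. There, expansion at infinity leaves $\pi$ times the coefficient of $t^n$ in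
$(1-t)^\alpha(1+t)^\alpha(1-xt)^{-2\alpha-1}$, a polynomial in $x$.

For the Poincaré inequality, the functions $D^\alpha(wP_n)/\sqrt{\lambda_n}$ are orthonormal in
$L^2(\mathbb R)$, and the coefficients of $D^\alpha u$ are $d_n=\sqrt{\lambda_n}\int_\Lambda u\,\bar
P_n$. Completeness of polynomials yields $u=w^{1/2}g$ with $g=\sum\lambda_n^{-1/2}d_n\,w^{1/2}P_n$
(`ae_eq_sqrtWeight_mul_density`). Hence
$\lambda_0\|u\|_{\omega^{-\alpha,-\alpha}}^2=\sum(\lambda_0/\lambda_n)|d_n|^2\le\sum|d_n|^2\le|u|_{\alpha,*}^2$,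
the last step being Bessel's inequality. Equality kills every $d_n$ with $n\ge1$, which leaves
multiples of $w$.

For the eigenvalue, closedness of $D^\alpha$ upgrades Bessel to Parseval
(`rieszDeriv_eq_fourierSum`), so $u\mapsto d$ identifies $H^\alpha_*(\Lambda)$ with $\ell^2$ and the
form with the inner product. The inclusion into $L^2(\Lambda)$ becomes a compact injective operator
$T$ because $\lambda_n\to\infty$. The eigenvalue problem reads $T^*Td=\lambda^{-1}d$, so the
smallest eigenvalue is $\|T\|^{-2}$, attained by `exists_norm_sq_mul_inner_eq`. The Poincaré
inequality applied to an eigenfunction gives the strict bound. -/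

/-! ### Fourier transforms and the vector space structure of $H^s_*(\Lambda)$. -/

theorem norm_exp_neg_I_mul_mul (ξ x : ℝ) : ‖Complex.exp (-(Complex.I * ξ * x))‖ = 1 := by
  have : -(Complex.I * (ξ : ℂ) * (x : ℂ)) = ((-(ξ * x) : ℝ) : ℂ) * Complex.I := by
    push_cast; ring
  rw [this, Complex.norm_exp_ofReal_mul_I]

theorem integrable_mul_exp {v : ℝ → ℂ} (hv : Integrable v) (ξ : ℝ) :
    Integrable fun x : ℝ => v x * Complex.exp (-(Complex.I * ξ * x)) := by
  refine hv.norm.mono' (hv.aestronglyMeasurable.mul (by fun_prop)) (.of_forall fun x => ?_)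
  rw [norm_mul, norm_exp_neg_I_mul_mul, mul_one]

theorem norm_hat_le {v : ℝ → ℂ} (ξ : ℝ) : ‖hat v ξ‖ ≤ ∫ x, ‖v x‖ := by
  refine (norm_integral_le_integral_norm _).trans_eq ?_
  simp_rw [norm_mul, norm_exp_neg_I_mul_mul, mul_one]

theorem hat_add {v w : ℝ → ℂ} (hv : Integrable v) (hw : Integrable w) (ξ : ℝ) :
    hat (v + w) ξ = hat v ξ + hat w ξ := by
  simp only [hat, Pi.add_apply, add_mul]
  exact integral_add (integrable_mul_exp hv ξ) (integrable_mul_exp hw ξ)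

theorem hat_smul (c : ℂ) (v : ℝ → ℂ) (ξ : ℝ) : hat (c • v) ξ = c * hat v ξ := by
  simp only [hat, Pi.smul_apply, smul_eq_mul, mul_assoc]
  exact integral_const_mul _ _

theorem zeroExt_add (v w : ℝ → ℂ) : zeroExt (v + w) = zeroExt v + zeroExt w :=
  indicator_add _ _ _

theorem zeroExt_smul (c : ℂ) (v : ℝ → ℂ) : zeroExt (c • v) = c • zeroExt v :=
  indicator_const_smul Lam c v

theorem measurableSet_Lam : MeasurableSet Lam := measurableSet_Ioo

instance isFiniteMeasure_restrict_Lam : IsFiniteMeasure (volume.restrict Lam) := ⟨by simp [Lam]⟩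

theorem hat_zeroExt (v : ℝ → ℂ) (ξ : ℝ) :
    hat (zeroExt v) ξ = ∫ x in Lam, v x * Complex.exp (-(Complex.I * ξ * x)) := by
  rw [hat, ← integral_indicator measurableSet_Lam]
  congr 1 with x
  by_cases hx : x ∈ Lam <;> simp [zeroExt, hx]

theorem hat_zeroExt_congr {v w : ℝ → ℂ} (h : v =ᵐ[volume.restrict Lam] w) :
    hat (zeroExt v) = hat (zeroExt w) := by
  ext ξ
  rw [hat_zeroExt, hat_zeroExt]
  exact integral_congr_ae (h.mono fun x hx => by simp only [hx])

namespace MemHStar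

variable {s : ℝ} {v w : ℝ → ℂ}

theorem add (hv : MemHStar s v) (hw : MemHStar s w) : MemHStar s (v + w) := by
  refine ⟨hv.memLp.add hw.memLp, ?_⟩
  have e : ∀ ξ, hat (zeroExt (v + w)) ξ = hat (zeroExt v) ξ + hat (zeroExt w) ξ := fun ξ => by
    rw [zeroExt_add, hat_add hv.integrable_zeroExt hw.integrable_zeroExt]
  simp only [e]
  have hc := continuous_hat hv.integrable_zeroExt
  have hd := continuous_hat hw.integrable_zeroExt
  refine ((hv.finite.add hw.finite).const_mul 2).mono' ?_ (.of_forall fun ξ => ?_)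
  · refine Measurable.aestronglyMeasurable ?_
    have := hc.measurable
    have := hd.measurable
    fun_prop
  · have h0 : 0 ≤ (1 + |ξ| ^ 2) ^ s := by positivity
    rw [Real.norm_of_nonneg (by positivity)]
    simp only [Pi.add_apply]
    have : ‖hat (zeroExt v) ξ + hat (zeroExt w) ξ‖ ^ 2 ≤
        2 * (‖hat (zeroExt v) ξ‖ ^ 2 + ‖hat (zeroExt w) ξ‖ ^ 2) :=
      (pow_le_pow_left₀ (norm_nonneg _) (norm_add_le _ _) 2).trans add_sq_le
    nlinarith

theorem smul (c : ℂ) (hv : MemHStar s v) : MemHStar s (c • v) := by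
  refine ⟨hv.memLp.const_smul c, ?_⟩
  simp only [zeroExt_smul, hat_smul, norm_mul, mul_pow]
  refine (hv.finite.const_mul (‖c‖ ^ 2)).congr (.of_forall fun ξ => ?_)
  simp only
  ring

end MemHStar

/-! ### The Riesz derivative through Plancherel. -/

theorem norm_neg_one_zpow (n : ℤ) : (-1 : ℂ) ^ n * conj ((-1 : ℂ) ^ n) = 1 := by
  rw [Complex.mul_conj, Complex.normSq_eq_norm_sq]
  simp

theorem rieszSymbol_mul_conj {s : ℝ} (u v : ℝ → ℂ) (ξ : ℝ) :
    rieszSymbol s u ξ * conj (rieszSymbol s v ξ) =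
      ((|ξ| ^ (2 * s) : ℝ) : ℂ) * (hat (zeroExt u) ξ * conj (hat (zeroExt v) ξ)) := by
  have h : ((|ξ| ^ (2 * s) : ℝ) : ℂ) = ((|ξ| ^ s : ℝ) : ℂ) * ((|ξ| ^ s : ℝ) : ℂ) := by
    rw [← Complex.ofReal_mul, mul_comm 2 s, Real.rpow_mul (abs_nonneg ξ), Real.rpow_two, sq]
  simp only [rieszSymbol, map_mul, Complex.conj_ofReal, h]
  linear_combination (((|ξ| ^ s : ℝ) : ℂ) * ((|ξ| ^ s : ℝ) : ℂ) *
    (hat (zeroExt u) ξ * conj (hat (zeroExt v) ξ))) * norm_neg_one_zpow ⌊(s + 1) / 2⌋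

section

variable {s : ℝ} (hs : 0 ≤ s) {u v : ℝ → ℂ}

theorem rieszDeriv_congr (hu : MemHStar s u) (hv : MemHStar s v)
    (h : u =ᵐ[volume.restrict Lam] v) : rieszDeriv hs hu = rieszDeriv hs hv := by
  unfold rieszDeriv
  congr 1
  apply MemLp.toLp_congr
  simp only [rieszSymbol, hat_zeroExt_congr h]
  rfl

theorem rieszDeriv_add (hu : MemHStar s u) (hv : MemHStar s v) :
    rieszDeriv hs (hu.add hv) = rieszDeriv hs hu + rieszDeriv hs hv := by
  unfold rieszDeriv
  rw [← FourierTransform.fourierInv_add, ← MemLp.toLp_add]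
  congr 1
  apply MemLp.toLp_congr
  refine .of_forall fun ξ => ?_
  simp only [rieszSymbol, Pi.add_apply, zeroExt_add,
    hat_add hu.integrable_zeroExt hv.integrable_zeroExt]
  ring

theorem rieszDeriv_smul (c : ℂ) (hu : MemHStar s u) :
    rieszDeriv hs (hu.smul c) = c • rieszDeriv hs hu := by
  unfold rieszDeriv
  rw [← FourierTransform.fourierInv_smul, ← MemLp.toLp_const_smul]
  congr 1
  apply MemLp.toLp_congr
  refine .of_forall fun ξ => ?_
  simp only [rieszSymbol, Pi.smul_apply, zeroExt_smul, hat_smul, smul_eq_mul]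
  ring

/-- Plancherel's theorem. The unimodular sign in the symbol cancels against its conjugate, and
undoing the dilation by $2\pi$ produces the factor $1/(2\pi)$. -/
theorem inner_rieszDeriv (hu : MemHStar s u) (hv : MemHStar s v) :
    inner ℂ (rieszDeriv hs hv) (rieszDeriv hs hu) =
      (1 / (2 * Real.pi) : ℂ) * ∫ ξ : ℝ, ((|ξ| ^ (2 * s) : ℝ) : ℂ) *
        (hat (zeroExt u) ξ * conj (hat (zeroExt v) ξ)) := by
  have h1 : inner ℂ (rieszDeriv hs hv) (rieszDeriv hs hu) =
      inner ℂ ((hv.memLp_rieszSymbol hs).toLp _) ((hu.memLp_rieszSymbol hs).toLp _) := by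
    unfold rieszDeriv
    rw [← Lp.inner_fourier_eq, FourierTransform.fourier_fourierInv_eq,
      FourierTransform.fourier_fourierInv_eq]
  rw [h1, L2.inner_def]
  have h2 : ∀ᵐ ξ : ℝ, inner ℂ ((hv.memLp_rieszSymbol hs).toLp _ ξ)
      ((hu.memLp_rieszSymbol hs).toLp _ ξ) =
      (fun η : ℝ => ((|η| ^ (2 * s) : ℝ) : ℂ) *
        (hat (zeroExt u) η * conj (hat (zeroExt v) η))) (2 * Real.pi * ξ) := by
    filter_upwards [(hv.memLp_rieszSymbol hs).coeFn_toLp, (hu.memLp_rieszSymbol hs).coeFn_toLp]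
      with ξ h3 h4
    rw [h3, h4, RCLike.inner_apply, rieszSymbol_mul_conj]
  rw [integral_congr_ae h2, Measure.integral_comp_mul_left (fun η : ℝ =>
    ((|η| ^ (2 * s) : ℝ) : ℂ) * (hat (zeroExt u) η * conj (hat (zeroExt v) η))), abs_of_pos (by positivity)]
  rw [Complex.real_smul]
  push_cast
  rw [one_div]

theorem formA_eq_inner (hu : MemHStar s u) (hv : MemHStar s v) :
    formA hs hu hv = inner ℂ (rieszDeriv hs hv) (rieszDeriv hs hu) := by
  rw [L2.inner_def]
  simp only [formA, RCLike.inner_apply]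

theorem seminormStar_eq_norm (hu : MemHStar s u) : seminormStar s u = ‖rieszDeriv hs hu‖ := by
  have h := inner_rieszDeriv hs hu hu
  have h2 : ∀ ξ : ℝ, ((|ξ| ^ (2 * s) : ℝ) : ℂ) * (hat (zeroExt u) ξ * conj (hat (zeroExt u) ξ)) =
      ((|ξ| ^ (2 * s) * ‖hat (zeroExt u) ξ‖ ^ 2 : ℝ) : ℂ) := fun ξ => by
    rw [Complex.mul_conj, Complex.normSq_eq_norm_sq]; push_cast; ring
  simp only [h2] at h
  rw [integral_complex_ofReal] at h
  have h3 : ‖rieszDeriv hs hu‖ ^ 2 =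
      1 / (2 * Real.pi) * ∫ ξ : ℝ, |ξ| ^ (2 * s) * ‖hat (zeroExt u) ξ‖ ^ 2 := by
    have h4 : (1 / (2 * Real.pi) : ℂ) = ((1 / (2 * Real.pi) : ℝ) : ℂ) := by push_cast; rfl
    rw [← inner_self_eq_norm_sq (𝕜 := ℂ), h, RCLike.re_eq_complex_re, h4, ← Complex.ofReal_mul,
      Complex.ofReal_re]
  rw [seminormStar, ← h3, Real.sqrt_sq (norm_nonneg _)]

end

/-! ### Continuation of the weight and decay of the transforms of weighted monomials. -/

/-- The continuation `(i(1 - z))^α (-i(1 + z))^α` of `(1 - x²)^α` to the closed upper half plane. -/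
def upperWeight (α : ℝ) (z : ℂ) : ℂ :=
  (Complex.I * (1 - z)) ^ (α : ℂ) * (-Complex.I * (1 + z)) ^ (α : ℂ)

/-- Both bases have real part $\mathrm{Im}\,z\ge0$, so they avoid the cut of the principal power; at
a zero of a base, $\alpha>0$ gives continuity. -/
theorem continuousAt_upperWeight {α : ℝ} (hα : 0 < α) {z : ℂ} (hz : 0 ≤ z.im) :
    ContinuousAt (upperWeight α) z := by
  have h1 : ContinuousAt (fun z : ℂ => Complex.I * (1 - z)) z := by fun_prop
  have h2 : ContinuousAt (fun z : ℂ => -Complex.I * (1 + z)) z := by fun_prop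
  have h3 := (Complex.continuousAt_cpow_const_of_re_pos (z := Complex.I * (1 - z)) (w := (α : ℂ))
    (Or.inl (by simpa using hz)) (by simpa using hα)).comp_of_eq h1 rfl
  have h4 := (Complex.continuousAt_cpow_const_of_re_pos (z := -Complex.I * (1 + z)) (w := (α : ℂ))
    (Or.inl (by simpa using hz)) (by simpa using hα)).comp_of_eq h2 rfl
  exact h3.mul h4

theorem differentiableAt_upperWeight {α : ℝ} {z : ℂ} (hz : 0 < z.im) :
    DifferentiableAt ℂ (upperWeight α) z := by
  have h1 : DifferentiableAt ℂ (fun z : ℂ => Complex.I * (1 - z)) z := by fun_prop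
  have h2 : DifferentiableAt ℂ (fun z : ℂ => -Complex.I * (1 + z)) z := by fun_prop
  exact (h1.cpow_const (Or.inl (by simpa using hz))).mul
    (h2.cpow_const (Or.inl (by simpa using hz)))

theorem norm_upperWeight (α : ℝ) (z : ℂ) : ‖upperWeight α z‖ = ‖1 - z‖ ^ α * ‖1 + z‖ ^ α := by
  rw [upperWeight, norm_mul, Complex.norm_cpow_real, Complex.norm_cpow_real]
  simp

/-- With its companion for $-i$, this isolates the phases $e^{\pm i\pi a/2}$. They cancel in
`upperWeight` on $\Lambda$ and add up outside it. -/
theorem I_mul_ofReal_cpow {t : ℝ} (ht : 0 < t) (a : ℂ) :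
    (Complex.I * t) ^ a = (t : ℂ) ^ a * Complex.exp (Real.pi / 2 * Complex.I * a) := by
  have ht' : (t : ℂ) ≠ 0 := by exact_mod_cast ht.ne'
  rw [Complex.cpow_def_of_ne_zero (by simp [ht']), Complex.cpow_def_of_ne_zero ht', mul_comm Complex.I,
    Complex.log_ofReal_mul ht Complex.I_ne_zero, Complex.log_I, ← Complex.exp_add, ← add_mul,
    Complex.ofReal_log ht.le]

theorem neg_I_mul_ofReal_cpow {t : ℝ} (ht : 0 < t) (a : ℂ) :
    (-Complex.I * t) ^ a = (t : ℂ) ^ a * Complex.exp (-(Real.pi / 2 * Complex.I * a)) := by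
  have ht' : (t : ℂ) ≠ 0 := by exact_mod_cast ht.ne'
  rw [Complex.cpow_def_of_ne_zero (by simp [ht']), Complex.cpow_def_of_ne_zero ht', mul_comm (-Complex.I),
    Complex.log_ofReal_mul ht (neg_ne_zero.2 Complex.I_ne_zero), Complex.log_neg_I,
    ← Complex.exp_add, Complex.ofReal_log ht.le]
  congr 1
  ring

theorem upperWeight_ofReal {α x : ℝ} (hx : x ∈ Lam) :
    upperWeight α x = (((1 - x ^ 2) ^ α : ℝ) : ℂ) := by
  obtain ⟨h1, h2⟩ := hx
  have e1 : (1 : ℂ) - x = ((1 - x : ℝ) : ℂ) := by push_cast; ring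
  have e2 : (1 : ℂ) + x = ((1 + x : ℝ) : ℂ) := by push_cast; ring
  rw [upperWeight, e1, e2, I_mul_ofReal_cpow (by linarith), neg_I_mul_ofReal_cpow (by linarith),
    mul_mul_mul_comm, ← Complex.exp_add, add_neg_cancel, Complex.exp_zero, mul_one,
    ← Complex.ofReal_cpow (by linarith), ← Complex.ofReal_cpow (by linarith), ← Complex.ofReal_mul,
    ← Real.mul_rpow (by linarith) (by linarith)]
  congr 3
  ring

/-- The weighted polynomial `(1 - x²)^α p(x)`. -/
def weightedPoly (α : ℝ) (p : Polynomial ℂ) (x : ℝ) : ℂ :=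
  (((1 - x ^ 2) ^ α : ℝ) : ℂ) * p.eval (x : ℂ)

theorem weightedPoly_add (α : ℝ) (p q : Polynomial ℂ) :
    weightedPoly α (p + q) = weightedPoly α p + weightedPoly α q := by
  ext x; simp [weightedPoly, mul_add]

theorem weightedPoly_smul (α : ℝ) (c : ℂ) (p : Polynomial ℂ) :
    weightedPoly α (c • p) = c • weightedPoly α p := by
  ext x; simp [weightedPoly]; ring

theorem weightedPoly_X_pow (α : ℝ) (n : ℕ) (x : ℝ) :
    weightedPoly α (Polynomial.X ^ n) x = (((1 - x ^ 2) ^ α : ℝ) : ℂ) * (x : ℂ) ^ n := by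
  simp [weightedPoly]

theorem continuous_weightedPoly {α : ℝ} (hα : 0 < α) (p : Polynomial ℂ) :
    Continuous (weightedPoly α p) := by
  unfold weightedPoly
  have : Continuous fun x : ℝ => (1 - x ^ 2) ^ α :=
    (by fun_prop : Continuous fun x : ℝ => 1 - x ^ 2).rpow_const fun _ => Or.inr hα.le
  have h2 : Continuous fun x : ℝ => p.eval (x : ℂ) := p.continuous.comp Complex.continuous_ofReal
  fun_prop

theorem memLp_restrict_Lam_of_continuous {f : ℝ → ℂ} (hf : Continuous f) :
    MemLp f 2 (volume.restrict Lam) := by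
  obtain ⟨C, hC⟩ := (isCompact_Icc (a := (-1 : ℝ)) (b := 1)).exists_bound_of_continuousOn
    hf.continuousOn
  refine MemLp.of_bound hf.aestronglyMeasurable C ?_
  exact (ae_restrict_mem measurableSet_Lam).mono fun x hx => hC x (Ioo_subset_Icc_self hx)

theorem integrable_zeroExt_of_continuous {f : ℝ → ℂ} (hf : Continuous f) :
    Integrable (zeroExt f) :=
  (integrable_indicator_iff measurableSet_Lam).2
    ((memLp_restrict_Lam_of_continuous hf).integrable (by norm_num))

theorem setIntegral_Lam (f : ℝ → ℂ) : ∫ x in Lam, f x = ∫ x in (-1 : ℝ)..1, f x := by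
  rw [intervalIntegral.integral_of_le (by norm_num), integral_Ioc_eq_integral_Ioo]; rfl

theorem hat_neg_of_conj {v : ℝ → ℂ} (hv : ∀ x, conj (v x) = v x) (ξ : ℝ) :
    hat v (-ξ) = conj (hat v ξ) := by
  rw [hat, hat, ← integral_conj]
  congr 1 with x
  rw [map_mul, hv, ← Complex.exp_conj]
  congr 2
  simp

/-- Compare $\int_0^1 t^\alpha e^{-k}\,dt$ with $\int_0^\infty t^\alpha e^{-kt}\,dt$. This puts the
top edge of the contour on the same scale $k^{-(\alpha+1)}$ as its vertical edges. -/
theorem exp_neg_le_rpow {α k : ℝ} (hα : 0 < α) (hk : 0 < k) :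
    Real.exp (-k) ≤ Real.Gamma (α + 1) * (α + 1) * k ^ (-(α + 1)) := by
  have h := Real.integral_rpow_mul_exp_neg_mul_Ioi (a := α + 1) (by linarith) hk
  have hi : IntegrableOn (fun t : ℝ => t ^ α * Real.exp (-(k * t))) (Ioi 0) := by
    have := integrableOn_rpow_mul_exp_neg_mul_rpow (s := α) (p := 1) (by linarith) zero_lt_one hk
    refine this.congr_fun (fun t _ => ?_) measurableSet_Ioi
    simp
  have h1 : ∫ t in (0 : ℝ)..1, t ^ α * Real.exp (-k) ≤
      ∫ t : ℝ in Ioi 0, t ^ (α + 1 - 1) * Real.exp (-(k * t)) := by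
    simp only [add_sub_cancel_right]
    rw [intervalIntegral.integral_of_le zero_le_one]
    refine (setIntegral_mono_on ?_ (hi.mono_set Ioc_subset_Ioi_self) measurableSet_Ioc ?_).trans
      (setIntegral_mono_set hi ?_ Ioc_subset_Ioi_self.eventuallyLE)
    · exact ((intervalIntegral.intervalIntegrable_rpow' (by linarith)).1).mul_const _
    · intro t ht
      have := ht.1
      have h3 : k * t ≤ k := mul_le_of_le_one_right hk.le ht.2
      gcongr
    · exact (ae_restrict_mem measurableSet_Ioi).mono fun t (ht : 0 < t) => by
        simp only [Pi.zero_apply]; positivity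
  rw [h, intervalIntegral.integral_mul_const, integral_rpow (Or.inl (by linarith)),
    Real.one_rpow, Real.zero_rpow (by linarith), one_div k, Real.inv_rpow hk.le,
    ← Real.rpow_neg hk.le, sub_zero, div_mul_eq_mul_div, one_mul, div_le_iff₀ (by linarith)] at h1
  linarith

theorem norm_integral_zero_one_le {α k C : ℝ} (hα : 0 < α) (hk : 0 < k) (hC : 0 ≤ C) {f : ℝ → ℂ}
    (hf : ∀ t ∈ Icc (0 : ℝ) 1, ‖f t‖ ≤ C * (t ^ α * Real.exp (-(k * t)))) :
    ‖∫ t in (0 : ℝ)..1, f t‖ ≤ C * (Real.Gamma (α + 1) * k ^ (-(α + 1))) := by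
  have h := Real.integral_rpow_mul_exp_neg_mul_Ioi (a := α + 1) (by linarith) hk
  have hi : IntegrableOn (fun t : ℝ => t ^ α * Real.exp (-(k * t))) (Ioi 0) := by
    have := integrableOn_rpow_mul_exp_neg_mul_rpow (s := α) (p := 1) (by linarith) zero_lt_one hk
    refine this.congr_fun (fun t _ => ?_) measurableSet_Ioi
    simp
  simp only [add_sub_cancel_right] at h
  rw [one_div k, Real.inv_rpow hk.le, ← Real.rpow_neg hk.le, mul_comm] at h
  rw [← h, ← integral_const_mul]
  rw [intervalIntegral.integral_of_le zero_le_one]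
  refine (norm_integral_le_of_norm_le ((hi.mono_set Ioc_subset_Ioi_self).const_mul C) ?_).trans
      (setIntegral_mono_set (hi.const_mul C) ?_ Ioc_subset_Ioi_self.eventuallyLE)
  · exact (ae_restrict_mem measurableSet_Ioc).mono fun t ht => hf t ⟨ht.1.le, ht.2⟩
  · exact (ae_restrict_mem measurableSet_Ioi).mono fun t (ht : 0 < t) => by
      simp only [Pi.zero_apply]; positivity

/-- At $-k$ the exponential is $e^{ikz}$, which decays upwards, so the contour is moved to the other
three sides of $[-1,1]\times[0,1]$. The top side contributes $O(e^{-k})$. On the vertical sides the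
weight vanishes like $t^\alpha$ at height $t$, and the Laplace integral of $t^\alpha$ gives
$k^{-(\alpha+1)}$. -/
theorem norm_hat_weightedPoly_le_of_neg {α : ℝ} (hα : 0 < α) (n : ℕ) {k : ℝ} (hk : 0 < k) :
    ‖hat (zeroExt (weightedPoly α (Polynomial.X ^ n))) (-k)‖ ≤
      (2 * (3 ^ α * 2 ^ n) + 2 * (3 ^ α * 3 ^ α * 2 ^ n) * (α + 1)) *
        (Real.Gamma (α + 1) * k ^ (-(α + 1))) := by
  set f : ℂ → ℂ := fun z => upperWeight α z * z ^ n * Complex.exp (Complex.I * k * z) with hf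
  have hw := norm_upperWeight α
  have hne : ∀ z : ℂ, ‖f z‖ = ‖1 - z‖ ^ α * ‖1 + z‖ ^ α * ‖z‖ ^ n * Real.exp (-(k * z.im)) := by
    intro z
    rw [hf]
    simp only [norm_mul, hw, norm_pow, Complex.norm_exp]
    congr 2
    simp
  have h := Complex.integral_boundary_rect_eq_zero_of_continuousOn_of_differentiableOn f
    (-1) (1 + Complex.I) ?_ ?_
  · have e0 : hat (zeroExt (weightedPoly α (Polynomial.X ^ n))) (-k) =
        ∫ x in (-1 : ℝ)..1, f x := by
      rw [hat_zeroExt, ← setIntegral_Lam]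
      refine setIntegral_congr_fun measurableSet_Lam fun x hx => ?_
      simp only [hf, weightedPoly_X_pow, upperWeight_ofReal hx]
      congr 2
      push_cast; ring
    rw [e0]
    simp only [Complex.neg_re, Complex.one_re, Complex.neg_im, Complex.one_im, Complex.add_re,
      Complex.I_re, add_zero, neg_zero, Complex.ofReal_zero, zero_mul, Complex.add_im,
      Complex.I_im, zero_add, Complex.ofReal_one, one_mul, smul_eq_mul, Complex.ofReal_neg] at h
    have h' : ∫ x in (-1 : ℝ)..1, f x = (∫ x in (-1 : ℝ)..1, f (x + Complex.I)) -
        Complex.I * (∫ y in (0 : ℝ)..1, f (1 + y * Complex.I)) +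
        Complex.I * ∫ y in (0 : ℝ)..1, f (-1 + y * Complex.I) := by
      linear_combination h
    rw [h']
    have b1 : ‖∫ x in (-1 : ℝ)..1, f (x + Complex.I)‖ ≤
        3 ^ α * 3 ^ α * 2 ^ n * Real.exp (-k) * |(1 : ℝ) - (-1)| := by
      refine intervalIntegral.norm_integral_le_of_norm_le_const fun x hx => ?_
      rw [uIoc_of_le (by norm_num)] at hx
      rw [hne]
      have hx1 : ‖(x : ℂ)‖ ≤ 1 := by
        rw [Complex.norm_real, Real.norm_eq_abs, abs_le]; exact ⟨hx.1.le, hx.2⟩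
      have i1 : ‖1 - ((x : ℂ) + Complex.I)‖ ≤ 3 := by
        have := norm_sub_le (1 : ℂ) ((x : ℂ) + Complex.I)
        have := norm_add_le (x : ℂ) Complex.I
        simp only [Complex.norm_I, norm_one] at *
        linarith
      have i2 : ‖1 + ((x : ℂ) + Complex.I)‖ ≤ 3 := by
        have := norm_add_le (1 : ℂ) ((x : ℂ) + Complex.I)
        have := norm_add_le (x : ℂ) Complex.I
        simp only [Complex.norm_I, norm_one] at *
        linarith
      have i3 : ‖(x : ℂ) + Complex.I‖ ≤ 2 := by
        have := norm_add_le (x : ℂ) Complex.I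
        simp only [Complex.norm_I] at *
        linarith
      have i4 : ((x : ℂ) + Complex.I).im = 1 := by simp
      rw [i4, mul_one]
      gcongr
    have b2 := norm_integral_zero_one_le (C := 3 ^ α * 2 ^ n)
      (f := fun y : ℝ => f (1 + y * Complex.I)) hα hk (by positivity) fun t ht => by
        rw [hne]
        have ht1 : ‖(t : ℂ) * Complex.I‖ = t := by
          simp [abs_of_nonneg ht.1]
        have i1 : ‖1 - (1 + (t : ℂ) * Complex.I)‖ = t := by
          rw [sub_add_cancel_left, norm_neg, ht1]
        have i2 : ‖1 + (1 + (t : ℂ) * Complex.I)‖ ≤ 3 := by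
          have := norm_add_le (2 : ℂ) ((t : ℂ) * Complex.I)
          rw [ht1, Complex.norm_ofNat] at this
          rw [← add_assoc, one_add_one_eq_two]
          linarith [ht.2]
        have i3 : ‖1 + (t : ℂ) * Complex.I‖ ≤ 2 := by
          have := norm_add_le (1 : ℂ) ((t : ℂ) * Complex.I)
          rw [ht1, norm_one] at this
          linarith [ht.2]
        have i4 : (1 + (t : ℂ) * Complex.I).im = t := by simp
        rw [i4, i1]
        calc t ^ α * ‖1 + (1 + (t : ℂ) * Complex.I)‖ ^ α * ‖1 + (t : ℂ) * Complex.I‖ ^ n *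
              Real.exp (-(k * t)) ≤ t ^ α * 3 ^ α * 2 ^ n * Real.exp (-(k * t)) := by
              have := ht.1
              gcongr
          _ = _ := by ring
    have b3 := norm_integral_zero_one_le (C := 3 ^ α * 2 ^ n)
      (f := fun y : ℝ => f (-1 + y * Complex.I)) hα hk (by positivity) fun t ht => by
        rw [hne]
        have ht1 : ‖(t : ℂ) * Complex.I‖ = t := by
          simp [abs_of_nonneg ht.1]
        have i1 : ‖1 + (-1 + (t : ℂ) * Complex.I)‖ = t := by
          rw [add_neg_cancel_left, ht1]
        have i2 : ‖1 - (-1 + (t : ℂ) * Complex.I)‖ ≤ 3 := by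
          have := norm_sub_le (2 : ℂ) ((t : ℂ) * Complex.I)
          rw [ht1, Complex.norm_ofNat] at this
          have e : (1 : ℂ) - (-1 + (t : ℂ) * Complex.I) = 2 - t * Complex.I := by ring
          rw [e]
          linarith [ht.2]
        have i3 : ‖-1 + (t : ℂ) * Complex.I‖ ≤ 2 := by
          have := norm_add_le (-1 : ℂ) ((t : ℂ) * Complex.I)
          rw [ht1, norm_neg, norm_one] at this
          linarith [ht.2]
        have i4 : (-1 + (t : ℂ) * Complex.I).im = t := by simp
        rw [i4, i1]
        calc ‖1 - (-1 + (t : ℂ) * Complex.I)‖ ^ α * t ^ α * ‖-1 + (t : ℂ) * Complex.I‖ ^ n *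
              Real.exp (-(k * t)) ≤ 3 ^ α * t ^ α * 2 ^ n * Real.exp (-(k * t)) := by
              have := ht.1
              gcongr
          _ = _ := by ring
    have b4 := exp_neg_le_rpow hα hk
    have e2 : |(1 : ℝ) - (-1)| = 2 := by norm_num
    rw [e2] at b1
    refine (norm_add_le _ _).trans ?_
    rw [norm_mul, Complex.norm_I, one_mul]
    have b5 := norm_sub_le (∫ x in (-1 : ℝ)..1, f (x + Complex.I))
      (Complex.I * (∫ y in (0 : ℝ)..1, f (1 + y * Complex.I)))
    rw [norm_mul, Complex.norm_I, one_mul] at b5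
    have b6 : 3 ^ α * 3 ^ α * 2 ^ n * Real.exp (-k) * 2 ≤
        3 ^ α * 3 ^ α * 2 ^ n * (Real.Gamma (α + 1) * (α + 1) * k ^ (-(α + 1))) * 2 := by
      gcongr
    linarith
  · intro z hz
    have hz' : 0 ≤ z.im := by
      have := hz.2
      simp only [mem_preimage, Complex.neg_im, Complex.one_im, neg_zero, Complex.add_im,
        Complex.I_im, zero_add, uIcc_of_le zero_le_one] at this
      exact this.1
    refine ContinuousAt.continuousWithinAt ?_
    exact ((continuousAt_upperWeight hα hz').mul (by fun_prop)).mul (by fun_prop)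
  · intro z hz
    have hz' : 0 < z.im := by
      have := hz.2
      simp only [mem_preimage, Complex.neg_im, Complex.one_im, neg_zero, Complex.add_im,
        Complex.I_im, zero_add, min_eq_left zero_le_one] at this
      exact this.1
    exact (((differentiableAt_upperWeight hz').mul (by fun_prop)).mul
      (by fun_prop)).differentiableWithinAt

theorem exists_norm_hat_weightedPoly_X_pow_le {α : ℝ} (hα : 0 < α) (n : ℕ) :
    ∃ C, 0 ≤ C ∧ ∀ ξ, ‖hat (zeroExt (weightedPoly α (Polynomial.X ^ n))) ξ‖ ≤
      C * (1 + |ξ|) ^ (-(α + 1)) := by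
  set J := zeroExt (weightedPoly α (Polynomial.X ^ n)) with hJ
  set A := (2 * (3 ^ α * 2 ^ n) + 2 * (3 ^ α * 3 ^ α * 2 ^ n) * (α + 1)) * Real.Gamma (α + 1)
    with hA
  have hG : 0 < Real.Gamma (α + 1) := Real.Gamma_pos_of_pos (by linarith)
  have hA0 : 0 ≤ A := by positivity
  set B := ∫ x, ‖J x‖ with hB
  have hB0 : 0 ≤ B := integral_nonneg fun x => norm_nonneg _
  have hconj : ∀ x, conj (J x) = J x := by
    intro x
    rw [hJ, zeroExt]
    by_cases hx : x ∈ Lam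
    · rw [indicator_of_mem hx, weightedPoly_X_pow, map_mul, map_pow, Complex.conj_ofReal,
        Complex.conj_ofReal]
    · rw [indicator_of_notMem hx, map_zero]
  have h1 : ∀ k : ℝ, 0 < k → ‖hat J (-k)‖ ≤ A * k ^ (-(α + 1)) := fun k hk =>
    (norm_hat_weightedPoly_le_of_neg hα n hk).trans_eq (by rw [hA]; ring)
  have h2 : ∀ ξ : ℝ, ξ ≠ 0 → ‖hat J ξ‖ ≤ A * |ξ| ^ (-(α + 1)) := by
    intro ξ hξ
    rcases lt_or_gt_of_ne hξ with h | h
    · have := h1 (-ξ) (by linarith)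
      rwa [neg_neg, ← abs_of_neg h] at this
    · have := h1 ξ h
      rw [hat_neg_of_conj hconj, RCLike.norm_conj] at this
      rwa [abs_of_pos h]
  -- $B$ serves $|\xi|\le1$, where $1+|\xi|\le2$, and $A$ serves $|\xi|\ge1$, where
  -- $1+|\xi|\le2|\xi|$; both cost the factor $2^{\alpha+1}$.
  refine ⟨(A + B) * 2 ^ (α + 1), by positivity, fun ξ => ?_⟩
  have hp : 0 < 1 + |ξ| := by positivity
  rcases le_total |ξ| 1 with h | h
  · have h3 : (1 : ℝ) ≤ 2 ^ (α + 1) * (1 + |ξ|) ^ (-(α + 1)) := by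
      rw [Real.rpow_neg hp.le, ← div_eq_mul_inv, ← Real.div_rpow (by norm_num) hp.le]
      refine Real.one_le_rpow ?_ (by linarith)
      rw [le_div_iff₀ hp]
      linarith
    calc ‖hat J ξ‖ ≤ B := norm_hat_le ξ
      _ ≤ (A + B) * 1 := by linarith
      _ ≤ _ := by rw [mul_assoc]; gcongr
  · have h0 : 0 < |ξ| := by linarith
    have h3 : |ξ| ^ (-(α + 1)) ≤ 2 ^ (α + 1) * (1 + |ξ|) ^ (-(α + 1)) := by
      rw [Real.rpow_neg hp.le, Real.rpow_neg h0.le, ← div_eq_mul_inv,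
        ← Real.div_rpow (by norm_num) hp.le, ← Real.inv_rpow h0.le]
      refine Real.rpow_le_rpow (by positivity) ?_ (by linarith)
      rw [inv_eq_one_div, div_le_div_iff₀ h0 hp]
      linarith
    calc ‖hat J ξ‖ ≤ A * |ξ| ^ (-(α + 1)) := h2 ξ (abs_pos.1 h0)
      _ ≤ (A + B) * (2 ^ (α + 1) * (1 + |ξ|) ^ (-(α + 1))) := by gcongr; linarith
      _ = _ := by ring

/-- The squared decay $(1+|\xi|)^{-2\alpha-2}$ beats $(1+|\xi|^2)^\alpha$ with an integrable
$(1+|\xi|)^{-2}$ to spare. -/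
theorem memHStar_weightedPoly_X_pow {α : ℝ} (hα : 0 < α) (n : ℕ) :
    MemHStar α (weightedPoly α (Polynomial.X ^ n)) := by
  have hc := continuous_weightedPoly hα (Polynomial.X ^ n)
  refine ⟨memLp_restrict_Lam_of_continuous hc, ?_⟩
  obtain ⟨C, hC, h⟩ := exists_norm_hat_weightedPoly_X_pow_le hα n
  have hh := continuous_hat (integrable_zeroExt_of_continuous hc)
  have hi : Integrable fun ξ : ℝ => (1 + ‖ξ‖) ^ (-2 : ℝ) :=
    integrable_one_add_norm (by simp)
  refine (hi.const_mul (C ^ 2)).mono' ?_ (.of_forall fun ξ => ?_)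
  · refine Measurable.aestronglyMeasurable ?_
    have := hh.measurable
    fun_prop
  · rw [Real.norm_of_nonneg (by positivity), Real.norm_eq_abs]
    have hp : 0 < 1 + |ξ| := by positivity
    calc (1 + |ξ| ^ 2) ^ α * ‖hat (zeroExt (weightedPoly α (Polynomial.X ^ n))) ξ‖ ^ 2
        ≤ ((1 + |ξ|) ^ 2) ^ α * (C * (1 + |ξ|) ^ (-(α + 1))) ^ 2 := by
          gcongr
          · nlinarith [abs_nonneg ξ]
          · exact h ξ
      _ = C ^ 2 * (1 + |ξ|) ^ (-2 : ℝ) := by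
          rw [mul_pow, ← Real.rpow_natCast, ← Real.rpow_mul hp.le,
            ← Real.rpow_natCast (_ ^ (-(α + 1))), ← Real.rpow_mul hp.le, mul_left_comm,
            ← Real.rpow_add hp]
          congr 2
          push_cast; ring

theorem memHStar_weightedPoly {α : ℝ} (hα : 0 < α) (p : Polynomial ℂ) :
    MemHStar α (weightedPoly α p) := by
  induction p using Polynomial.induction_on' with
  | add p q hp hq => rw [weightedPoly_add]; exact hp.add hq
  | monomial n c =>
    rw [← Polynomial.C_mul_X_pow_eq_monomial, ← Polynomial.smul_eq_C_mul, weightedPoly_smul]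
    exact (memHStar_weightedPoly_X_pow hα n).smul c

/-! ### Cauchy's theorem on a half disc. -/

open Complex in
/-- Cauchy's theorem for the upper half of a disc. -/
theorem integral_boundary_half_disc_eq_zero {f : ℂ → ℂ} {R : ℝ} (hR : 0 < R)
    (hc : ContinuousOn f {z | ‖z‖ ≤ R ∧ 0 ≤ z.im})
    (hd : ∀ z : ℂ, 0 < z.im → DifferentiableAt ℂ f z) :
    (∫ x in (-R)..R, f x) +
      ∫ θ in (0 : ℝ)..Real.pi, I * (R * exp (θ * I)) * f (R * exp (θ * I)) = 0 := by
  set S : Set ℂ := {z | ‖z‖ ≤ R ∧ 0 ≤ z.im} with hS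
  have hcomp : IsCompact S := by
    have : S = Metric.closedBall 0 R ∩ {z | 0 ≤ z.im} := by ext z; simp [hS]
    rw [this]
    exact (isCompact_closedBall _ _).inter_right (isClosed_le continuous_const continuous_im)
  obtain ⟨M, hM⟩ := hcomp.exists_bound_of_continuousOn hc
  have hM0 : 0 ≤ M := (norm_nonneg _).trans (hM 0 (by simp [hS, hR.le]))
  have hreal : ∀ x : ℝ, |x| ≤ R → (x : ℂ) ∈ S := fun x hx => by simp [hS, hx]
  have hci : ContinuousOn (fun x : ℝ => f x) (Icc (-R) R) :=
    hc.comp continuous_ofReal.continuousOn fun x hx => hreal x (abs_le.2 hx)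
  have hsub : ∀ {a b : ℝ}, -R ≤ a → a ≤ b → b ≤ R → uIcc a b ⊆ Icc (-R) R := fun h1 h2 h3 => by
    rw [uIcc_of_le h2]; exact Icc_subset_Icc h1 h3
  have key : ∀ r : ℝ, 0 < r → r < R → ‖(∫ x in (-R)..R, f x) +
      ∫ θ in (0 : ℝ)..Real.pi, I * (R * exp (θ * I)) * f (R * exp (θ * I))‖ ≤
      r * (M * (2 + Real.pi)) := by
    intro r hr hrR
    -- The exponential carries the rectangle $[\log r,\log R]\times[0,\pi]$ onto the upper half
    -- annulus, and the factor `exp s` is the Jacobian. The rectangle form of Cauchy's theorem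
    -- therefore handles the half annulus.
    set g : ℂ → ℂ := fun s => exp s * f (exp s) with hg
    have hmem : ∀ s : ℂ, s.re ≤ Real.log R → 0 ≤ s.im → s.im ≤ Real.pi → exp s ∈ S := by
      intro s h1 h2 h3
      refine ⟨?_, ?_⟩
      · rw [norm_exp, ← Real.exp_log hR]; exact Real.exp_le_exp.2 h1
      · rw [exp_im]; exact mul_nonneg (Real.exp_pos _).le (Real.sin_nonneg_of_nonneg_of_le_pi h2 h3)
    have hlog : Real.log r ≤ Real.log R := Real.log_le_log hr hrR.le
    have h := integral_boundary_rect_eq_zero_of_continuousOn_of_differentiableOn g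
      (Real.log r) (Real.log R + Real.pi * I) ?_ ?_
    · simp only [ofReal_re, ofReal_im, add_re, mul_re, I_re, mul_zero, I_im, mul_one, sub_self,
        add_zero, ofReal_zero, zero_mul, add_im, mul_im, zero_add, smul_eq_mul] at h
      have e1 : ∫ x in Real.log r..Real.log R, g x = ∫ x in r..R, f x := by
        have := intervalIntegral.integral_deriv_smul_comp''' (a := Real.log r) (b := Real.log R)
          (f := Real.exp) (f' := Real.exp) (g := fun x : ℝ => f x)
          Real.continuous_exp.continuousOn (fun x _ => (Real.hasDerivAt_exp x).hasDerivWithinAt)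
          ?_ ?_ ?_
        · rw [Real.exp_log hr, Real.exp_log hR] at this
          rw [← this]
          refine intervalIntegral.integral_congr fun x _ => ?_
          simp [hg]
        · refine hci.mono ?_
          rintro _ ⟨x, hx, rfl⟩
          rw [min_eq_left hlog, max_eq_right hlog] at hx
          refine ⟨by linarith [Real.exp_pos x], ?_⟩
          rw [← Real.exp_log hR]; exact Real.exp_le_exp.2 hx.2.le
        · refine (hci.mono ?_).integrableOn_compact
            (isCompact_uIcc.image_of_continuousOn Real.continuous_exp.continuousOn)
          rintro _ ⟨x, hx, rfl⟩
          rw [uIcc_of_le hlog] at hx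
          refine ⟨by linarith [Real.exp_pos x], ?_⟩
          rw [← Real.exp_log hR]; exact Real.exp_le_exp.2 hx.2
        · refine ContinuousOn.integrableOn_compact isCompact_uIcc ?_
          refine Real.continuous_exp.continuousOn.smul (hci.comp Real.continuous_exp.continuousOn ?_)
          intro x hx
          rw [uIcc_of_le hlog] at hx
          refine ⟨by linarith [Real.exp_pos x], ?_⟩
          rw [← Real.exp_log hR]; exact Real.exp_le_exp.2 hx.2
      have e2 : ∫ x in Real.log r..Real.log R, g (x + Real.pi * I) =
          -∫ x in (-R)..(-r), f x := by
        have := intervalIntegral.integral_deriv_smul_comp''' (a := Real.log r) (b := Real.log R)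
          (f := fun x => -Real.exp x) (f' := fun x => -Real.exp x) (g := fun x : ℝ => f x)
          (by fun_prop) (fun x _ => (Real.hasDerivAt_exp x).neg.hasDerivWithinAt)
          ?_ ?_ ?_
        · rw [Real.exp_log hr, Real.exp_log hR] at this
          rw [← intervalIntegral.integral_symm, ← this]
          refine intervalIntegral.integral_congr fun x _ => ?_
          simp [hg, exp_add]
        · refine hci.mono ?_
          rintro _ ⟨x, hx, rfl⟩
          rw [min_eq_left hlog, max_eq_right hlog] at hx
          refine ⟨?_, by linarith [Real.exp_pos x]⟩
          rw [← Real.exp_log hR]; exact neg_le_neg (Real.exp_le_exp.2 hx.2.le)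
        · refine (hci.mono ?_).integrableOn_compact
            (isCompact_uIcc.image_of_continuousOn (by fun_prop))
          rintro _ ⟨x, hx, rfl⟩
          rw [uIcc_of_le hlog] at hx
          refine ⟨?_, by linarith [Real.exp_pos x]⟩
          rw [← Real.exp_log hR]; exact neg_le_neg (Real.exp_le_exp.2 hx.2)
        · refine ContinuousOn.integrableOn_compact isCompact_uIcc ?_
          refine Real.continuous_exp.neg.continuousOn.smul
            (hci.comp (f := fun x : ℝ => -Real.exp x) (by fun_prop) ?_)
          intro x hx
          rw [uIcc_of_le hlog] at hx
          refine ⟨?_, by linarith [Real.exp_pos x]⟩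
          rw [← Real.exp_log hR]; exact neg_le_neg (Real.exp_le_exp.2 hx.2)
      have e3 : ∀ ρ : ℝ, 0 < ρ → I * ∫ θ in (0 : ℝ)..Real.pi, g (Real.log ρ + θ * I) =
          ∫ θ in (0 : ℝ)..Real.pi, I * (ρ * exp (θ * I)) * f (ρ * exp (θ * I)) := by
        intro ρ hρ
        rw [← intervalIntegral.integral_const_mul]
        refine intervalIntegral.integral_congr fun θ _ => ?_
        simp only [hg, exp_add, ← ofReal_exp, Real.exp_log hρ]
        ring
      rw [e1, e2, e3 r hr, e3 R hR] at h
      have e4 : ∫ x in (-R)..R, f x = (∫ x in (-R)..(-r), f x) + (∫ x in (-r)..r, f x) +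
          ∫ x in r..R, f x := by
        rw [intervalIntegral.integral_add_adjacent_intervals,
          intervalIntegral.integral_add_adjacent_intervals]
        · exact (hci.mono (hsub le_rfl (by linarith) hrR.le)).intervalIntegrable
        · exact (hci.mono (hsub (by linarith) (by linarith) le_rfl)).intervalIntegrable
        · exact (hci.mono (hsub le_rfl (by linarith) (by linarith))).intervalIntegrable
        · exact (hci.mono (hsub (by linarith) (by linarith) (by linarith))).intervalIntegrable
      have e5 : (∫ x in (-R)..R, f x) +
          ∫ θ in (0 : ℝ)..Real.pi, I * (R * exp (θ * I)) * f (R * exp (θ * I)) =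
          (∫ x in (-r)..r, f x) +
          ∫ θ in (0 : ℝ)..Real.pi, I * (r * exp (θ * I)) * f (r * exp (θ * I)) := by
        rw [e4]; linear_combination h
      rw [e5]
      have b1 : ‖∫ x in (-r)..r, f x‖ ≤ M * |r - (-r)| :=
        intervalIntegral.norm_integral_le_of_norm_le_const fun x hx => hM _ <| hreal x <| by
          rw [uIoc_of_le (by linarith)] at hx
          exact (abs_le.2 ⟨hx.1.le, hx.2⟩).trans hrR.le
      have b2 : ‖∫ θ in (0 : ℝ)..Real.pi, I * (r * exp (θ * I)) * f (r * exp (θ * I))‖ ≤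
          r * M * |Real.pi - 0| :=
        intervalIntegral.norm_integral_le_of_norm_le_const fun θ hθ => by
          rw [uIoc_of_le Real.pi_pos.le] at hθ
          have hm := hM _ (hmem (Real.log r + θ * I) (by simpa using hlog) (by simpa using hθ.1.le)
            (by simpa using hθ.2))
          rw [exp_add, ← ofReal_exp, Real.exp_log hr] at hm
          rw [norm_mul, norm_mul, norm_mul, norm_I, one_mul, norm_exp_ofReal_mul_I, mul_one,
            norm_real, Real.norm_of_nonneg hr.le]
          gcongr
      rw [show r - -r = 2 * r by ring, abs_of_pos (by linarith)] at b1
      rw [sub_zero, abs_of_pos Real.pi_pos] at b2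
      refine (norm_add_le _ _).trans ?_
      linarith
    · refine (continuous_exp.continuousOn).mul (hc.comp continuous_exp.continuousOn ?_)
      rintro s ⟨h1, h2⟩
      simp only [mem_preimage, ofReal_re, ofReal_im, add_re, mul_re, I_re, mul_zero, I_im, mul_one,
        sub_self, add_zero, add_im, mul_im, zero_add, uIcc_of_le hlog, uIcc_of_le Real.pi_pos.le]
        at h1 h2
      exact hmem s h1.2 h2.1 h2.2
    · rintro s ⟨h1, h2⟩
      simp only [mem_preimage, ofReal_re, ofReal_im, add_re, mul_re, I_re, mul_zero, I_im, mul_one,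
        sub_self, add_zero, add_im, mul_im, zero_add, min_eq_left Real.pi_pos.le,
        max_eq_right Real.pi_pos.le] at h1 h2
      refine DifferentiableAt.differentiableWithinAt ?_
      refine differentiableAt_exp.mul ((hd _ ?_).comp s differentiableAt_exp)
      rw [exp_im]
      exact mul_pos (Real.exp_pos _) (Real.sin_pos_of_pos_of_lt_pi h2.1 h2.2)
  -- The excised half disc contributes $O(r)$ since $f$ is bounded near $0$, while the quantity to
  -- estimate does not depend on $r$.
  rw [← norm_le_zero_iff]
  refine ge_of_tendsto (f := fun r : ℝ => r * (M * (2 + Real.pi))) 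
    (x := nhdsWithin 0 (Ioi 0)) ?_ ?_
  · have : Filter.Tendsto (fun r : ℝ => r * (M * (2 + Real.pi))) (nhds 0) (nhds 0) := by
      simpa using (continuous_id.mul continuous_const).tendsto (0 : ℝ) (f := fun r : ℝ =>
        r * (M * (2 + Real.pi)))
    exact this.mono_left nhdsWithin_le_nhds
  · filter_upwards [Ioo_mem_nhdsGT hR] with r hr using key r hr.1 hr.2

/-! ### The kernel integral and its boundary values. -/

/-- The continuation to the upper half plane of `(1 - y²)^α y^n (ε + i(x - y))^{-2α-1}`. -/
def kernelIntegrand (α : ℝ) (n : ℕ) (ε x : ℝ) (z : ℂ) : ℂ :=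
  upperWeight α z * z ^ n * (ε + Complex.I * (x - z)) ^ ((-(2 * α + 1) : ℝ) : ℂ)

theorem kernel_base_re (ε x : ℝ) (z : ℂ) : ((ε : ℂ) + Complex.I * (x - z)).re = ε + z.im := by
  simp

theorem kernel_base_im (ε x : ℝ) (z : ℂ) : ((ε : ℂ) + Complex.I * (x - z)).im = x - z.re := by
  simp

theorem norm_sub_le_norm_kernel_base {ε x : ℝ} {z : ℂ} (hε : 0 ≤ ε) (hz : 0 ≤ z.im) :
    ‖(x : ℂ) - z‖ ≤ ‖(ε : ℂ) + Complex.I * (x - z)‖ := by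
  rw [Complex.norm_def, Complex.norm_def, Complex.normSq_apply, Complex.normSq_apply,
    kernel_base_re, kernel_base_im]
  refine Real.sqrt_le_sqrt ?_
  simp only [Complex.sub_re, Complex.sub_im, Complex.ofReal_re, Complex.ofReal_im]
  nlinarith [mul_nonneg hε hz, mul_nonneg hε hε]

theorem norm_kernelIntegrand_le {α : ℝ} (hα : 0 < α) (n : ℕ) {ε x δ : ℝ} {z : ℂ} (hε : 0 ≤ ε)
    (hz : 0 ≤ z.im) (hz2 : ‖z‖ ≤ 2) (hδ : 0 < δ) (hx : δ ≤ ‖(x : ℂ) - z‖) :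
    ‖kernelIntegrand α n ε x z‖ ≤ 3 ^ α * 3 ^ α * 2 ^ n * δ ^ (-(2 * α + 1)) := by
  rw [kernelIntegrand, norm_mul, norm_mul, norm_upperWeight, norm_pow, Complex.norm_cpow_real]
  have i1 : ‖1 - z‖ ≤ 3 := (norm_sub_le _ _).trans (by rw [norm_one]; linarith)
  have i2 : ‖1 + z‖ ≤ 3 := (norm_add_le _ _).trans (by rw [norm_one]; linarith)
  have i3 : ‖(ε : ℂ) + Complex.I * (x - z)‖ ^ (-(2 * α + 1)) ≤ δ ^ (-(2 * α + 1)) :=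
    Real.rpow_le_rpow_of_nonpos hδ (hx.trans (norm_sub_le_norm_kernel_base hε hz)) (by linarith)
  gcongr

theorem continuousAt_kernelIntegrand {α : ℝ} (hα : 0 < α) (n : ℕ) {ε x : ℝ} {z : ℂ} (hε : 0 < ε)
    (hz : 0 ≤ z.im) : ContinuousAt (kernelIntegrand α n ε x) z := by
  have h1 : ContinuousAt (fun z : ℂ => (ε : ℂ) + Complex.I * (x - z)) z := by fun_prop
  refine ((continuousAt_upperWeight hα hz).mul (by fun_prop)).mul ?_
  exact h1.cpow continuousAt_const (Or.inl (by rw [kernel_base_re]; linarith))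

theorem differentiableAt_kernelIntegrand {α : ℝ} (n : ℕ) {ε x : ℝ} {z : ℂ} (hε : 0 < ε)
    (hz : 0 < z.im) : DifferentiableAt ℂ (kernelIntegrand α n ε x) z := by
  have h1 : DifferentiableAt ℂ (fun z : ℂ => (ε : ℂ) + Complex.I * (x - z)) z := by fun_prop
  refine ((differentiableAt_upperWeight hz).mul (by fun_prop)).mul ?_
  exact h1.cpow_const (Or.inl (by rw [kernel_base_re]; linarith))

theorem tendsto_kernelIntegrand (α : ℝ) (n : ℕ) {x : ℝ} {z : ℂ} (hz : 0 ≤ z.im) (hx : z ≠ x) :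
    Filter.Tendsto (fun ε : ℝ => kernelIntegrand α n ε x z) (nhdsWithin 0 (Ioi 0))
      (nhds (kernelIntegrand α n 0 x z)) := by
  have h1 : ContinuousAt (fun ε : ℝ => (ε : ℂ) + Complex.I * (x - z)) 0 := by fun_prop
  have h2 : ContinuousAt (fun ε : ℝ => kernelIntegrand α n ε x z) 0 := by
    refine continuousAt_const.mul (h1.cpow continuousAt_const ?_)
    rw [Complex.mem_slitPlane_iff, kernel_base_re, kernel_base_im, zero_add]
    rcases hz.lt_or_eq with h | h
    · exact Or.inl h
    · refine Or.inr fun h3 => hx ?_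
      apply Complex.ext
      · simp only [Complex.ofReal_re]; linarith
      · simp only [Complex.ofReal_im]; exact h.symm
  exact h2.tendsto.mono_left nhdsWithin_le_nhds

/-- The phases multiply to $e^{-i\pi\alpha/2}e^{-i\pi\alpha/2}e^{i\pi(2\alpha+1)/2}=i$ whatever
$\alpha$ is. The exponent $-2\alpha-1$ of the kernel is exactly what makes this work; to the left of
$-1$ the product is $-i$. -/
theorem kernelIntegrand_zero_re_of_one_lt {α : ℝ} (n : ℕ) {x y : ℝ} (hx : |x| < 1) (hy : 1 < y) :
    (kernelIntegrand α n 0 x y).re = 0 := by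
  obtain ⟨hx1, hx2⟩ := abs_lt.1 hx
  have e1 : Complex.I * (1 - (y : ℂ)) = -Complex.I * ((y - 1 : ℝ) : ℂ) := by push_cast; ring
  have e2 : (1 : ℂ) + y = ((1 + y : ℝ) : ℂ) := by push_cast; ring
  have e3 : ((0 : ℝ) : ℂ) + Complex.I * (x - (y : ℂ)) = -Complex.I * ((y - x : ℝ) : ℂ) := by
    push_cast; ring
  have e4 : ∀ a b : ℝ, 0 ≤ a → (a : ℂ) ^ (b : ℂ) = ((a ^ b : ℝ) : ℂ) := fun a b ha =>
    (Complex.ofReal_cpow ha b).symm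
  rw [kernelIntegrand, upperWeight, e1, e2, e3, neg_I_mul_ofReal_cpow (by linarith),
    neg_I_mul_ofReal_cpow (by linarith), neg_I_mul_ofReal_cpow (by linarith),
    e4 _ _ (by linarith), e4 _ _ (by linarith), e4 _ _ (by linarith)]
  have e5 : Complex.exp (-(Real.pi / 2 * Complex.I * α)) *
      Complex.exp (-(Real.pi / 2 * Complex.I * α)) *
      Complex.exp (-(Real.pi / 2 * Complex.I * ((-(2 * α + 1) : ℝ) : ℂ))) = Complex.I := by
    rw [← Complex.exp_add, ← Complex.exp_add]
    refine Eq.trans (congrArg _ ?_) Complex.exp_pi_div_two_mul_I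
    push_cast; ring
  have e6 : ∀ A B C D E F : ℂ, A * E * (B * E) * C * (D * F) = E * E * F * (A * B * C * D) := by
    intros; ring
  rw [e6, e5, ← Complex.ofReal_pow, ← Complex.ofReal_mul, ← Complex.ofReal_mul,
    ← Complex.ofReal_mul, Complex.re_mul_ofReal, Complex.I_re, zero_mul]

theorem kernelIntegrand_zero_re_of_lt_neg_one {α : ℝ} (n : ℕ) {x y : ℝ} (hx : |x| < 1)
    (hy : y < -1) : (kernelIntegrand α n 0 x y).re = 0 := by
  obtain ⟨hx1, hx2⟩ := abs_lt.1 hx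
  have e1 : -Complex.I * (1 + (y : ℂ)) = Complex.I * ((-1 - y : ℝ) : ℂ) := by push_cast; ring
  have e2 : (1 : ℂ) - y = ((1 - y : ℝ) : ℂ) := by push_cast; ring
  have e3 : ((0 : ℝ) : ℂ) + Complex.I * (x - (y : ℂ)) = Complex.I * ((x - y : ℝ) : ℂ) := by
    push_cast; ring
  have e4 : ∀ a b : ℝ, 0 ≤ a → (a : ℂ) ^ (b : ℂ) = ((a ^ b : ℝ) : ℂ) := fun a b ha =>
    (Complex.ofReal_cpow ha b).symm
  rw [kernelIntegrand, upperWeight, e1, e2, e3, I_mul_ofReal_cpow (by linarith),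
    I_mul_ofReal_cpow (by linarith), I_mul_ofReal_cpow (by linarith),
    e4 _ _ (by linarith), e4 _ _ (by linarith), e4 _ _ (by linarith)]
  have e5 : Complex.exp (Real.pi / 2 * Complex.I * α) *
      Complex.exp (Real.pi / 2 * Complex.I * α) *
      Complex.exp (Real.pi / 2 * Complex.I * ((-(2 * α + 1) : ℝ) : ℂ)) = -Complex.I := by
    rw [← Complex.exp_add, ← Complex.exp_add]
    refine Eq.trans (congrArg _ ?_) Complex.exp_neg_pi_div_two_mul_I
    push_cast; ring
  have e6 : ∀ A B C D E F : ℂ, A * E * (B * E) * C * (D * F) = E * E * F * (A * B * C * D) := by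
    intros; ring
  rw [e6, e5, ← Complex.ofReal_pow, ← Complex.ofReal_mul, ← Complex.ofReal_mul,
    ← Complex.ofReal_mul, Complex.re_mul_ofReal, Complex.neg_re, Complex.I_re, neg_zero, zero_mul]

theorem abs_le_norm_sub_of_one_le {δ x y : ℝ} (hx : |x| ≤ 1 - δ) (hy : 1 ≤ |y|) :
    δ ≤ ‖(x : ℂ) - y‖ := by
  rw [← Complex.ofReal_sub, Complex.norm_real, Real.norm_eq_abs, abs_sub_comm]
  linarith [abs_sub_abs_le_abs_sub y x]

theorem le_norm_sub_of_norm_eq_two {δ x : ℝ} {z : ℂ} (hx : |x| ≤ 1 - δ) (hz : ‖z‖ = 2) :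
    δ ≤ ‖(x : ℂ) - z‖ := by
  rw [norm_sub_rev]
  have := norm_sub_norm_le z (x : ℂ)
  rw [hz, Complex.norm_real, Real.norm_eq_abs] at this
  linarith

/-- Radius $2$ keeps the arc away from $\pm1$ and from every $x\in\Lambda$. The integral over
$\Lambda$ is thus traded for pieces on which the singularity at $z=x$ is never approached as
$\varepsilon\to0$. -/
theorem integral_kernelIntegrand_eq {α : ℝ} (hα : 0 < α) (n : ℕ) {ε : ℝ} (hε : 0 < ε) (x : ℝ) :
    ∫ y in (-1 : ℝ)..1, kernelIntegrand α n ε x y =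
      -((∫ y in (-2 : ℝ)..(-1), kernelIntegrand α n ε x y) +
        (∫ y in (1 : ℝ)..2, kernelIntegrand α n ε x y) +
        ∫ θ in (0 : ℝ)..Real.pi, Complex.I * (2 * Complex.exp (θ * Complex.I)) *
          kernelIntegrand α n ε x (2 * Complex.exp (θ * Complex.I))) := by
  have h := integral_boundary_half_disc_eq_zero (f := kernelIntegrand α n ε x) (R := 2)
    two_pos (fun z hz => (continuousAt_kernelIntegrand hα n hε hz.2).continuousWithinAt)
    (fun z hz => differentiableAt_kernelIntegrand n hε hz)
  have hc : Continuous fun y : ℝ => kernelIntegrand α n ε x y :=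
    continuous_iff_continuousAt.2 fun y =>
      (continuousAt_kernelIntegrand hα n hε (by simp)).comp_of_eq
        Complex.continuous_ofReal.continuousAt rfl
  have hs : ∫ y in (-2 : ℝ)..2, kernelIntegrand α n ε x y =
      (∫ y in (-2 : ℝ)..(-1), kernelIntegrand α n ε x y) +
      (∫ y in (-1 : ℝ)..1, kernelIntegrand α n ε x y) +
      ∫ y in (1 : ℝ)..2, kernelIntegrand α n ε x y := by
    rw [intervalIntegral.integral_add_adjacent_intervals (hc.intervalIntegrable _ _)
      (hc.intervalIntegrable _ _), intervalIntegral.integral_add_adjacent_intervals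
      (hc.intervalIntegrable _ _) (hc.intervalIntegrable _ _)]
  rw [hs] at h
  push_cast at h
  linear_combination h

theorem arc_im_nonneg {θ : ℝ} (h0 : 0 ≤ θ) (hπ : θ ≤ Real.pi) :
    0 ≤ (2 * Complex.exp (θ * Complex.I)).im := by
  simp only [Complex.mul_im, Complex.re_ofNat, Complex.im_ofNat, zero_mul, add_zero,
    Complex.exp_ofReal_mul_I_im]
  exact mul_nonneg two_pos.le (Real.sin_nonneg_of_nonneg_of_le_pi h0 hπ)

theorem norm_arc (θ : ℝ) : ‖2 * Complex.exp (θ * Complex.I)‖ = 2 := by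
  rw [norm_mul, Complex.norm_exp_ofReal_mul_I, Complex.norm_ofNat, mul_one]

/-- Uniform bound of the regularised kernel integral away from the end points. -/
theorem norm_integral_kernelIntegrand_le {α : ℝ} (hα : 0 < α) (n : ℕ) {ε δ x : ℝ} (hε : 0 < ε) (hδ : 0 < δ)
    (hx : |x| ≤ 1 - δ) : ‖∫ y in (-1 : ℝ)..1, kernelIntegrand α n ε x y‖ ≤
      (2 + 2 * Real.pi) * (3 ^ α * 3 ^ α * 2 ^ n * δ ^ (-(2 * α + 1))) := by
  set K := 3 ^ α * 3 ^ α * 2 ^ n * δ ^ (-(2 * α + 1)) with hK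
  rw [integral_kernelIntegrand_eq hα n hε, norm_neg]
  have b1 : ‖∫ y in (-2 : ℝ)..(-1), kernelIntegrand α n ε x y‖ ≤ K * |(-1 : ℝ) - (-2)| := by
    refine intervalIntegral.norm_integral_le_of_norm_le_const fun y hy => ?_
    rw [uIoc_of_le (by norm_num)] at hy
    have hy' : 1 ≤ |y| := by rw [abs_of_neg (by linarith [hy.2])]; linarith [hy.2]
    refine norm_kernelIntegrand_le hα n hε.le (by simp) ?_ hδ (abs_le_norm_sub_of_one_le hx hy')
    rw [Complex.norm_real, Real.norm_eq_abs, abs_of_neg (by linarith [hy.2])]; linarith [hy.1]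
  have b2 : ‖∫ y in (1 : ℝ)..2, kernelIntegrand α n ε x y‖ ≤ K * |(2 : ℝ) - 1| := by
    refine intervalIntegral.norm_integral_le_of_norm_le_const fun y hy => ?_
    rw [uIoc_of_le (by norm_num)] at hy
    have hy' : 1 ≤ |y| := by rw [abs_of_pos (by linarith [hy.1])]; linarith [hy.1]
    refine norm_kernelIntegrand_le hα n hε.le (by simp) ?_ hδ (abs_le_norm_sub_of_one_le hx hy')
    rw [Complex.norm_real, Real.norm_eq_abs, abs_of_pos (by linarith [hy.1])]; linarith [hy.2]
  have b3 : ‖∫ θ in (0 : ℝ)..Real.pi, Complex.I * (2 * Complex.exp (θ * Complex.I)) *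
      kernelIntegrand α n ε x (2 * Complex.exp (θ * Complex.I))‖ ≤ 2 * K * |Real.pi - 0| := by
    refine intervalIntegral.norm_integral_le_of_norm_le_const fun θ hθ => ?_
    rw [uIoc_of_le Real.pi_pos.le] at hθ
    rw [norm_mul, norm_mul, Complex.norm_I, one_mul, norm_arc]
    gcongr
    exact norm_kernelIntegrand_le hα n hε.le (arc_im_nonneg hθ.1.le hθ.2) (norm_arc θ).le hδ
      (le_norm_sub_of_norm_eq_two hx (norm_arc θ))
  norm_num at b1 b2
  rw [sub_zero, abs_of_pos Real.pi_pos] at b3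
  refine (norm_add_le _ _).trans ?_
  refine (add_le_add (norm_add_le _ _) le_rfl).trans ?_
  linarith

/-- Real part of the boundary values of the kernel integral. -/
theorem tendsto_re_integral_kernelIntegrand {α : ℝ} (hα : 0 < α) (n : ℕ) {x : ℝ} (hx : |x| < 1) :
    Filter.Tendsto (fun ε : ℝ => (∫ y in (-1 : ℝ)..1, kernelIntegrand α n ε x y).re)
      (nhdsWithin 0 (Ioi 0))
      (nhds (-∫ θ in (0 : ℝ)..Real.pi, Complex.I * (2 * Complex.exp (θ * Complex.I)) *
          kernelIntegrand α n 0 x (2 * Complex.exp (θ * Complex.I))).re) := by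
  set δ := 1 - |x| with hδ'
  have hδ : 0 < δ := by linarith
  have hxδ : |x| ≤ 1 - δ := by rw [hδ']; linarith
  set K := 3 ^ α * 3 ^ α * 2 ^ n * δ ^ (-(2 * α + 1)) with hK
  have hpos : ∀ᶠ ε : ℝ in nhdsWithin 0 (Ioi 0), 0 < ε := self_mem_nhdsWithin
  have hc : ∀ ε : ℝ, 0 < ε → Continuous fun y : ℝ => kernelIntegrand α n ε x y := fun ε hε =>
    continuous_iff_continuousAt.2 fun y =>
      (continuousAt_kernelIntegrand hα n hε (by simp)).comp_of_eq
        Complex.continuous_ofReal.continuousAt rfl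
  have t1 : Filter.Tendsto (fun ε : ℝ => ∫ y in (-2 : ℝ)..(-1), kernelIntegrand α n ε x y)
      (nhdsWithin 0 (Ioi 0)) (nhds (∫ y in (-2 : ℝ)..(-1), kernelIntegrand α n 0 x y)) := by
    refine intervalIntegral.tendsto_integral_filter_of_dominated_convergence (fun _ => K)
      (hpos.mono fun ε hε => (hc ε hε).aestronglyMeasurable) (hpos.mono fun ε hε => ?_)
      (by simp) (.of_forall fun y hy => ?_)
    · refine .of_forall fun y hy => ?_
      rw [uIoc_of_le (by norm_num)] at hy
      have hy' : 1 ≤ |y| := by rw [abs_of_neg (by linarith [hy.2])]; linarith [hy.2]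
      refine norm_kernelIntegrand_le hα n hε.le (by simp) ?_ hδ (abs_le_norm_sub_of_one_le hxδ hy')
      rw [Complex.norm_real, Real.norm_eq_abs, abs_of_neg (by linarith [hy.2])]; linarith [hy.1]
    · rw [uIoc_of_le (by norm_num)] at hy
      refine tendsto_kernelIntegrand α n (by simp) fun h => ?_
      rw [Complex.ofReal_inj] at h
      linarith [hy.2, (abs_lt.1 hx).1]
  have t2 : Filter.Tendsto (fun ε : ℝ => ∫ y in (1 : ℝ)..2, kernelIntegrand α n ε x y)
      (nhdsWithin 0 (Ioi 0)) (nhds (∫ y in (1 : ℝ)..2, kernelIntegrand α n 0 x y)) := by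
    refine intervalIntegral.tendsto_integral_filter_of_dominated_convergence (fun _ => K)
      (hpos.mono fun ε hε => (hc ε hε).aestronglyMeasurable) (hpos.mono fun ε hε => ?_)
      (by simp) (.of_forall fun y hy => ?_)
    · refine .of_forall fun y hy => ?_
      rw [uIoc_of_le (by norm_num)] at hy
      have hy' : 1 ≤ |y| := by rw [abs_of_pos (by linarith [hy.1])]; linarith [hy.1]
      refine norm_kernelIntegrand_le hα n hε.le (by simp) ?_ hδ (abs_le_norm_sub_of_one_le hxδ hy')
      rw [Complex.norm_real, Real.norm_eq_abs, abs_of_pos (by linarith [hy.1])]; linarith [hy.2]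
    · rw [uIoc_of_le (by norm_num)] at hy
      refine tendsto_kernelIntegrand α n (by simp) fun h => ?_
      rw [Complex.ofReal_inj] at h
      linarith [hy.1, (abs_lt.1 hx).2]
  have t3 : Filter.Tendsto (fun ε : ℝ => ∫ θ in (0 : ℝ)..Real.pi,
      Complex.I * (2 * Complex.exp (θ * Complex.I)) *
        kernelIntegrand α n ε x (2 * Complex.exp (θ * Complex.I)))
      (nhdsWithin 0 (Ioi 0)) (nhds (∫ θ in (0 : ℝ)..Real.pi,
        Complex.I * (2 * Complex.exp (θ * Complex.I)) *
          kernelIntegrand α n 0 x (2 * Complex.exp (θ * Complex.I)))) := by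
    refine intervalIntegral.tendsto_integral_filter_of_dominated_convergence (fun _ => 2 * K)
      (hpos.mono fun ε hε => ?_) (hpos.mono fun ε hε => ?_)
      (by simp) (.of_forall fun θ hθ => ?_)
    · refine ContinuousOn.aestronglyMeasurable ?_ measurableSet_uIoc
      refine ContinuousOn.mul (by fun_prop) fun θ hθ => ?_
      rw [uIoc_of_le Real.pi_pos.le] at hθ
      refine ContinuousAt.continuousWithinAt ?_
      exact (continuousAt_kernelIntegrand hα n hε (arc_im_nonneg hθ.1.le hθ.2)).comp_of_eq
        (f := fun θ : ℝ => 2 * Complex.exp (θ * Complex.I)) (by fun_prop) rfl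
    · refine .of_forall fun θ hθ => ?_
      rw [uIoc_of_le Real.pi_pos.le] at hθ
      rw [norm_mul, norm_mul, Complex.norm_I, one_mul, norm_arc]
      gcongr
      exact norm_kernelIntegrand_le hα n hε.le (arc_im_nonneg hθ.1.le hθ.2) (norm_arc θ).le hδ
        (le_norm_sub_of_norm_eq_two hxδ (norm_arc θ))
    · rw [uIoc_of_le Real.pi_pos.le] at hθ
      refine (tendsto_kernelIntegrand α n (arc_im_nonneg hθ.1.le hθ.2) fun h => ?_).const_mul _
      have h2 := norm_arc θ
      rw [h, Complex.norm_real, Real.norm_eq_abs] at h2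
      linarith
  have hre : ∀ a b : ℝ, a ≤ b → (∀ y ∈ Ioo a b, (kernelIntegrand α n 0 x y).re = 0) →
      (∫ y in a..b, kernelIntegrand α n 0 x y).re = 0 := by
    intro a b hab h
    -- A non-integrable integrand has integral $0$ by convention, so integrability at
    -- $\varepsilon=0$ need not be established.
    by_cases hi : IntervalIntegrable (fun y : ℝ => kernelIntegrand α n 0 x y) volume a b
    · have h2 := Complex.reCLM.intervalIntegral_comp_comm hi
      simp only [Complex.reCLM_apply] at h2
      rw [← h2, intervalIntegral.integral_of_le hab, integral_Ioc_eq_integral_Ioo]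
      exact setIntegral_eq_zero_of_forall_eq_zero h
    · rw [intervalIntegral.integral_undef hi, Complex.zero_re]
  have z1 := hre (-2) (-1) (by norm_num) fun y hy =>
    kernelIntegrand_zero_re_of_lt_neg_one n hx hy.2
  have z2 := hre 1 2 (by norm_num) fun y hy => kernelIntegrand_zero_re_of_one_lt n hx hy.1
  have t4 := (Complex.continuous_re.tendsto _).comp ((t1.add t2).add t3).neg
  have e : (-((∫ y in (-2 : ℝ)..(-1), kernelIntegrand α n 0 x y) +
      (∫ y in (1 : ℝ)..2, kernelIntegrand α n 0 x y) +
      ∫ θ in (0 : ℝ)..Real.pi, Complex.I * (2 * Complex.exp (θ * Complex.I)) *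
          kernelIntegrand α n 0 x (2 * Complex.exp (θ * Complex.I)))).re =
      (-∫ θ in (0 : ℝ)..Real.pi, Complex.I * (2 * Complex.exp (θ * Complex.I)) *
          kernelIntegrand α n 0 x (2 * Complex.exp (θ * Complex.I))).re := by
    simp only [Complex.neg_re, Complex.add_re, z1, z2, zero_add]
  rw [e] at t4
  refine t4.congr' (hpos.mono fun ε hε => ?_)
  simp only [Function.comp_apply]
  rw [← integral_kernelIntegrand_eq hα n hε]

/-! ### Expansion at infinity and the generating function. -/

/-- The arguments lie in $[-\pi/2,\pi/2]$ and $(-\pi/2,\pi/2)$, so their sum stays within the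
principal range. -/
theorem mul_cpow_of_re_nonneg {a b : ℂ} (ha : a ≠ 0) (ha' : 0 ≤ a.re) (hb : 0 < b.re) (c : ℂ) :
    (a * b) ^ c = a ^ c * b ^ c := by
  have hb0 : b ≠ 0 := by rintro rfl; simp at hb
  have h1 := abs_le.1 (Complex.abs_arg_le_pi_div_two_iff.2 ha')
  have h2 := abs_lt.1 (Complex.abs_arg_lt_pi_div_two_iff.2 (Or.inl hb))
  rw [Complex.cpow_def_of_ne_zero (mul_ne_zero ha hb0), Complex.cpow_def_of_ne_zero ha,
    Complex.cpow_def_of_ne_zero hb0, Complex.log_mul ha hb0 ⟨by linarith, by linarith⟩,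
    add_mul, Complex.exp_add]

theorem one_sub_re_pos {w : ℂ} (hw : ‖w‖ < 1) : 0 < (1 - w).re := by
  rw [Complex.sub_re, Complex.one_re]
  linarith [Complex.re_le_norm w]

/-- All three bases contain the factor $a=-iz$, whose exponents sum to
$\alpha+\alpha-(2\alpha+1)=-1$. What remains is single-valued in $z^{-1}$ near infinity and can be
expanded in a power series. -/
theorem kernelIntegrand_zero_arc (α : ℝ) (n : ℕ) {x : ℝ} (hx : |x| < 1) {z : ℂ} (hz : 0 ≤ z.im)
    (hz2 : ‖z‖ = 2) : Complex.I * z * kernelIntegrand α n 0 x z =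
      -(z ^ n * ((1 - z⁻¹) ^ (α : ℂ) * (1 + z⁻¹) ^ (α : ℂ) *
        (1 - x * z⁻¹) ^ (-((2 * α + 1 : ℝ) : ℂ)))) := by
  have hz0 : z ≠ 0 := by rintro rfl; simp at hz2
  have hI : Complex.I ≠ 0 := Complex.I_ne_zero
  set a : ℂ := -Complex.I * z with ha
  have ha0 : a ≠ 0 := mul_ne_zero (neg_ne_zero.2 hI) hz0
  have har : 0 ≤ a.re := by simpa [ha] using hz
  have hi : ‖z⁻¹‖ < 1 := by rw [norm_inv, hz2]; norm_num
  have hi2 : ‖(x : ℂ) * z⁻¹‖ < 1 := by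
    rw [norm_mul, Complex.norm_real, Real.norm_eq_abs]
    nlinarith [abs_nonneg x, norm_nonneg z⁻¹]
  have e1 : Complex.I * (1 - z) = a * (1 - z⁻¹) := by
    rw [ha]; field_simp; ring
  have e2 : -Complex.I * (1 + z) = a * (1 - -z⁻¹) := by
    rw [ha]; field_simp; ring
  have e3 : ((0 : ℝ) : ℂ) + Complex.I * (x - z) = a * (1 - x * z⁻¹) := by
    rw [ha]; field_simp; push_cast; ring
  have e4 : a ^ (α : ℂ) * a ^ (α : ℂ) * a ^ ((-(2 * α + 1) : ℝ) : ℂ) = a⁻¹ := by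
    rw [← Complex.cpow_add _ _ ha0, ← Complex.cpow_add _ _ ha0, ← Complex.cpow_neg_one]
    congr 1
    push_cast; ring
  rw [kernelIntegrand, upperWeight, e1, e2, e3,
    mul_cpow_of_re_nonneg ha0 har (one_sub_re_pos hi),
    mul_cpow_of_re_nonneg ha0 har (one_sub_re_pos (by rwa [norm_neg])),
    mul_cpow_of_re_nonneg ha0 har (one_sub_re_pos hi2), sub_neg_eq_add, ← Complex.ofReal_neg]
  have e5 : Complex.I * z * a⁻¹ = -1 := by
    rw [ha]; field_simp
  linear_combination (z ^ n * ((1 - z⁻¹) ^ (α : ℂ) * (1 + z⁻¹) ^ (α : ℂ) *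
        (1 - x * z⁻¹) ^ ((-(2 * α + 1) : ℝ) : ℂ))) * (Complex.I * z * e4 + e5)

/-- The `n`-th Taylor coefficient of `(1 - t)^{-β}`. -/
def binomCoeff (β : ℝ) (n : ℕ) : ℝ := Ring.choose (β + n - 1) n

theorem hasSum_binomCoeff (β : ℝ) {t : ℂ} (ht : ‖t‖ < 1) :
    HasSum (fun n => (binomCoeff β n : ℂ) * t ^ n) ((1 - t) ^ (-(β : ℂ))) := by
  have h := (Complex.one_div_one_sub_cpow_hasFPowerSeriesOnBall_zero (β : ℂ)).hasSum
    (y := t) (by rw [Metric.mem_eball, edist_zero_right, enorm_eq_nnnorm,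
      ENNReal.coe_lt_one_iff]; exact ht)
  simp only [FormalMultilinearSeries.ofScalars_apply_eq, zero_add, one_div, ← Complex.cpow_neg,
    smul_eq_mul] at h
  refine h.congr_fun fun n => ?_
  rw [binomCoeff, Complex.ofReal_choose]
  push_cast
  rfl

theorem binomCoeff_zero (β : ℝ) : binomCoeff β 0 = 1 := by
  simp [binomCoeff]

theorem eval_ascPochhammer_eq_Gamma {β : ℝ} (hβ : 0 < β) (n : ℕ) :
    (ascPochhammer ℝ n).eval β = Real.Gamma (β + n) / Real.Gamma β := by
  have hG : Real.Gamma β ≠ 0 := (Real.Gamma_pos_of_pos hβ).ne'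
  induction n with
  | zero => simp [hG]
  | succ n ih =>
    have h : Real.Gamma (β + n + 1) = (β + n) * Real.Gamma (β + n) :=
      Real.Gamma_add_one (by positivity)
    rw [ascPochhammer_succ_eval, ih]
    push_cast
    rw [← add_assoc, h]
    ring

theorem binomCoeff_eq_Gamma {β : ℝ} (hβ : 0 < β) (n : ℕ) :
    binomCoeff β n = Real.Gamma (β + n) / (Real.Gamma β * n.factorial) := by
  have h := Ring.factorial_nsmul_multichoose_eq_ascPochhammer β n
  rw [Ring.multichoose_eq, nsmul_eq_mul, Polynomial.ascPochhammer_smeval_eq_eval,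
    eval_ascPochhammer_eq_Gamma hβ] at h
  have hn : (n.factorial : ℝ) ≠ 0 := by positivity
  rw [binomCoeff, ← div_div, ← h]
  field_simp

theorem hasSum_cauchy_product {a b : ℕ → ℝ} {t A B : ℂ} (ha : HasSum (fun n => (a n : ℂ) * t ^ n) A)
    (hb : HasSum (fun n => (b n : ℂ) * t ^ n) B) :
    HasSum (fun n => ((∑ k ∈ Finset.range (n + 1), a k * b (n - k) : ℝ) : ℂ) * t ^ n) (A * B) := by
  have h := hasSum_sum_range_mul_of_summable_norm ha.summable.norm hb.summable.norm
  rw [ha.tsum_eq, hb.tsum_eq] at h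
  refine h.congr_fun fun n => ?_
  rw [Complex.ofReal_sum, Finset.sum_mul]
  refine Finset.sum_congr rfl fun k hk => ?_
  obtain ⟨m, rfl⟩ := Nat.exists_eq_add_of_le (Nat.lt_succ_iff.1 (Finset.mem_range.1 hk))
  rw [Nat.add_sub_cancel_left, pow_add]
  push_cast; ring

/-- The `n`-th Taylor coefficient of `(1 - t)^α (1 + t)^α`. -/
def weightCoeff (α : ℝ) (n : ℕ) : ℝ :=
  ∑ k ∈ Finset.range (n + 1), binomCoeff (-α) k * ((-1) ^ (n - k) * binomCoeff (-α) (n - k))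

theorem weightCoeff_zero (α : ℝ) : weightCoeff α 0 = 1 := by
  simp [weightCoeff, binomCoeff_zero]

/-- The `n`-th Taylor coefficient in `t` of `(1 - t)^α (1 + t)^α (1 - x t)^{-2α-1}`. -/
def genCoeff (α x : ℝ) (n : ℕ) : ℝ :=
  ∑ k ∈ Finset.range (n + 1), (x ^ k * binomCoeff (2 * α + 1) k) * weightCoeff α (n - k)

theorem hasSum_genCoeff (α : ℝ) {x : ℝ} (hx : |x| < 1) {t : ℂ} (ht : ‖t‖ < 1) :
    HasSum (fun n => (genCoeff α x n : ℂ) * t ^ n)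
      ((1 - t) ^ (α : ℂ) * (1 + t) ^ (α : ℂ) * (1 - x * t) ^ (-((2 * α + 1 : ℝ) : ℂ))) := by
  have h1 := hasSum_binomCoeff (-α) ht
  have h2 := hasSum_binomCoeff (-α) (t := -t) (by rwa [norm_neg])
  have h3 := hasSum_binomCoeff (2 * α + 1) (t := x * t) (by
    rw [norm_mul, Complex.norm_real, Real.norm_eq_abs]
    nlinarith [abs_nonneg x, norm_nonneg t])
  simp only [Complex.ofReal_neg, neg_neg, sub_neg_eq_add] at h1 h2
  have h2' : HasSum (fun n => (((-1) ^ n * binomCoeff (-α) n : ℝ) : ℂ) * t ^ n)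
      ((1 + t) ^ (α : ℂ)) := by
    refine h2.congr_fun fun n => ?_
    rw [neg_pow t]
    push_cast; ring
  have h3' : HasSum (fun n => ((x ^ n * binomCoeff (2 * α + 1) n : ℝ) : ℂ) * t ^ n)
      ((1 - x * t) ^ (-((2 * α + 1 : ℝ) : ℂ))) := by
    refine h3.congr_fun fun n => ?_
    rw [mul_pow]
    push_cast; ring
  have h4 := hasSum_cauchy_product h3' (hasSum_cauchy_product h1 h2')
  rw [mul_comm (_ ^ (-((2 * α + 1 : ℝ) : ℂ)))] at h4
  simpa only [genCoeff, weightCoeff] using h4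

theorem integral_cos_int_mul (k : ℤ) :
    ∫ θ in (0 : ℝ)..Real.pi, Real.cos (k * θ) = if k = 0 then Real.pi else 0 := by
  split_ifs with h
  · simp [h]
  · have hk : (k : ℝ) ≠ 0 := by exact_mod_cast h
    rw [intervalIntegral.integral_comp_mul_left _ hk]
    simp [Real.sin_int_mul_pi]

/-- The term of index $m$ is a real multiple of $e^{i(n-m)\theta}$. The real part of its integral
over a half circle is that of $\cos((n-m)\theta)$ over $[0,\pi]$, which vanishes unless $m=n$; so
half a circle already extracts the coefficient. -/
theorem re_integral_arc (α : ℝ) (n : ℕ) {x : ℝ} (hx : |x| < 1) :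
    (-∫ θ in (0 : ℝ)..Real.pi, Complex.I * (2 * Complex.exp (θ * Complex.I)) *
      kernelIntegrand α n 0 x (2 * Complex.exp (θ * Complex.I))).re =
      Real.pi * genCoeff α x n := by
  -- On the arc $|z^{-1}|=1/2$, so the series at $t=1/2$ dominates termwise.
  have hs : Summable fun m => ‖(genCoeff α x m : ℂ) * (2⁻¹ : ℂ) ^ m‖ :=
    (hasSum_genCoeff α hx (t := 2⁻¹) (by norm_num)).summable.norm
  have hF : ∀ (m : ℕ) (θ : ℝ), ‖(genCoeff α x m : ℂ) * (2 * Complex.exp (θ * Complex.I)) ^ n *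
      (2 * Complex.exp (θ * Complex.I))⁻¹ ^ m‖ =
      2 ^ n * ‖(genCoeff α x m : ℂ) * (2⁻¹ : ℂ) ^ m‖ := by
    intro m θ
    rw [norm_mul, norm_mul, norm_pow, norm_pow, norm_inv, norm_arc, norm_mul, norm_pow, norm_inv,
      Complex.norm_ofNat]
    ring
  have h := intervalIntegral.hasSum_integral_of_dominated_convergence (a := 0) (b := Real.pi)
    (μ := volume) (F := fun (m : ℕ) (θ : ℝ) => (genCoeff α x m : ℂ) *
      (2 * Complex.exp (θ * Complex.I)) ^ n * (2 * Complex.exp (θ * Complex.I))⁻¹ ^ m)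
    (f := fun θ : ℝ => -(Complex.I * (2 * Complex.exp (θ * Complex.I)) *
      kernelIntegrand α n 0 x (2 * Complex.exp (θ * Complex.I))))
    (fun m _ => 2 ^ n * ‖(genCoeff α x m : ℂ) * (2⁻¹ : ℂ) ^ m‖) ?_ ?_ ?_ ?_ ?_
  · rw [intervalIntegral.integral_neg] at h
    have h2 := (Complex.hasSum_re h)
    have h3 : ∀ m : ℕ, (∫ θ in (0 : ℝ)..Real.pi, (genCoeff α x m : ℂ) *
        (2 * Complex.exp (θ * Complex.I)) ^ n * (2 * Complex.exp (θ * Complex.I))⁻¹ ^ m).re =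
        if m = n then Real.pi * genCoeff α x n else 0 := by
      intro m
      have e : ∀ θ : ℝ, (genCoeff α x m : ℂ) *
        (2 * Complex.exp (θ * Complex.I)) ^ n * (2 * Complex.exp (θ * Complex.I))⁻¹ ^ m =
        ((genCoeff α x m * 2 ^ n * 2⁻¹ ^ m : ℝ) : ℂ) *
          Complex.exp ((((((n : ℤ) - m : ℤ) : ℝ) * θ : ℝ) : ℂ) * Complex.I) := by
        intro θ
        have : ((((((n : ℤ) - m : ℤ) : ℝ) * θ : ℝ) : ℂ) * Complex.I) =
            (n : ℂ) * (θ * Complex.I) + (m : ℂ) * (-(θ * Complex.I)) := by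
          push_cast; ring
        rw [this, Complex.exp_add, Complex.exp_nat_mul, Complex.exp_nat_mul, mul_inv,
          Complex.exp_neg, mul_pow, mul_pow]
        push_cast; ring
      have hcont : Continuous fun θ : ℝ => ((genCoeff α x m * 2 ^ n * 2⁻¹ ^ m : ℝ) : ℂ) *
          Complex.exp ((((((n : ℤ) - m : ℤ) : ℝ) * θ : ℝ) : ℂ) * Complex.I) := by fun_prop
      simp only [e]
      have h4 := Complex.reCLM.intervalIntegral_comp_comm (hcont.intervalIntegrable 0 Real.pi
        (μ := volume))
      simp only [Complex.reCLM_apply, Complex.re_ofReal_mul, Complex.exp_ofReal_mul_I_re] at h4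
      rw [← h4, intervalIntegral.integral_const_mul, integral_cos_int_mul]
      by_cases hmn : m = n
      · subst hmn
        simp only [sub_self, if_true]
        rw [inv_pow, mul_assoc (genCoeff α x m), mul_inv_cancel₀ (by positivity)]
        ring
      · rw [if_neg hmn, if_neg (by omega), mul_zero]
    simp only [h3] at h2
    exact h2.unique (hasSum_ite_eq n _)
  · intro m
    have : Continuous fun θ : ℝ => (2 * Complex.exp (θ * Complex.I))⁻¹ :=
      Continuous.inv₀ (by fun_prop) fun θ => by simp [Complex.exp_ne_zero]
    exact Continuous.aestronglyMeasurable (by fun_prop)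
  · exact fun m => .of_forall fun θ _ => (hF m θ).le
  · exact .of_forall fun θ _ => hs.mul_left _
  · simp
  · refine .of_forall fun θ hθ => ?_
    rw [uIoc_of_le Real.pi_pos.le] at hθ
    rw [kernelIntegrand_zero_arc α n hx (arc_im_nonneg hθ.1.le hθ.2) (norm_arc θ), neg_neg]
    have h5 := (hasSum_genCoeff α hx (t := (2 * Complex.exp (θ * Complex.I))⁻¹)
      (by rw [norm_inv, norm_arc]; norm_num)).mul_left ((2 * Complex.exp (θ * Complex.I)) ^ n)
    refine h5.congr_fun fun m => ?_
    ring

theorem tendsto_re_integral_kernelIntegrand_genCoeff {α : ℝ} (hα : 0 < α) (n : ℕ) {x : ℝ}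
    (hx : |x| < 1) :
    Filter.Tendsto (fun ε : ℝ => (∫ y in (-1 : ℝ)..1, kernelIntegrand α n ε x y).re)
      (nhdsWithin 0 (Ioi 0)) (nhds (Real.pi * genCoeff α x n)) := by
  rw [← re_integral_arc α n hx]
  exact tendsto_re_integral_kernelIntegrand hα n hx

/-! ### Laplace transforms and the transform of the regularised symbol. -/

theorem integrableOn_rpow_mul_exp_neg_mul {s k : ℝ} (hs : -1 < s) (hk : 0 < k) :
    IntegrableOn (fun t : ℝ => t ^ s * Real.exp (-(k * t))) (Ioi 0) := by
  refine (integrableOn_rpow_mul_exp_neg_mul_rpow (s := s) (p := 1) hs zero_lt_one hk).congr_fun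
    (fun t _ => ?_) measurableSet_Ioi
  simp

theorem norm_cexp_neg_mul_ofReal (z : ℂ) (t : ℝ) :
    ‖Complex.exp (-(z * t))‖ = Real.exp (-(z.re * t)) := by
  rw [Complex.norm_exp]; simp

theorem aestronglyMeasurable_rpow_mul_cexp (s : ℝ) (z : ℂ) (μ : Measure ℝ) :
    AEStronglyMeasurable (fun t : ℝ => ((t ^ s : ℝ) : ℂ) * Complex.exp (-(z * t))) μ := by
  refine Measurable.aestronglyMeasurable ?_
  fun_prop

theorem hasDerivAt_laplace_rpow {s : ℝ} (hs : 0 ≤ s) {z : ℂ} (hz : 0 < z.re) :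
    HasDerivAt (fun z : ℂ => ∫ t : ℝ in Ioi 0, ((t ^ s : ℝ) : ℂ) * Complex.exp (-(z * t)))
      (∫ t : ℝ in Ioi 0, ((t ^ s : ℝ) : ℂ) * (Complex.exp (-(z * t)) * -t)) z := by
  -- The half plane $\mathrm{Re}\,w>\mathrm{Re}\,z/2$ is a neighbourhood of $z$ on which a single
  -- exponential dominates the derivatives.
  refine (hasDerivAt_integral_of_dominated_loc_of_deriv_le
    (F := fun (z : ℂ) (t : ℝ) => ((t ^ s : ℝ) : ℂ) * Complex.exp (-(z * t)))
    (F' := fun (z : ℂ) (t : ℝ) => ((t ^ s : ℝ) : ℂ) * (Complex.exp (-(z * t)) * -t))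
    (bound := fun t : ℝ => t ^ (s + 1) * Real.exp (-(z.re / 2 * t)))
    (s := {w : ℂ | z.re / 2 < w.re}) ?_ ?_ ?_ ?_ ?_ ?_ ?_).2
  · exact (isOpen_lt continuous_const Complex.continuous_re).mem_nhds
      (show z.re / 2 < z.re by linarith)
  · exact .of_forall fun w => aestronglyMeasurable_rpow_mul_cexp s w _
  · refine (integrableOn_rpow_mul_exp_neg_mul (s := s) (by linarith) hz).mono'
      (aestronglyMeasurable_rpow_mul_cexp s z _) ?_
    filter_upwards [ae_restrict_mem measurableSet_Ioi] with t ht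
    rw [norm_mul, norm_cexp_neg_mul_ofReal, Complex.norm_real,
      Real.norm_of_nonneg (Real.rpow_nonneg (le_of_lt ht) s)]
  · refine Measurable.aestronglyMeasurable ?_
    fun_prop
  · filter_upwards [ae_restrict_mem measurableSet_Ioi] with t ht w hw
    have ht0 : 0 < t := ht
    rw [norm_mul, norm_mul, norm_neg, norm_cexp_neg_mul_ofReal, Complex.norm_real,
      Complex.norm_real, Real.norm_of_nonneg (Real.rpow_nonneg (le_of_lt ht) s),
      Real.norm_of_nonneg ht0.le, Real.rpow_add ht0, Real.rpow_one]
    have : Real.exp (-(w.re * t)) ≤ Real.exp (-(z.re / 2 * t)) := by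
      refine Real.exp_le_exp.2 (neg_le_neg (mul_le_mul_of_nonneg_right (le_of_lt hw) ht0.le))
    calc t ^ s * (Real.exp (-(w.re * t)) * t) = t ^ s * t * Real.exp (-(w.re * t)) := by ring
      _ ≤ _ := by gcongr
  · exact integrableOn_rpow_mul_exp_neg_mul (by linarith) (by linarith)
  · refine .of_forall fun t w _ => ?_
    have h1 : HasDerivAt (fun w : ℂ => -(w * t)) (-(t : ℂ)) w := by
      have := ((hasDerivAt_id w).mul_const (t : ℂ)).neg
      rwa [one_mul] at this
    exact h1.cexp.const_mul _

/-- The Laplace transform of a power, at complex points of the right half plane. -/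
theorem integral_rpow_mul_cexp {s : ℝ} (hs : 0 ≤ s) {z : ℂ} (hz : 0 < z.re) :
    ∫ t : ℝ in Ioi 0, ((t ^ s : ℝ) : ℂ) * Complex.exp (-(z * t)) =
      Real.Gamma (s + 1) * z ^ ((-(s + 1) : ℝ) : ℂ) := by
  have ho : IsOpen {w : ℂ | 0 < w.re} := isOpen_lt continuous_const Complex.continuous_re
  have hF : AnalyticOnNhd ℂ
      (fun z : ℂ => ∫ t : ℝ in Ioi 0, ((t ^ s : ℝ) : ℂ) * Complex.exp (-(z * t)))
      {w : ℂ | 0 < w.re} := by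
    refine DifferentiableOn.analyticOnNhd (fun w hw => ?_) ho
    exact (hasDerivAt_laplace_rpow hs hw).differentiableAt.differentiableWithinAt
  have hG : AnalyticOnNhd ℂ
      (fun z : ℂ => Real.Gamma (s + 1) * z ^ ((-(s + 1) : ℝ) : ℂ)) {w : ℂ | 0 < w.re} := by
    refine DifferentiableOn.analyticOnNhd (fun w hw => ?_) ho
    exact ((differentiableAt_id.cpow_const (Or.inl hw)).const_mul _).differentiableWithinAt
  have hpre : IsPreconnected {w : ℂ | 0 < w.re} :=
    (convex_halfSpace_re_gt 0).isPreconnected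
  refine hF.eqOn_of_preconnected_of_frequently_eq hG hpre (z₀ := 1) (by simp) ?_ hz
  have hreal : ∀ r : ℝ, 0 < r →
      ∫ t : ℝ in Ioi 0, ((t ^ s : ℝ) : ℂ) * Complex.exp (-((r : ℂ) * t)) =
      Real.Gamma (s + 1) * (r : ℂ) ^ ((-(s + 1) : ℝ) : ℂ) := by
    intro r hr
    have h := Real.integral_rpow_mul_exp_neg_mul_Ioi (a := s + 1) (by linarith) hr
    rw [add_sub_cancel_right, one_div, Real.inv_rpow hr.le, ← Real.rpow_neg hr.le] at h
    rw [← Complex.ofReal_cpow hr.le, ← Complex.ofReal_mul, mul_comm, ← h, ← integral_complex_ofReal]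
    congr 1 with t
    push_cast
    rfl
  -- The real points $1+1/(k+1)$ accumulate at $1$ without reaching it, as the identity theorem
  -- requires.
  have ht : Filter.Tendsto (fun k : ℕ => ((1 + 1 / ((k : ℝ) + 1) : ℝ) : ℂ)) Filter.atTop
      (nhdsWithin 1 {1}ᶜ) := by
    refine tendsto_nhdsWithin_iff.2 ⟨?_, .of_forall fun k => ?_⟩
    · have := (tendsto_one_div_add_atTop_nhds_zero_nat (𝕜 := ℝ)).const_add 1
      rw [add_zero] at this
      rw [← Complex.ofReal_one]
      exact (Complex.continuous_ofReal.tendsto _).comp this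
    · have : (1 : ℝ) + 1 / ((k : ℝ) + 1) ≠ 1 := by
        have : (0 : ℝ) < 1 / ((k : ℝ) + 1) := by positivity
        linarith
      simpa only [mem_compl_iff, mem_singleton_iff, Complex.ofReal_eq_one] using this
  refine ht.frequently (Filter.Frequently.of_forall fun k => ?_)
  exact hreal _ (by positivity)

theorem integrable_comp_abs {f : ℝ → ℝ} (hf : IntegrableOn f (Ioi 0)) :
    Integrable fun x : ℝ => f |x| := by
  have h1 : IntegrableOn (fun x => f |x|) (Ioi 0) :=
    hf.congr_fun (fun x (hx : 0 < x) => by rw [abs_of_pos hx]) measurableSet_Ioi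
  have h2 : IntegrableOn (fun x => f |x|) (Iic 0) := by
    rw [← Measure.map_neg_eq_self (volume : Measure ℝ)]
    have m : MeasurableEmbedding fun x : ℝ => -x := (Homeomorph.neg ℝ).measurableEmbedding
    rw [m.integrableOn_map_iff]
    simp_rw [Function.comp_def, abs_neg, neg_preimage, neg_Iic, neg_zero]
    exact (Iff.mpr integrableOn_Ici_iff_integrableOn_Ioi) h1
  rw [← integrableOn_univ, ← Iic_union_Ioi (a := (0 : ℝ))]
  exact h2.union h1

/-- The regularised symbol `|ξ|^{2α} e^{-ε|ξ|}`. -/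
def regSymbol (α ε ξ : ℝ) : ℂ := ((|ξ| ^ (2 * α) * Real.exp (-(ε * |ξ|)) : ℝ) : ℂ)

theorem continuous_regSymbol {α : ℝ} (hα : 0 < α) (ε : ℝ) : Continuous (regSymbol α ε) := by
  unfold regSymbol
  have : Continuous fun ξ : ℝ => |ξ| ^ (2 * α) :=
    continuous_abs.rpow_const fun _ => Or.inr (by positivity)
  fun_prop

theorem integrable_regSymbol {α ε : ℝ} (hα : 0 < α) (hε : 0 < ε) :
    Integrable (regSymbol α ε) := by
  have h := integrableOn_rpow_mul_exp_neg_mul (s := 2 * α) (by linarith) hε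
  exact (integrable_comp_abs h).ofReal

/-- The symbol is real and even, so the two half-line integrals are conjugate and add up to twice
the real part of a Laplace transform. -/
theorem hat_regSymbol {α ε : ℝ} (hα : 0 < α) (hε : 0 < ε) (t : ℝ) :
    hat (regSymbol α ε) t = ((2 * Real.Gamma (2 * α + 1) *
      ((ε + Complex.I * t : ℂ) ^ ((-(2 * α + 1) : ℝ) : ℂ)).re : ℝ) : ℂ) := by
  have hi := integrable_mul_exp (integrable_regSymbol hα hε) t
  have h1 : ∫ x : ℝ in Ioi 0, regSymbol α ε x * Complex.exp (-(Complex.I * t * x)) =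
      Real.Gamma (2 * α + 1) * (ε + Complex.I * t : ℂ) ^ ((-(2 * α + 1) : ℝ) : ℂ) := by
    rw [← integral_rpow_mul_cexp (by positivity) (by simpa using hε)]
    refine setIntegral_congr_fun measurableSet_Ioi fun x (hx : 0 < x) => ?_
    simp only [regSymbol, abs_of_pos hx, Complex.ofReal_mul, Complex.ofReal_exp, mul_assoc]
    rw [← Complex.exp_add]
    congr 2
    push_cast; ring
  have h2 : ∫ x : ℝ in Iic 0, regSymbol α ε x * Complex.exp (-(Complex.I * t * x)) =
      conj (∫ x : ℝ in Ioi 0, regSymbol α ε x * Complex.exp (-(Complex.I * t * x))) := by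
    rw [← integral_conj]
    have := integral_comp_neg_Ioi (0 : ℝ)
      (fun x : ℝ => regSymbol α ε x * Complex.exp (-(Complex.I * t * x)))
    rw [neg_zero] at this
    rw [← this]
    congr 1 with x
    simp only [regSymbol, abs_neg, map_mul, Complex.conj_ofReal, ← Complex.exp_conj, map_neg,
      Complex.conj_I]
    congr 2
    push_cast; ring
  rw [hat, ← intervalIntegral.integral_Iic_add_Ioi hi.integrableOn hi.integrableOn (b := 0), h2,
    h1, add_comm, Complex.add_conj, Complex.re_ofReal_mul]
  push_cast; ring

/-- The multiplication formula by Fubini. The dilation $c$ is taken to be $1$ when the transform is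
moved off $u$ and $-r$ when it is moved off the weighted monomial. -/
theorem integral_mul_hat {A B : ℝ → ℂ} (hA : Integrable A) (hB : Integrable B) (c : ℝ) :
    ∫ ξ, A ξ * hat B (c * ξ) = ∫ x, B x * hat A (c * x) := by
  simp only [hat, ← integral_const_mul]
  rw [integral_integral_swap]
  · congr 1 with x
    congr 1 with ξ
    have : -(Complex.I * ((c * ξ : ℝ) : ℂ) * x) = -(Complex.I * ((c * x : ℝ) : ℂ) * ξ) := by
      push_cast; ring
    rw [this]; ring
  · refine (hA.mul_prod hB).norm.mono' ?_ (.of_forall fun p => ?_)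
    · have := (hA.mul_prod hB).aestronglyMeasurable
      have h2 : Continuous fun p : ℝ × ℝ =>
        Complex.exp (-(Complex.I * ((c * p.1 : ℝ) : ℂ) * p.2)) := by fun_prop
      refine (this.mul h2.aestronglyMeasurable).congr (.of_forall fun p => ?_)
      simp only [Function.uncurry]
      simp [mul_assoc]
    · simp only [Function.uncurry, norm_mul, norm_exp_neg_I_mul_mul, mul_one, le_refl]

theorem hat_mul_exp (g : ℝ → ℂ) (x η : ℝ) :
    hat (fun ξ => g ξ * Complex.exp (-(Complex.I * x * ξ))) η = hat g (x + η) := by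
  simp only [hat, mul_assoc, ← Complex.exp_add]
  congr 1 with ξ
  congr 2
  push_cast; ring

/-- Homogeneity of the power: pulling $r$ out of the base replaces $(\varepsilon,x)$ by
$(\varepsilon/r,x/r)$ and leaves the unit interval for $y$. -/
theorem hat_regSymbol_sub {α ε r : ℝ} (hα : 0 < α) (hε : 0 < ε) (hr : 0 < r) (x y : ℝ) :
    hat (regSymbol α ε) (x + -r * y) = ((2 * Real.Gamma (2 * α + 1) * r ^ (-(2 * α + 1)) *
      (((ε / r : ℝ) + Complex.I * ((x / r : ℝ) - y) : ℂ) ^ ((-(2 * α + 1) : ℝ) : ℂ)).re : ℝ) : ℂ) := by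
  have hr0 : (r : ℂ) ≠ 0 := by exact_mod_cast hr.ne'
  have e : (ε : ℂ) + Complex.I * ((x + -r * y : ℝ) : ℂ) =
      r * ((ε / r : ℝ) + Complex.I * ((x / r : ℝ) - y)) := by
    push_cast; field_simp
    ring
  have hp : 0 < ε / r := by positivity
  rw [hat_regSymbol hα hε, e, mul_cpow_of_re_nonneg hr0 (by simpa using hr.le)
    (by rw [kernel_base_re]; simpa using hp), ← Complex.ofReal_cpow hr.le, Complex.re_ofReal_mul,
    mul_assoc (2 * Real.Gamma _)]

/-! ### The Riesz form against weighted monomials. -/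

section

variable {α : ℝ} {n : ℕ}

theorem conj_hat_weightedPoly_X_pow (η : ℝ) :
    conj (hat (zeroExt (weightedPoly α (Polynomial.X ^ n))) η) =
      hat (zeroExt (weightedPoly α (Polynomial.X ^ n))) (-η) := by
  rw [hat_neg_of_conj]
  intro x
  rw [zeroExt]
  by_cases hx : x ∈ Lam
  · rw [indicator_of_mem hx, weightedPoly_X_pow, map_mul, map_pow, Complex.conj_ofReal,
      Complex.conj_ofReal]
  · rw [indicator_of_notMem hx, map_zero]

theorem integral_zeroExt_mul (v f : ℝ → ℂ) : ∫ x, zeroExt v x * f x = ∫ x in Lam, v x * f x := by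
  rw [← integral_indicator measurableSet_Lam]
  congr 1 with x
  by_cases hx : x ∈ Lam <;> simp [zeroExt, hx]

theorem integral_weightedPoly_mul_hat_regSymbol (hα : 0 < α) {ε r : ℝ} (hε : 0 < ε) (hr : 0 < r)
    (x : ℝ) : ∫ y, zeroExt (weightedPoly α (Polynomial.X ^ n)) y *
      hat (regSymbol α ε) (x + -r * y) =
      ((2 * Real.Gamma (2 * α + 1) * r ^ (-(2 * α + 1)) *
        (∫ y in (-1 : ℝ)..1, kernelIntegrand α n (ε / r) (x / r) y).re : ℝ) : ℂ) := by
  rw [integral_zeroExt_mul]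
  have hε' : 0 < ε / r := by positivity
  have hc : Continuous fun y : ℝ => kernelIntegrand α n (ε / r) (x / r) y :=
    continuous_iff_continuousAt.2 fun y =>
      (continuousAt_kernelIntegrand hα n hε' (by simp)).comp_of_eq
        Complex.continuous_ofReal.continuousAt rfl
  have h4 := Complex.reCLM.intervalIntegral_comp_comm (hc.intervalIntegrable (-1) 1
    (μ := volume))
  simp only [Complex.reCLM_apply] at h4
  rw [← h4, ← intervalIntegral.integral_const_mul, ← intervalIntegral.integral_ofReal,
    ← setIntegral_Lam]
  refine setIntegral_congr_fun measurableSet_Lam fun y hy => ?_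
  simp only [hat_regSymbol_sub hα hε hr, weightedPoly_X_pow]
  rw [kernelIntegrand, upperWeight_ofReal hy, ← Complex.ofReal_pow, ← Complex.ofReal_mul,
    Complex.re_ofReal_mul]
  push_cast; ring

/-- Two uses of `integral_mul_hat`, legitimate because the regularised symbol is integrable. The
weighted monomial is real, so conjugating its transform only reflects the argument. -/
theorem integral_regSymbol_mul_hat (hα : 0 < α) {u : ℝ → ℂ} (hu : MemHStar α u) {ε r : ℝ}
    (hε : 0 < ε) (hr : 0 < r) :
    ∫ ξ, regSymbol α ε ξ * (hat (zeroExt u) ξ *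
        conj (hat (zeroExt (weightedPoly α (Polynomial.X ^ n))) (r * ξ))) =
      ∫ x in Lam, u x * ((2 * Real.Gamma (2 * α + 1) * r ^ (-(2 * α + 1)) *
        (∫ y in (-1 : ℝ)..1, kernelIntegrand α n (ε / r) (x / r) y).re : ℝ) : ℂ) := by
  have hJ := integrable_zeroExt_of_continuous (continuous_weightedPoly hα (Polynomial.X ^ n))
  have hJc := continuous_hat hJ
  have hg := integrable_regSymbol hα hε
  have hA : Integrable fun ξ => regSymbol α ε ξ *
      hat (zeroExt (weightedPoly α (Polynomial.X ^ n))) (-r * ξ) := by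
    refine (hg.norm.const_mul (∫ x, ‖zeroExt (weightedPoly α (Polynomial.X ^ n)) x‖)).mono' ?_ ?_
    · exact hg.aestronglyMeasurable.mul
        (hJc.comp (by fun_prop : Continuous fun ξ : ℝ => -r * ξ)).aestronglyMeasurable
    · refine .of_forall fun ξ => ?_
      rw [norm_mul, mul_comm]
      gcongr
      exact norm_hat_le _
  have h1 := integral_mul_hat hA hu.integrable_zeroExt 1
  simp only [one_mul] at h1
  rw [← integral_zeroExt_mul]
  calc _ = ∫ ξ, regSymbol α ε ξ * hat (zeroExt (weightedPoly α (Polynomial.X ^ n))) (-r * ξ) *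
        hat (zeroExt u) ξ := by
        congr 1 with ξ
        rw [conj_hat_weightedPoly_X_pow, neg_mul]
        ring
    _ = _ := h1
    _ = _ := by
        congr 1 with x
        congr 1
        rw [← integral_weightedPoly_mul_hat_regSymbol hα hε hr]
        have h2 := integral_mul_hat (integrable_mul_exp hg x) hJ (-r)
        simp only [hat_mul_exp] at h2
        rw [← h2, hat]
        congr 1 with ξ
        ring

theorem continuous_genCoeff (α : ℝ) (n : ℕ) : Continuous fun x => genCoeff α x n := by
  unfold genCoeff
  fun_prop

/-- An integrable majorant for the pairing of `û` with the decaying transforms. -/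
theorem integrable_majorant {u : ℝ → ℂ} (hα : 0 < α) (hu : MemHStar α u) :
    Integrable fun ξ : ℝ => |ξ| ^ (2 * α) * (‖hat (zeroExt u) ξ‖ * (1 + |ξ|) ^ (-(α + 1))) := by
  have hi : Integrable fun ξ : ℝ => (1 + ‖ξ‖) ^ (-2 : ℝ) :=
    integrable_one_add_norm (by simp)
  have hm := (continuous_hat hu.integrable_zeroExt).measurable
  refine (hu.finite.add hi).mono' (Measurable.aestronglyMeasurable (by fun_prop))
    (.of_forall fun ξ => ?_)
  have hp : 0 < 1 + |ξ| := by positivity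
  rw [Real.norm_of_nonneg (by positivity)]
  simp only [Pi.add_apply, Real.norm_eq_abs]
  -- The majorant factors as $(ac)(ab)$. The first factor is square integrable by membership of $u$,
  -- the second is at most $(1+|\xi|)^{-1}$, and $2xy\le x^2+y^2$ finishes.
  set a := |ξ| ^ α with ha
  set b := (1 + |ξ|) ^ (-(α + 1)) with hb
  set c := ‖hat (zeroExt u) ξ‖ with hc
  have h1 : |ξ| ^ (2 * α) = a ^ 2 := by
    rw [ha, mul_comm, Real.rpow_mul (abs_nonneg ξ), Real.rpow_two]
  have h2 : a ^ 2 ≤ (1 + |ξ| ^ 2) ^ α := by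
    rw [← h1, Real.rpow_mul (abs_nonneg ξ), Real.rpow_two]
    gcongr
    linarith
  have h3 : a * b ≤ (1 + |ξ|) ^ (-1 : ℝ) := by
    calc a * b ≤ (1 + |ξ|) ^ α * b := by rw [ha]; gcongr; linarith
      _ = _ := by rw [hb, ← Real.rpow_add hp]; congr 1; ring
  have h4 : (1 + |ξ|) ^ (-2 : ℝ) = ((1 + |ξ|) ^ (-1 : ℝ)) ^ 2 := by
    rw [← Real.rpow_natCast, ← Real.rpow_mul hp.le]; norm_num
  have ha0 : 0 ≤ a := by positivity
  have hb0 : 0 ≤ b := by positivity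
  have hc0 : 0 ≤ c := by positivity
  rw [h1, h4]
  have h5 : (a * b) ^ 2 ≤ ((1 + |ξ|) ^ (-1 : ℝ)) ^ 2 := by gcongr
  have h6 : a ^ 2 * c ^ 2 ≤ (1 + |ξ| ^ 2) ^ α * c ^ 2 := by gcongr
  nlinarith [sq_nonneg (a * c - a * b), sq_nonneg (a * c), sq_nonneg (a * b)]

theorem norm_pairing_le {C : ℝ} (hα : 0 < α) (hC : 0 ≤ C) (hJ : ∀ ξ,
      ‖hat (zeroExt (weightedPoly α (Polynomial.X ^ n))) ξ‖ ≤ C * (1 + |ξ|) ^ (-(α + 1)))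
    {r : ℝ} (hr : 1 ≤ r) (u : ℝ → ℂ) (ξ : ℝ) :
    ‖((|ξ| ^ (2 * α) : ℝ) : ℂ) * (hat (zeroExt u) ξ *
      conj (hat (zeroExt (weightedPoly α (Polynomial.X ^ n))) (r * ξ)))‖ ≤
      C * (|ξ| ^ (2 * α) * (‖hat (zeroExt u) ξ‖ * (1 + |ξ|) ^ (-(α + 1)))) := by
  rw [norm_mul, norm_mul, RCLike.norm_conj, Complex.norm_real, Real.norm_of_nonneg (by positivity)]
  have h1 : (1 + |r * ξ|) ^ (-(α + 1)) ≤ (1 + |ξ|) ^ (-(α + 1)) := by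
    refine Real.rpow_le_rpow_of_nonpos (by positivity) ?_ (by linarith)
    rw [abs_mul r ξ, abs_of_pos (by linarith : 0 < r)]
    nlinarith [abs_nonneg ξ]
  calc |ξ| ^ (2 * α) * (‖hat (zeroExt u) ξ‖ *
        ‖hat (zeroExt (weightedPoly α (Polynomial.X ^ n))) (r * ξ)‖)
      ≤ |ξ| ^ (2 * α) * (‖hat (zeroExt u) ξ‖ * (C * (1 + |ξ|) ^ (-(α + 1)))) := by
        gcongr
        exact (hJ _).trans (by gcongr)
    _ = _ := by ring

/-- The bound on the kernel integral blows up at the end points, where $u$ is merely square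
integrable. Taking $r>1$ moves the evaluation points $x/r$ into a compact part of $\Lambda$, so
$\varepsilon\to0$ is a dominated limit; $r\to1$ is taken afterwards, when only polynomials remain.
-/
theorem integral_symbol_mul_hat_dilated (hα : 0 < α) {u : ℝ → ℂ} (hu : MemHStar α u) {r : ℝ}
    (hr : 1 < r) :
    ∫ ξ, ((|ξ| ^ (2 * α) : ℝ) : ℂ) * (hat (zeroExt u) ξ *
        conj (hat (zeroExt (weightedPoly α (Polynomial.X ^ n))) (r * ξ))) =
      ∫ x in Lam, u x * ((2 * Real.Gamma (2 * α + 1) * r ^ (-(2 * α + 1)) *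
        (Real.pi * genCoeff α (x / r) n) : ℝ) : ℂ) := by
  obtain ⟨C, hC, hJ⟩ := exists_norm_hat_weightedPoly_X_pow_le hα n
  have hJc := continuous_hat
    (integrable_zeroExt_of_continuous (continuous_weightedPoly hα (Polynomial.X ^ n)))
  have huc := continuous_hat hu.integrable_zeroExt
  have hr0 : 0 < r := by linarith
  have hpos : ∀ᶠ ε : ℝ in nhdsWithin 0 (Ioi 0), 0 < ε := self_mem_nhdsWithin
  have hcs : Continuous fun ξ : ℝ => |ξ| ^ (2 * α) :=
    continuous_abs.rpow_const fun _ => Or.inr (by positivity)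
  have hexp : ∀ ε ξ : ℝ, regSymbol α ε ξ = ((Real.exp (-(ε * |ξ|)) : ℝ) : ℂ) *
      ((|ξ| ^ (2 * α) : ℝ) : ℂ) := fun ε ξ => by
    rw [regSymbol, mul_comm, Complex.ofReal_mul]
  have t1 : Filter.Tendsto (fun ε : ℝ => ∫ ξ, regSymbol α ε ξ * (hat (zeroExt u) ξ *
        conj (hat (zeroExt (weightedPoly α (Polynomial.X ^ n))) (r * ξ))))
      (nhdsWithin 0 (Ioi 0))
      (nhds (∫ ξ, ((|ξ| ^ (2 * α) : ℝ) : ℂ) * (hat (zeroExt u) ξ *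
        conj (hat (zeroExt (weightedPoly α (Polynomial.X ^ n))) (r * ξ))))) := by
    refine tendsto_integral_filter_of_dominated_convergence _
      (.of_forall fun ε => ?_) (hpos.mono fun ε hε => .of_forall fun ξ => ?_)
      ((integrable_majorant hα hu).const_mul C) (.of_forall fun ξ => ?_)
    · have := continuous_regSymbol hα ε
      have h2 := hJc.comp (by fun_prop : Continuous fun ξ : ℝ => r * ξ)
      exact (this.mul (huc.mul (Complex.continuous_conj.comp h2))).aestronglyMeasurable
    · rw [hexp, mul_assoc, norm_mul, Complex.norm_real, Real.norm_of_nonneg (Real.exp_pos _).le]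
      have h1 : Real.exp (-(ε * |ξ|)) ≤ 1 := Real.exp_le_one_iff.2 (by
        have := mul_nonneg hε.le (abs_nonneg ξ); linarith)
      exact (mul_le_of_le_one_left (norm_nonneg _) h1).trans (norm_pairing_le hα hC hJ hr.le u ξ)
    · simp only [hexp, mul_assoc]
      have h1 : Continuous fun ε : ℝ => ((Real.exp (-(ε * |ξ|)) : ℝ) : ℂ) *
        (((|ξ| ^ (2 * α) : ℝ) : ℂ) * (hat (zeroExt u) ξ *
        conj (hat (zeroExt (weightedPoly α (Polynomial.X ^ n))) (r * ξ)))) := by fun_prop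
      have h2 := h1.tendsto 0
      simp only [zero_mul, neg_zero, Real.exp_zero, Complex.ofReal_one, one_mul] at h2
      exact h2.mono_left nhdsWithin_le_nhds
  set δ := 1 - 1 / r with hδ'
  have hδ : 0 < δ := by
    rw [hδ', sub_pos, div_lt_one hr0]; exact hr
  have hxr : ∀ x ∈ Lam, |x / r| ≤ 1 - δ := by
    intro x hx
    rw [hδ', sub_sub_cancel, abs_div, abs_of_pos hr0]
    gcongr
    exact (abs_lt.2 hx).le
  set K := (2 + 2 * Real.pi) * (3 ^ α * 3 ^ α * 2 ^ n * δ ^ (-(2 * α + 1))) with hK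
  set G := 2 * Real.Gamma (2 * α + 1) * r ^ (-(2 * α + 1)) with hG
  have hG0 : 0 ≤ G := by
    have := Real.Gamma_pos_of_pos (show 0 < 2 * α + 1 by linarith)
    positivity
  have hue := hu.memLp.integrable (q := 2) (by norm_num)
  have t2 : Filter.Tendsto (fun ε : ℝ => ∫ x in Lam, u x * ((G *
        (∫ y in (-1 : ℝ)..1, kernelIntegrand α n (ε / r) (x / r) y).re : ℝ) : ℂ))
      (nhdsWithin 0 (Ioi 0))
      (nhds (∫ x in Lam, u x * ((G * (Real.pi * genCoeff α (x / r) n) : ℝ) : ℂ))) := by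
    refine tendsto_integral_filter_of_dominated_convergence (fun x => ‖u x‖ * (G * K))
      (hpos.mono fun ε hε => ?_) (hpos.mono fun ε hε => ?_)
      (hue.norm.mul_const _) ?_
    · refine hue.aestronglyMeasurable.mul (Continuous.aestronglyMeasurable ?_)
      -- Measurability in $x$ comes from recognising this function as the Fourier transform of an
      -- integrable function, hence continuous.
      have h3 : ∀ x : ℝ, ((G *
          (∫ y in (-1 : ℝ)..1, kernelIntegrand α n (ε / r) (x / r) y).re : ℝ) : ℂ) =
          hat (fun ξ => regSymbol α ε ξ *
            hat (zeroExt (weightedPoly α (Polynomial.X ^ n))) (-r * ξ)) x := by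
        intro x
        rw [hG, ← integral_weightedPoly_mul_hat_regSymbol hα hε hr0]
        have h2 := integral_mul_hat (integrable_mul_exp (integrable_regSymbol hα hε) x)
          (integrable_zeroExt_of_continuous (continuous_weightedPoly hα (Polynomial.X ^ n))) (-r)
        simp only [hat_mul_exp] at h2
        rw [← h2, hat]
        congr 1 with ξ
        ring
      simp only [h3]
      refine continuous_hat ?_
      have hg := integrable_regSymbol hα hε
      refine (hg.norm.const_mul (∫ x, ‖zeroExt (weightedPoly α (Polynomial.X ^ n)) x‖)).mono' ?_ ?_
      · exact hg.aestronglyMeasurable.mul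
          (hJc.comp (by fun_prop : Continuous fun ξ : ℝ => -r * ξ)).aestronglyMeasurable
      · refine .of_forall fun ξ => ?_
        rw [norm_mul, mul_comm]
        gcongr
        exact norm_hat_le _
    · filter_upwards [ae_restrict_mem measurableSet_Lam] with x hx
      rw [norm_mul, Complex.norm_real, Real.norm_eq_abs, abs_mul, abs_of_nonneg hG0]
      gcongr
      exact (Complex.abs_re_le_norm _).trans
        (norm_integral_kernelIntegrand_le hα n (by positivity) hδ (hxr x hx))
    · filter_upwards [ae_restrict_mem measurableSet_Lam] with x hx
      have h1 := tendsto_re_integral_kernelIntegrand_genCoeff hα n (x := x / r)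
        ((hxr x hx).trans_lt (by linarith))
      have h2 : Filter.Tendsto (fun ε : ℝ => ε / r) (nhdsWithin 0 (Ioi 0))
          (nhdsWithin 0 (Ioi 0)) := by
        refine tendsto_nhdsWithin_iff.2 ⟨?_, hpos.mono fun ε hε => div_pos hε hr0⟩
        have : Filter.Tendsto (fun ε : ℝ => ε / r) (nhds 0) (nhds (0 / r)) :=
          (continuous_id.div_const r).tendsto 0
        rw [zero_div] at this
        exact this.mono_left nhdsWithin_le_nhds
      have h3 := ((h1.comp h2).const_mul G)
      exact ((Complex.continuous_ofReal.tendsto _).comp h3).const_mul (u x)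
  refine tendsto_nhds_unique t1 (t2.congr' (hpos.mono fun ε hε => ?_))
  exact (integral_regSymbol_mul_hat hα hu hε hr0).symm

/-- The Riesz operator of order `2α` maps `(1 - x²)^α xⁿ` to a polynomial of degree `n`. -/
theorem integral_symbol_mul_hat (hα : 0 < α) {u : ℝ → ℂ} (hu : MemHStar α u) :
    ∫ ξ, ((|ξ| ^ (2 * α) : ℝ) : ℂ) * (hat (zeroExt u) ξ *
        conj (hat (zeroExt (weightedPoly α (Polynomial.X ^ n))) ξ)) =
      2 * Real.pi * ∫ x in Lam, u x * ((Real.Gamma (2 * α + 1) * genCoeff α x n : ℝ) : ℂ) := by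
  obtain ⟨C, hC, hJ⟩ := exists_norm_hat_weightedPoly_X_pow_le hα n
  have hJc := continuous_hat
    (integrable_zeroExt_of_continuous (continuous_weightedPoly hα (Polynomial.X ^ n)))
  have huc := continuous_hat hu.integrable_zeroExt
  have hpos : ∀ᶠ r : ℝ in nhdsWithin 1 (Ioi 1), 1 < r := self_mem_nhdsWithin
  have hcs : Continuous fun ξ : ℝ => |ξ| ^ (2 * α) :=
    continuous_abs.rpow_const fun _ => Or.inr (by positivity)
  have t1 : Filter.Tendsto (fun r : ℝ => ∫ ξ, ((|ξ| ^ (2 * α) : ℝ) : ℂ) * (hat (zeroExt u) ξ *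
        conj (hat (zeroExt (weightedPoly α (Polynomial.X ^ n))) (r * ξ))))
      (nhdsWithin 1 (Ioi 1))
      (nhds (∫ ξ, ((|ξ| ^ (2 * α) : ℝ) : ℂ) * (hat (zeroExt u) ξ *
        conj (hat (zeroExt (weightedPoly α (Polynomial.X ^ n))) ξ)))) := by
    refine tendsto_integral_filter_of_dominated_convergence _
      (.of_forall fun r => ?_) (hpos.mono fun r hr => .of_forall fun ξ => ?_)
      ((integrable_majorant hα hu).const_mul C) (.of_forall fun ξ => ?_)
    · have h2 := hJc.comp (by fun_prop : Continuous fun ξ : ℝ => r * ξ)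
      exact ((Complex.continuous_ofReal.comp hcs).mul
        (huc.mul (Complex.continuous_conj.comp h2))).aestronglyMeasurable
    · exact norm_pairing_le hα hC hJ hr.le u ξ
    · have h2 := hJc.comp (by fun_prop : Continuous fun r : ℝ => r * ξ)
      have h3 := (((Complex.continuous_conj.comp h2).tendsto 1).const_mul
        (hat (zeroExt u) ξ)).const_mul ((|ξ| ^ (2 * α) : ℝ) : ℂ)
      simp only [Function.comp_apply, one_mul] at h3
      exact h3.mono_left nhdsWithin_le_nhds
  have hue := hu.memLp.integrable (q := 2) (by norm_num)
  obtain ⟨M, hM⟩ := (isCompact_Icc (a := (-1 : ℝ)) (b := 1)).exists_bound_of_continuousOn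
    (continuous_genCoeff α n).continuousOn
  have hG0 : 0 < Real.Gamma (2 * α + 1) := Real.Gamma_pos_of_pos (by linarith)
  have t2 : Filter.Tendsto (fun r : ℝ => ∫ x in Lam, u x * ((2 * Real.Gamma (2 * α + 1) *
        r ^ (-(2 * α + 1)) * (Real.pi * genCoeff α (x / r) n) : ℝ) : ℂ))
      (nhdsWithin 1 (Ioi 1))
      (nhds (∫ x in Lam, u x * ((2 * Real.Gamma (2 * α + 1) * (1 : ℝ) ^ (-(2 * α + 1)) *
        (Real.pi * genCoeff α (x / 1) n) : ℝ) : ℂ))) := by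
    refine tendsto_integral_filter_of_dominated_convergence
      (fun x => ‖u x‖ * (2 * Real.Gamma (2 * α + 1) * 1 * (Real.pi * M)))
      (hpos.mono fun r hr => ?_) (hpos.mono fun r hr => ?_)
      (hue.norm.mul_const _) ?_
    · refine hue.aestronglyMeasurable.mul (Continuous.aestronglyMeasurable ?_)
      have := (continuous_genCoeff α n).comp (by fun_prop : Continuous fun x : ℝ => x / r)
      simp only [Function.comp_def] at this
      fun_prop
    · filter_upwards [ae_restrict_mem measurableSet_Lam] with x hx
      have hr0 : 0 < r := by linarith
      have hx1 : |x / r| ≤ 1 := by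
        rw [abs_div, abs_of_pos hr0, div_le_one hr0]
        exact (abs_lt.2 hx).le.trans hr.le
      have h1 : r ^ (-(2 * α + 1)) ≤ 1 := Real.rpow_le_one_of_one_le_of_nonpos hr.le (by linarith)
      have h2 := hM (x / r) (abs_le.1 hx1)
      rw [Real.norm_eq_abs] at h2
      rw [norm_mul, Complex.norm_real, Real.norm_eq_abs, abs_mul, abs_mul Real.pi,
        abs_of_pos Real.pi_pos, abs_of_nonneg (by positivity)]
      gcongr
    · refine .of_forall fun x => ?_
      have h1 : ContinuousAt (fun r : ℝ => r ^ (-(2 * α + 1))) 1 :=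
        Real.continuousAt_rpow_const _ _ (Or.inl one_ne_zero)
      have h2 : ContinuousAt (fun r : ℝ => genCoeff α (x / r) n) 1 :=
        (continuous_genCoeff α n).continuousAt.comp
          (continuousAt_const.div continuousAt_id one_ne_zero)
      have h3 := ((h1.const_mul (2 * Real.Gamma (2 * α + 1))).mul (h2.const_mul Real.pi))
      exact (((Complex.continuous_ofReal.tendsto _).comp h3.tendsto).const_mul
        (u x)).mono_left nhdsWithin_le_nhds
  -- At $r=1$ the powers of $r$ disappear, and both sides pass to the limit by dominated
  -- convergence.
  have h := tendsto_nhds_unique t1 (t2.congr' (hpos.mono fun r hr => by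
    exact (integral_symbol_mul_hat_dilated hα hu hr).symm))
  rw [h, ← integral_const_mul]
  congr 1 with x
  rw [Real.one_rpow, div_one]
  push_cast; ring

end

/-! ### The polynomial operator and its eigenvalues. -/

open Polynomial in
/-- The image of `(1 - x²)^α xⁿ` under the Riesz operator of order `2α`. -/
def rieszPoly (α : ℝ) (n : ℕ) : ℂ[X] :=
  ∑ k ∈ Finset.range (n + 1), C ((Real.Gamma (2 * α + 1) *
    (binomCoeff (2 * α + 1) k * weightCoeff α (n - k)) : ℝ) : ℂ) * X ^ k

theorem eval_rieszPoly (α : ℝ) (n : ℕ) (x : ℝ) :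
    (rieszPoly α n).eval (x : ℂ) = ((Real.Gamma (2 * α + 1) * genCoeff α x n : ℝ) : ℂ) := by
  rw [rieszPoly, Polynomial.eval_finsetSum, genCoeff, Finset.mul_sum, Complex.ofReal_sum]
  refine Finset.sum_congr rfl fun k _ => ?_
  simp only [Polynomial.eval_mul, Polynomial.eval_C, Polynomial.eval_pow, Polynomial.eval_X]
  push_cast; ring

open Polynomial in
/-- The polynomial operator `p ↦ (-Δ)^α ((1 - x²)^α p)` on `Λ`. -/
def rieszOp (α : ℝ) : ℂ[X] →ₗ[ℂ] ℂ[X] :=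
  (Polynomial.basisMonomials ℂ).constr ℂ (rieszPoly α)

theorem rieszOp_X_pow (α : ℝ) (n : ℕ) : rieszOp α (Polynomial.X ^ n) = rieszPoly α n := by
  have h := (Polynomial.basisMonomials ℂ).constr_basis ℂ (rieszPoly α) n
  simpa [rieszOp, Polynomial.monomial_one_right_eq_X_pow] using h

/-- The eigenvalues `Γ(2α + 1 + n) / n!`. -/
def gammaRatio (α : ℝ) (n : ℕ) : ℝ := Real.Gamma (2 * α + 1 + n) / n.factorial

theorem gammaRatio_zero (α : ℝ) : gammaRatio α 0 = Real.Gamma (2 * α + 1) := by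
  simp [gammaRatio]

theorem gammaRatio_pos {α : ℝ} (hα : 0 < α) (n : ℕ) : 0 < gammaRatio α n := by
  have : 0 < Real.Gamma (2 * α + 1 + n) := Real.Gamma_pos_of_pos (by positivity)
  unfold gammaRatio
  positivity

theorem gammaRatio_succ {α : ℝ} (hα : 0 < α) (n : ℕ) :
    gammaRatio α (n + 1) = gammaRatio α n + gammaRatio α n * (2 * α / (n + 1)) := by
  have h : Real.Gamma (2 * α + 1 + n + 1) = (2 * α + 1 + n) * Real.Gamma (2 * α + 1 + n) :=
    Real.Gamma_add_one (by positivity)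
  have hn : (n.factorial : ℝ) ≠ 0 := by positivity
  have hn1 : (n : ℝ) + 1 ≠ 0 := by positivity
  unfold gammaRatio
  rw [Nat.factorial_succ]
  push_cast
  rw [← add_assoc, h]
  field_simp
  ring

theorem gammaRatio_strictMono {α : ℝ} (hα : 0 < α) : StrictMono (gammaRatio α) := by
  refine strictMono_nat_of_lt_succ fun n => ?_
  rw [gammaRatio_succ hα]
  have := gammaRatio_pos hα n
  have : 0 < gammaRatio α n * (2 * α / (n + 1)) := by positivity
  linarith

/-- The increments are at least $2\alpha\lambda_0/(n+1)$, so the divergence of the harmonic series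
suffices and no asymptotics of $\Gamma$ are needed. The divergence is what makes the embedding
compact. -/
theorem tendsto_gammaRatio {α : ℝ} (hα : 0 < α) :
    Filter.Tendsto (gammaRatio α) Filter.atTop Filter.atTop := by
  have h0 := gammaRatio_pos hα 0
  have h : ∀ n : ℕ, gammaRatio α 0 * (2 * α) * ∑ i ∈ Finset.range n, 1 / ((i : ℝ) + 1) ≤
      gammaRatio α n := by
    intro n
    induction n with
    | zero => simpa using h0.le
    | succ n ih =>
      rw [Finset.sum_range_succ, gammaRatio_succ hα, mul_add]
      have h1 : gammaRatio α 0 ≤ gammaRatio α n := (gammaRatio_strictMono hα).monotone n.zero_le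
      have h2 : gammaRatio α 0 * (2 * α) * (1 / ((n : ℝ) + 1)) ≤
          gammaRatio α n * (2 * α / (n + 1)) := by
        calc gammaRatio α 0 * (2 * α) * (1 / ((n : ℝ) + 1))
            = gammaRatio α 0 * (2 * α / (n + 1)) := by ring
          _ ≤ _ := by gcongr
      linarith
  exact Filter.tendsto_atTop_mono h
    (Real.tendsto_sum_range_one_div_nat_succ_atTop.const_mul_atTop (by positivity))

theorem coeff_rieszPoly_self {α : ℝ} (hα : 0 < α) (n : ℕ) :
    (rieszPoly α n).coeff n = (gammaRatio α n : ℂ) := by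
  have hG : Real.Gamma (2 * α + 1) ≠ 0 := (Real.Gamma_pos_of_pos (by positivity)).ne'
  rw [rieszPoly, Polynomial.finsetSum_coeff, Finset.sum_eq_single n]
  · rw [Polynomial.coeff_C_mul, Polynomial.coeff_X_pow_self, mul_one, Nat.sub_self,
      weightCoeff_zero, mul_one, binomCoeff_eq_Gamma (by positivity), gammaRatio]
    congr 1
    field_simp
  · intro k _ hk
    rw [Polynomial.coeff_C_mul, Polynomial.coeff_X_pow, if_neg hk.symm, mul_zero]
  · intro h; exact absurd (Finset.mem_range.2 n.lt_succ_self) h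

theorem rieszPoly_mem_degreeLT (α : ℝ) (n : ℕ) :
    rieszPoly α n ∈ Polynomial.degreeLT ℂ (n + 1) := by
  refine Submodule.sum_mem _ fun k hk => ?_
  rw [Polynomial.mem_degreeLT]
  refine (Polynomial.degree_C_mul_X_pow_le _ _).trans_lt ?_
  exact_mod_cast Finset.mem_range.1 hk

/-- Triangularity: on $X^n$ the leading coefficients cancel by `coeff_rieszPoly_self`, and lower
powers already have lower degree. -/
theorem rieszOp_sub_mem_degreeLT {α : ℝ} (hα : 0 < α) {n : ℕ} {p : Polynomial ℂ}
    (hp : p ∈ Polynomial.degreeLT ℂ (n + 1)) :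
    rieszOp α p - (gammaRatio α n : ℂ) • p ∈ Polynomial.degreeLT ℂ n := by
  have hX : ∀ k ≤ n, rieszOp α (Polynomial.X ^ k) - (gammaRatio α n : ℂ) • Polynomial.X ^ k ∈
      Polynomial.degreeLT ℂ n := by
    intro k hk
    have h1 : rieszOp α (Polynomial.X ^ k) ∈ Polynomial.degreeLT ℂ (k + 1) := by
      rw [rieszOp_X_pow]; exact rieszPoly_mem_degreeLT α k
    have h2 : (Polynomial.X ^ k : Polynomial ℂ) ∈ Polynomial.degreeLT ℂ (k + 1) := by
      rw [Polynomial.mem_degreeLT]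
      refine (Polynomial.degree_X_pow_le k).trans_lt ?_
      exact_mod_cast k.lt_succ_self
    have h3 := Submodule.sub_mem _ h1 (Submodule.smul_mem _ (gammaRatio α n : ℂ) h2)
    rcases hk.lt_or_eq with h | h
    · exact Polynomial.degreeLT_mono (Nat.succ_le_of_lt h) h3
    · subst h
      rw [Polynomial.mem_degreeLT, Polynomial.degree_lt_iff_coeff_zero] at h3 ⊢
      intro m hm
      rcases hm.lt_or_eq with h | h
      · exact h3 m h
      · subst h
        rw [Polynomial.coeff_sub, rieszOp_X_pow, coeff_rieszPoly_self hα, Polynomial.coeff_smul,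
          Polynomial.coeff_X_pow_self, smul_eq_mul, mul_one, sub_self]
  rw [Polynomial.degreeLT_eq_span_X_pow] at hp
  induction hp using Submodule.span_induction with
  | mem q hq =>
    simp only [Finset.coe_image, Finset.coe_range, mem_image, mem_Iio] at hq
    obtain ⟨k, hk, rfl⟩ := hq
    exact hX k (Nat.lt_succ_iff.1 hk)
  | zero => simp
  | add q r _ _ hq hr =>
    have := Submodule.add_mem _ hq hr
    rwa [map_add, smul_add, add_sub_add_comm]
  | smul c q _ hq =>
    have := Submodule.smul_mem _ c hq
    rwa [map_smul, smul_comm, ← smul_sub]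

theorem rieszOp_mem_degreeLT {α : ℝ} (hα : 0 < α) {n : ℕ} {p : Polynomial ℂ}
    (hp : p ∈ Polynomial.degreeLT ℂ n) : rieszOp α p ∈ Polynomial.degreeLT ℂ n := by
  have h1 := rieszOp_sub_mem_degreeLT hα (Polynomial.degreeLT_mono n.le_succ hp)
  have h2 := Submodule.add_mem _ h1 (Submodule.smul_mem _ (gammaRatio α n : ℂ) hp)
  rwa [sub_add_cancel] at h2

/-! ### The weighted $L^2$ space and the eigenpolynomials. -/

/-- The square root `(1 - x²)^{α/2}` of the weight. -/
def sqrtWeight (α x : ℝ) : ℝ := (1 - x ^ 2) ^ (α / 2)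

theorem continuous_sqrtWeight {α : ℝ} (hα : 0 < α) : Continuous (sqrtWeight α) :=
  (by fun_prop : Continuous fun x : ℝ => 1 - x ^ 2).rpow_const fun _ => Or.inr (by positivity)

theorem one_sub_sq_pos {x : ℝ} (hx : x ∈ Lam) : 0 < 1 - x ^ 2 := by
  obtain ⟨h1, h2⟩ := hx
  nlinarith

theorem sqrtWeight_pos {α x : ℝ} (hx : x ∈ Lam) : 0 < sqrtWeight α x :=
  Real.rpow_pos_of_pos (one_sub_sq_pos hx) _

theorem sqrtWeight_sq {α x : ℝ} (hx : x ∈ Lam) : sqrtWeight α x ^ 2 = (1 - x ^ 2) ^ α := by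
  rw [sqrtWeight, ← Real.rpow_natCast, ← Real.rpow_mul (one_sub_sq_pos hx).le]
  congr 1
  push_cast; ring

theorem sqrtWeight_le_one {α x : ℝ} (hα : 0 < α) (hx : x ∈ Lam) : sqrtWeight α x ≤ 1 :=
  Real.rpow_le_one (one_sub_sq_pos hx).le (by nlinarith) (by positivity)

theorem memLp_sqrtWeight_mul_eval {α : ℝ} (hα : 0 < α) (p : Polynomial ℂ) :
    MemLp (fun x : ℝ => (sqrtWeight α x : ℂ) * p.eval (x : ℂ)) 2 (volume.restrict Lam) := by
  refine memLp_restrict_Lam_of_continuous ?_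
  have h1 := continuous_sqrtWeight hα
  have h2 : Continuous fun x : ℝ => p.eval (x : ℂ) := p.continuous.comp Complex.continuous_ofReal
  fun_prop

/-- The isometric image `(1 - x²)^{α/2} p` in `L²(Λ)` of a polynomial of the weighted `L²` space. -/
def polyLp {α : ℝ} (hα : 0 < α) : Polynomial ℂ →ₗ[ℂ] Lp ℂ 2 (volume.restrict Lam) where
  toFun p := (memLp_sqrtWeight_mul_eval hα p).toLp
  map_add' p q := by
    rw [← MemLp.toLp_add]
    refine MemLp.toLp_congr _ _ (.of_forall fun x => ?_)
    simp [mul_add]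
  map_smul' c p := by
    rw [RingHom.id_apply, ← MemLp.toLp_const_smul]
    refine MemLp.toLp_congr _ _ (.of_forall fun x => ?_)
    simp [mul_left_comm]

theorem coeFn_polyLp {α : ℝ} (hα : 0 < α) (p : Polynomial ℂ) :
    polyLp hα p =ᵐ[volume.restrict Lam] fun x : ℝ => (sqrtWeight α x : ℂ) * p.eval (x : ℂ) :=
  (memLp_sqrtWeight_mul_eval hα p).coeFn_toLp

theorem inner_polyLp {α : ℝ} (hα : 0 < α) (p q : Polynomial ℂ) :
    inner ℂ (polyLp hα p) (polyLp hα q) =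
      ∫ x in Lam, weightedPoly α q x * conj (p.eval (x : ℂ)) := by
  rw [L2.inner_def]
  refine integral_congr_ae ?_
  filter_upwards [coeFn_polyLp hα p, coeFn_polyLp hα q, ae_restrict_mem measurableSet_Lam]
    with x hp hq hx
  rw [hp, hq, RCLike.inner_apply, weightedPoly, ← sqrtWeight_sq hx, map_mul, Complex.conj_ofReal]
  push_cast; ring

/-- A nonzero polynomial has finitely many zeros, whereas $\Lambda$ has positive measure. -/
theorem polyLp_injective {α : ℝ} (hα : 0 < α) : Function.Injective (polyLp hα) := by
  rw [injective_iff_map_eq_zero]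
  intro p hp
  by_contra hne
  have h1 : ∀ᵐ x : ℝ ∂(volume.restrict Lam), p.eval (x : ℂ) = 0 := by
    have h2 := coeFn_polyLp hα p
    rw [hp] at h2
    filter_upwards [h2, Lp.coeFn_zero ℂ 2 (volume.restrict Lam), ae_restrict_mem measurableSet_Lam]
      with x h3 h4 hx
    rw [h4, Pi.zero_apply] at h3
    have := (sqrtWeight_pos (α := α) hx).ne'
    exact (mul_eq_zero.1 h3.symm).resolve_left (by exact_mod_cast this)
  have hfin : {x : ℝ | p.eval (x : ℂ) = 0}.Finite := by
    have := (Polynomial.finite_setOfPred_isRoot hne).preimage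
      (f := fun x : ℝ => (x : ℂ)) Complex.ofReal_injective.injOn
    exact this
  rw [ae_restrict_iff' measurableSet_Lam] at h1
  have h3 : volume Lam ≤ volume {x : ℝ | p.eval (x : ℂ) = 0} := measure_mono_ae h1
  rw [hfin.measure_zero volume, Lam, Real.volume_Ioo] at h3
  norm_num at h3

/-- The Riesz derivative of a weighted polynomial. -/
def polyDeriv {α : ℝ} (hα : 0 < α) : Polynomial ℂ →ₗ[ℂ] Lp ℂ 2 (volume : Measure ℝ) where
  toFun p := rieszDeriv hα.le (memHStar_weightedPoly hα p)
  map_add' p q := by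
    rw [← rieszDeriv_add]
    exact rieszDeriv_congr _ _ _ (by rw [weightedPoly_add])
  map_smul' c p := by
    rw [RingHom.id_apply, ← rieszDeriv_smul]
    exact rieszDeriv_congr _ _ _ (by rw [weightedPoly_smul])

theorem polyDeriv_apply {α : ℝ} (hα : 0 < α) (p : Polynomial ℂ) :
    polyDeriv hα p = rieszDeriv hα.le (memHStar_weightedPoly hα p) := rfl

theorem integrable_mul_conj_eval {u : ℝ → ℂ} (hu : MemLp u 2 (volume.restrict Lam))
    (p : Polynomial ℂ) : IntegrableOn (fun x : ℝ => u x * conj (p.eval (x : ℂ))) Lam := by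
  have h2 : Continuous fun x : ℝ => conj (p.eval (x : ℂ)) :=
    Complex.continuous_conj.comp (p.continuous.comp Complex.continuous_ofReal)
  exact hu.integrable_mul (memLp_restrict_Lam_of_continuous h2)

/-- The weak form of $(-\Delta)^\alpha(wp)=$ `rieszOp α p` on $\Lambda$, tested against an arbitrary
element of $H^\alpha_*(\Lambda)$. This is the only way the Fourier analysis enters the spectral
argument. -/
theorem inner_polyDeriv {α : ℝ} (hα : 0 < α) {u : ℝ → ℂ} (hu : MemHStar α u) (p : Polynomial ℂ) :
    inner ℂ (polyDeriv hα p) (rieszDeriv hα.le hu) =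
      ∫ x in Lam, u x * conj ((rieszOp α p).eval (x : ℂ)) := by
  induction p using Polynomial.induction_on' with
  | add p q hp hq =>
    rw [map_add, inner_add_left, hp, hq, ← integral_add (integrable_mul_conj_eval hu.memLp _)
      (integrable_mul_conj_eval hu.memLp _)]
    simp only [map_add, Polynomial.eval_add, mul_add]
  | monomial n c =>
    rw [← Polynomial.C_mul_X_pow_eq_monomial, ← Polynomial.smul_eq_C_mul, map_smul, map_smul,
      inner_smul_left, polyDeriv_apply, inner_rieszDeriv, integral_symbol_mul_hat hα hu,
      rieszOp_X_pow]
    rw [← mul_assoc (1 / (2 * Real.pi : ℂ)), one_div_mul_cancel (by simp), one_mul,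
      ← integral_const_mul]
    congr 1 with x
    rw [Polynomial.eval_smul, smul_eq_mul, map_mul, eval_rieszPoly, Complex.conj_ofReal]
    ring

/-- The left side is Hermitian in $p$ and $q$, so `rieszOp` is symmetric for the weighted inner
product. -/
theorem inner_polyDeriv_polyDeriv {α : ℝ} (hα : 0 < α) (p q : Polynomial ℂ) :
    inner ℂ (polyDeriv hα p) (polyDeriv hα q) =
      inner ℂ (polyLp hα (rieszOp α p)) (polyLp hα q) := by
  rw [polyDeriv_apply hα q, inner_polyDeriv, inner_polyLp]

/-- There are polynomials, orthonormal for the weight, that diagonalise the Riesz operator. -/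
theorem exists_orthonormal_eigenpolynomials {α : ℝ} (hα : 0 < α) :
    ∃ P : ℕ → Polynomial ℂ, Orthonormal ℂ (fun n => polyLp hα (P n)) ∧
      (∀ n, P n ∈ Polynomial.degreeLT ℂ (n + 1)) ∧
      (∀ n, rieszOp α (P n) = (gammaRatio α n : ℂ) • P n) ∧
      Submodule.span ℂ (range P) = ⊤ := by
  set f : ℕ → Lp ℂ 2 (volume.restrict Lam) := fun n => polyLp hα (Polynomial.X ^ n) with hf
  have hker : LinearMap.ker (polyLp hα) = ⊥ := LinearMap.ker_eq_bot.2 (polyLp_injective hα)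
  have hli : LinearIndependent ℂ f := by
    have h := (Polynomial.basisMonomials ℂ).linearIndependent.map' (polyLp hα) hker
    have h2 : f = polyLp hα ∘ Polynomial.basisMonomials ℂ := by
      funext n
      simp [hf, Polynomial.monomial_one_right_eq_X_pow]
    rw [h2]
    exact h
  set e := InnerProductSpace.gramSchmidtNormed ℂ f with he
  have hon : Orthonormal ℂ e := InnerProductSpace.gramSchmidtNormed_orthonormal hli
  have hspan : ∀ n, Submodule.span ℂ (e '' Iio n) =
      (Polynomial.degreeLT ℂ n).map (polyLp hα) := by
    intro n
    rw [he, InnerProductSpace.span_gramSchmidtNormed, InnerProductSpace.span_gramSchmidt_Iio,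
      Polynomial.degreeLT_eq_span_X_pow, Submodule.map_span]
    congr 1
    ext y
    simp [hf]
  have hmem : ∀ n, e n ∈ (Polynomial.degreeLT ℂ (n + 1)).map (polyLp hα) := by
    intro n
    rw [← hspan]
    exact Submodule.subset_span ⟨n, by simp, rfl⟩
  choose P hP1 hP2 using hmem
  have hspan_orth : ∀ n, ∀ y ∈ Submodule.span ℂ (e '' Iio n), inner ℂ (e n) y = 0 := by
    intro n y hy
    induction hy using Submodule.span_induction with
    | mem y hy =>
      obtain ⟨k, hk, rfl⟩ := hy
      exact hon.2 (ne_of_gt hk)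
    | zero => simp
    | add y z _ _ hy hz => rw [inner_add_right, hy, hz, add_zero]
    | smul c y _ hy => rw [inner_smul_right, hy, mul_zero]
  have horth : ∀ n, ∀ q ∈ Polynomial.degreeLT ℂ n,
      inner ℂ (polyLp hα (P n)) (polyLp hα q) = 0 := by
    intro n q hq
    rw [hP2]
    exact hspan_orth n _ (by rw [hspan]; exact Submodule.mem_map_of_mem hq)
  refine ⟨P, by simpa only [hP2] using hon, hP1, fun n => ?_, ?_⟩
  · set r := rieszOp α (P n) - (gammaRatio α n : ℂ) • P n with hr
    have hrV : r ∈ Polynomial.degreeLT ℂ n := rieszOp_sub_mem_degreeLT hα (hP1 n)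
    -- By symmetry the operator moves onto $r$, where it preserves degree below $n$, and $P_n$ is
    -- orthogonal to such polynomials. So $r$ has degree below $n$ and is orthogonal to itself.
    have h2 : inner ℂ (polyLp hα (rieszOp α (P n))) (polyLp hα r) = 0 := by
      rw [← inner_polyDeriv_polyDeriv, inner_eq_zero_symm, inner_polyDeriv_polyDeriv,
        inner_eq_zero_symm]
      exact horth n _ (rieszOp_mem_degreeLT hα hrV)
    have h4 : polyLp hα r =
        polyLp hα (rieszOp α (P n)) - (gammaRatio α n : ℂ) • polyLp hα (P n) := by
      rw [hr, map_sub, map_smul]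
    have h1 : inner ℂ (polyLp hα r) (polyLp hα r) = 0 := by
      calc inner ℂ (polyLp hα r) (polyLp hα r)
          = inner ℂ (polyLp hα (rieszOp α (P n)) - (gammaRatio α n : ℂ) • polyLp hα (P n))
              (polyLp hα r) := by rw [← h4]
        _ = 0 := by
          rw [inner_sub_left, inner_smul_left, h2, horth n r hrV, mul_zero, sub_zero]
    have h3 : r = 0 := polyLp_injective hα (by rw [inner_self_eq_zero.1 h1, map_zero])
    exact sub_eq_zero.1 h3
  · rw [eq_top_iff]
    intro p _
    have hp : p ∈ Polynomial.degreeLT ℂ (p.natDegree + 1) := by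
      rw [Polynomial.mem_degreeLT]
      refine Polynomial.degree_le_natDegree.trans_lt ?_
      exact_mod_cast p.natDegree.lt_succ_self
    have h1 : polyLp hα p ∈ (Submodule.span ℂ (range P)).map (polyLp hα) := by
      have h2 := Submodule.mem_map_of_mem (f := polyLp hα) hp
      rw [← hspan] at h2
      rw [Submodule.map_span]
      refine Submodule.span_mono ?_ h2
      rintro _ ⟨k, _, rfl⟩
      exact ⟨P k, ⟨k, rfl⟩, hP2 k⟩
    obtain ⟨q, hq, h3⟩ := h1
    rwa [← polyLp_injective hα h3]

/-! ### Orthonormal sequences and diagonal operators on $\ell^2$. -/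

section HilbertSequences

variable {E : Type*} [NormedAddCommGroup E] [InnerProductSpace ℂ E] {v : ℕ → E}

/-- The norm of a square summable sequence. -/
theorem hasSum_sq_norm (d : lp (fun _ : ℕ => ℂ) 2) : HasSum (fun n => ‖d n‖ ^ 2) (‖d‖ ^ 2) := by
  have h := lp.hasSum_norm (p := 2) (by norm_num) d
  simpa using h

theorem memlp_two_of_summable {f : ℕ → ℂ} (hf : Summable fun n => ‖f n‖ ^ 2) :
    Memℓp (E := fun _ : ℕ => ℂ) f 2 :=
  memℓp_gen (by simpa using hf)

/-- The sequence of Fourier coefficients of a vector. -/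
def fourierSeq (hv : Orthonormal ℂ v) (x : E) : lp (fun _ : ℕ => ℂ) 2 :=
  ⟨fun n => inner ℂ (v n) x, memlp_two_of_summable (hv.inner_products_summable x)⟩

theorem fourierSeq_apply (hv : Orthonormal ℂ v) (x : E) (n : ℕ) :
    fourierSeq hv x n = inner ℂ (v n) x := rfl

theorem norm_fourierSeq_le (hv : Orthonormal ℂ v) (x : E) : ‖fourierSeq hv x‖ ≤ ‖x‖ := by
  refine (sq_le_sq₀ (norm_nonneg _) (norm_nonneg x)).1 ?_
  rw [← (hasSum_sq_norm _).tsum_eq]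
  exact hv.tsum_inner_products_le x

variable [CompleteSpace E]

/-- The isometry of `ℓ²` determined by an orthonormal sequence. -/
def fourierSum (hv : Orthonormal ℂ v) : lp (fun _ : ℕ => ℂ) 2 →ₗᵢ[ℂ] E :=
  hv.orthogonalFamily.linearIsometry

theorem hasSum_fourierSum (hv : Orthonormal ℂ v) (d : lp (fun _ : ℕ => ℂ) 2) :
    HasSum (fun n => d n • v n) (fourierSum hv d) := by
  have h := hv.orthogonalFamily.hasSum_linearIsometry d
  simpa [fourierSum] using h

theorem inner_fourierSum (hv : Orthonormal ℂ v) (d : lp (fun _ : ℕ => ℂ) 2) (n : ℕ) :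
    inner ℂ (v n) (fourierSum hv d) = d n := by
  have h1 := (hasSum_fourierSum hv d).mapL (innerSL ℂ (v n))
  have h2 : HasSum (fun k => innerSL ℂ (v n) (d k • v k)) (d n) := by
    have h3 : (fun k => innerSL ℂ (v n) (d k • v k)) = fun k => if k = n then d n else 0 := by
      funext k
      rw [innerSL_apply_apply, inner_smul_right, orthonormal_iff_ite.1 hv n k]
      rcases eq_or_ne n k with rfl | h
      · simp
      · simp [h, h.symm]
    rw [h3]
    exact hasSum_ite_eq n (d n)
  exact h1.unique h2

end HilbertSequences

section Diagonal

theorem sq_norm_mul_le {a : ℕ → ℂ} {C : ℝ} (h : ∀ n, ‖a n‖ ≤ C) (d : ℕ → ℂ) (n : ℕ) :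
    ‖a n * d n‖ ^ 2 ≤ C ^ 2 * ‖d n‖ ^ 2 := by
  rw [norm_mul, mul_pow]
  gcongr
  exact h n

/-- The linear map of `ℓ²` multiplying by a bounded sequence. -/
def diagLM (a : ℕ → ℂ) (C : ℝ) (h : ∀ n, ‖a n‖ ≤ C) :
    lp (fun _ : ℕ => ℂ) 2 →ₗ[ℂ] lp (fun _ : ℕ => ℂ) 2 where
  toFun d := ⟨fun n => a n * d n, memlp_two_of_summable
    (((hasSum_sq_norm d).summable.mul_left (C ^ 2)).of_nonneg_of_le (fun _ => by positivity)
      (sq_norm_mul_le h d))⟩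
  map_add' d e := by ext n; exact mul_add _ _ _
  map_smul' c d := by ext n; exact mul_left_comm _ _ _

theorem diagLM_apply {a : ℕ → ℂ} {C : ℝ} (h : ∀ n, ‖a n‖ ≤ C) (d : lp (fun _ : ℕ => ℂ) 2)
    (n : ℕ) : diagLM a C h d n = a n * d n := rfl

theorem norm_diagLM_le {a : ℕ → ℂ} {C : ℝ} (h : ∀ n, ‖a n‖ ≤ C) (d : lp (fun _ : ℕ => ℂ) 2) :
    ‖diagLM a C h d‖ ≤ C * ‖d‖ := by
  have hC : 0 ≤ C := (norm_nonneg _).trans (h 0)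
  refine (sq_le_sq₀ (norm_nonneg _) (by positivity)).1 ?_
  rw [mul_pow]
  refine hasSum_le (fun n => ?_) (hasSum_sq_norm _) ((hasSum_sq_norm d).mul_left (C ^ 2))
  rw [diagLM_apply]
  exact sq_norm_mul_le h d n

/-- The diagonal operator on `ℓ²` with bounded entries. -/
def diagCLM (a : ℕ → ℂ) (C : ℝ) (h : ∀ n, ‖a n‖ ≤ C) :
    lp (fun _ : ℕ => ℂ) 2 →L[ℂ] lp (fun _ : ℕ => ℂ) 2 :=
  (diagLM a C h).mkContinuous C (norm_diagLM_le h)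

theorem diagCLM_apply {a : ℕ → ℂ} {C : ℝ} (h : ∀ n, ‖a n‖ ≤ C) (d : lp (fun _ : ℕ => ℂ) 2)
    (n : ℕ) : diagCLM a C h d n = a n * d n := rfl

theorem norm_diagCLM_le {a : ℕ → ℂ} {C : ℝ} (h : ∀ n, ‖a n‖ ≤ C) : ‖diagCLM a C h‖ ≤ C :=
  LinearMap.mkContinuous_norm_le _ ((norm_nonneg _).trans (h 0)) _

/-- A diagonal operator with entries tending to zero is compact. -/
theorem isCompactOperator_diagCLM {a : ℕ → ℂ} {C : ℝ} (h : ∀ n, ‖a n‖ ≤ C)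
    (ha : Filter.Tendsto a Filter.atTop (nhds 0)) : IsCompactOperator (diagCLM a C h) := by
  set F : ℕ → lp (fun _ : ℕ => ℂ) 2 →L[ℂ] lp (fun _ : ℕ => ℂ) 2 := fun N =>
    ∑ k ∈ Finset.range N, (lp.singleContinuousLinearMap ℂ (fun _ : ℕ => ℂ) 2 k).comp
      (a k • lp.evalCLM ℂ (fun _ : ℕ => ℂ) 2 k) with hF
  have hFapp : ∀ N d n, F N d n = if n < N then a n * d n else 0 := by
    intro N d n
    simp only [hF, sum_apply, ContinuousLinearMap.comp_apply,
      lp.singleContinuousLinearMap_apply, lp.coeFn_sum, Finset.sum_apply, lp.single_apply]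
    simp [Pi.single_apply]
    rfl
  have hFc : ∀ N, IsCompactOperator (F N) := by
    intro N
    induction N with
    | zero =>
      have h0 : F 0 = 0 := Finset.sum_range_zero _
      rw [h0]
      exact isCompactOperator_zero
    | succ N ih =>
      have h1 : F (N + 1) = F N + (lp.singleContinuousLinearMap ℂ (fun _ : ℕ => ℂ) 2 N).comp
          (a N • lp.evalCLM ℂ (fun _ : ℕ => ℂ) 2 N) := Finset.sum_range_succ _ N
      rw [h1]
      have h2 : IsCompactOperator (a N • lp.evalCLM ℂ (fun _ : ℕ => ℂ) 2 N) :=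
        isCompactOperator_of_locallyCompactSpace_dom _
      exact ih.add (h2.clm_comp (lp.singleContinuousLinearMap ℂ (fun _ : ℕ => ℂ) 2 N))
  refine isCompactOperator_of_tendsto (F := F) (l := Filter.atTop) ?_ (.of_forall hFc)
  rw [Metric.tendsto_atTop]
  intro ε hε
  -- The remainder after truncation is diagonal with entries of norm at most $\varepsilon/2$. The
  -- operator norm is then bounded only by $\le$, and halving restores strictness.
  obtain ⟨N, hN⟩ := Metric.tendsto_atTop.1 ha (ε / 2) (by positivity)
  refine ⟨N, fun M hM => ?_⟩
  have hb : ∀ n, ‖(if n < M then 0 else a n)‖ ≤ ε / 2 := by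
    intro n
    split_ifs with hn
    · simp; positivity
    · simpa using (hN n (by omega)).le
  have h1 : diagCLM a C h - F M = diagCLM _ _ hb := by
    ext d n
    rw [sub_apply, lp.coeFn_sub, Pi.sub_apply, hFapp, diagCLM_apply,
      diagCLM_apply]
    split_ifs <;> simp
  rw [dist_comm, dist_eq_norm, h1]
  exact (norm_diagCLM_le hb).trans_lt (by linarith)

end Diagonal

/-! ### Completeness of polynomials and the expansion of $u$. -/

/-- A square integrable function on `Λ` orthogonal to all polynomials vanishes. -/
theorem ae_eq_zero_of_integral_mul_conj_eval_eq_zero {h : ℝ → ℂ}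
    (hh : MemLp h 2 (volume.restrict Lam))
    (h0 : ∀ p : Polynomial ℂ, ∫ x in Lam, h x * conj (p.eval (x : ℂ)) = 0) :
    h =ᵐ[volume.restrict Lam] 0 := by
  have hint : IntegrableOn h Lam := hh.integrable (by norm_num)
  have key : ∀ᵐ x : ℝ, x ∈ Lam → h x = 0 := by
    refine IsOpen.ae_eq_zero_of_integral_contDiff_smul_eq_zero isOpen_Ioo
      hint.locallyIntegrableOn fun g hg _ hgs => ?_
    have h1 : ∫ x, g x • h x = ∫ x in Lam, g x • h x := by
      refine (setIntegral_eq_integral_of_forall_compl_eq_zero fun x hx => ?_).symm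
      rw [image_eq_zero_of_notMem_tsupport fun h2 => hx (hgs h2), zero_smul]
    rw [h1, ← norm_le_zero_iff]
    refine le_of_forall_pos_le_add fun δ hδ => ?_
    set M := ∫ x in Lam, ‖h x‖ with hM
    have hM0 : 0 ≤ M := integral_nonneg fun _ => norm_nonneg _
    -- Weierstrass approximation of a test function; the denominator $M+1$ allows for $M=0$.
    obtain ⟨q, hq⟩ := exists_polynomial_near_of_continuousOn (-1) 1 g hg.continuous.continuousOn
      (δ / (M + 1)) (by positivity)
    have h2 : ∫ x in Lam, ((q.eval x : ℝ) : ℂ) * h x = 0 := by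
      rw [← h0 (q.map Complex.ofRealHom)]
      congr 1 with x
      have h3 : (q.map Complex.ofRealHom).eval (x : ℂ) = ((q.eval x : ℝ) : ℂ) := by
        have := Polynomial.eval_map_apply (f := Complex.ofRealHom) (p := q) (x := x)
        simpa using this
      rw [h3, Complex.conj_ofReal, mul_comm]
    have hi1 : IntegrableOn (fun x => g x • h x) Lam := by
      have hc : Continuous g := hg.continuous
      have h3 : MemLp (fun x => (g x : ℂ)) 2 (volume.restrict Lam) :=
        memLp_restrict_Lam_of_continuous (by fun_prop)
      have h4 : IntegrableOn (fun x => (g x : ℂ) * h x) Lam := h3.integrable_mul hh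
      simpa using h4
    have hi2 : IntegrableOn (fun x => ((q.eval x : ℝ) : ℂ) * h x) Lam := by
      have hc : Continuous fun x => q.eval x := q.continuous
      have h3 : MemLp (fun x => ((q.eval x : ℝ) : ℂ)) 2 (volume.restrict Lam) :=
        memLp_restrict_Lam_of_continuous (by fun_prop)
      exact h3.integrable_mul hh
    calc ‖∫ x in Lam, g x • h x‖
        = ‖∫ x in Lam, (g x • h x - ((q.eval x : ℝ) : ℂ) * h x)‖ := by
          rw [integral_sub hi1 hi2, h2, sub_zero]
      _ ≤ ∫ x in Lam, δ / (M + 1) * ‖h x‖ := by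
          refine norm_integral_le_of_norm_le (hint.norm.const_mul _) ?_
          filter_upwards [ae_restrict_mem measurableSet_Lam] with x hx
          have h5 : g x • h x - ((q.eval x : ℝ) : ℂ) * h x = ((g x - q.eval x : ℝ) : ℂ) * h x := by
            rw [Complex.real_smul]; push_cast; ring
          rw [h5, norm_mul, Complex.norm_real, Real.norm_eq_abs, abs_sub_comm]
          gcongr
          exact (hq x (Ioo_subset_Icc_self hx)).le
      _ = δ / (M + 1) * M := by rw [integral_const_mul]
      _ ≤ 0 + δ := by
          rw [zero_add, div_mul_eq_mul_div, div_le_iff₀ (by positivity)]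
          nlinarith
  rw [Filter.EventuallyEq, ae_restrict_iff' measurableSet_Lam]
  exact key

/-- The orthonormal eigenpolynomials of the Riesz operator. -/
def eigenPoly {α : ℝ} (hα : 0 < α) : ℕ → Polynomial ℂ :=
  (exists_orthonormal_eigenpolynomials hα).choose

theorem orthonormal_eigenPoly {α : ℝ} (hα : 0 < α) :
    Orthonormal ℂ (fun n => polyLp hα (eigenPoly hα n)) :=
  (exists_orthonormal_eigenpolynomials hα).choose_spec.1

theorem eigenPoly_mem_degreeLT {α : ℝ} (hα : 0 < α) (n : ℕ) :
    eigenPoly hα n ∈ Polynomial.degreeLT ℂ (n + 1) :=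
  (exists_orthonormal_eigenpolynomials hα).choose_spec.2.1 n

theorem rieszOp_eigenPoly {α : ℝ} (hα : 0 < α) (n : ℕ) :
    rieszOp α (eigenPoly hα n) = (gammaRatio α n : ℂ) • eigenPoly hα n :=
  (exists_orthonormal_eigenpolynomials hα).choose_spec.2.2.1 n

theorem span_eigenPoly {α : ℝ} (hα : 0 < α) : Submodule.span ℂ (range (eigenPoly hα)) = ⊤ :=
  (exists_orthonormal_eigenpolynomials hα).choose_spec.2.2.2

theorem ae_eq_zero_of_integral_mul_conj_eigenPoly_eq_zero {α : ℝ} (hα : 0 < α) {h : ℝ → ℂ}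
    (hh : MemLp h 2 (volume.restrict Lam))
    (h0 : ∀ n, ∫ x in Lam, h x * conj ((eigenPoly hα n).eval (x : ℂ)) = 0) :
    h =ᵐ[volume.restrict Lam] 0 := by
  refine ae_eq_zero_of_integral_mul_conj_eval_eq_zero hh fun p => ?_
  have hp : p ∈ Submodule.span ℂ (range (eigenPoly hα)) := by
    rw [span_eigenPoly]; exact Submodule.mem_top
  induction hp using Submodule.span_induction with
  | mem p hp => obtain ⟨n, rfl⟩ := hp; exact h0 n
  | zero => simp
  | add p q _ _ hp hq =>
    simp only [Polynomial.eval_add, map_add, mul_add]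
    rw [integral_add (integrable_mul_conj_eval hh p) (integrable_mul_conj_eval hh q), hp, hq,
      add_zero]
  | smul c p _ hp =>
    simp only [Polynomial.eval_smul, smul_eq_mul, map_mul, mul_left_comm _ (conj c)]
    rw [integral_const_mul, hp, mul_zero]

/-- The normalised Riesz derivatives of the weighted eigenpolynomials. -/
def derivBasis {α : ℝ} (hα : 0 < α) (n : ℕ) : Lp ℂ 2 (volume : Measure ℝ) :=
  ((√(gammaRatio α n))⁻¹ : ℂ) • polyDeriv hα (eigenPoly hα n)

theorem sqrt_gammaRatio_ne_zero {α : ℝ} (hα : 0 < α) (n : ℕ) : (√(gammaRatio α n) : ℂ) ≠ 0 := by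
  exact_mod_cast (Real.sqrt_pos.2 (gammaRatio_pos hα n)).ne'

theorem sqrt_gammaRatio_mul_self {α : ℝ} (hα : 0 < α) (n : ℕ) :
    (√(gammaRatio α n) : ℂ) * √(gammaRatio α n) = gammaRatio α n := by
  exact_mod_cast Real.mul_self_sqrt (gammaRatio_pos hα n).le

/-- The eigenvalue $\lambda_n$ from `rieszOp_eigenPoly` against the normalisation $\lambda_n^{-1/2}$
leaves $\sqrt{\lambda_n}$, so these coefficients encode the moments of $u$ against the
eigenpolynomials. -/
theorem inner_derivBasis {α : ℝ} (hα : 0 < α) {u : ℝ → ℂ} (hu : MemHStar α u) (n : ℕ) :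
    inner ℂ (derivBasis hα n) (rieszDeriv hα.le hu) =
      √(gammaRatio α n) * ∫ x in Lam, u x * conj ((eigenPoly hα n).eval (x : ℂ)) := by
  rw [derivBasis, inner_smul_left, inner_polyDeriv, rieszOp_eigenPoly]
  simp only [Polynomial.eval_smul, smul_eq_mul, map_mul, Complex.conj_ofReal,
    mul_left_comm _ (gammaRatio α n : ℂ), map_inv₀]
  rw [integral_const_mul, ← mul_assoc, ← sqrt_gammaRatio_mul_self hα,
    inv_mul_cancel_left₀ (sqrt_gammaRatio_ne_zero hα n)]

theorem orthonormal_derivBasis {α : ℝ} (hα : 0 < α) : Orthonormal ℂ (derivBasis hα) := by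
  rw [orthonormal_iff_ite]
  intro m n
  rw [derivBasis, derivBasis, inner_smul_left, inner_smul_right, inner_polyDeriv_polyDeriv,
    rieszOp_eigenPoly, map_smul, inner_smul_left, orthonormal_iff_ite.1 (orthonormal_eigenPoly hα)]
  split_ifs with h
  · subst h
    rw [← sqrt_gammaRatio_mul_self hα]
    have := sqrt_gammaRatio_ne_zero hα m
    simp only [map_inv₀, map_mul, Complex.conj_ofReal]
    field_simp
  · simp

theorem norm_inv_sqrt_gammaRatio_le {α : ℝ} (hα : 0 < α) (n : ℕ) :
    ‖((√(gammaRatio α n))⁻¹ : ℂ)‖ ≤ (√(gammaRatio α 0))⁻¹ := by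
  rw [norm_inv, Complex.norm_real, Real.norm_of_nonneg (Real.sqrt_nonneg _)]
  have := Real.sqrt_pos.2 (gammaRatio_pos hα 0)
  gcongr
  exact (gammaRatio_strictMono hα).monotone n.zero_le

/-- The diagonal operator with entries `λ_n^{-1/2}`. -/
def invSqrtDiag {α : ℝ} (hα : 0 < α) : lp (fun _ : ℕ => ℂ) 2 →L[ℂ] lp (fun _ : ℕ => ℂ) 2 :=
  diagCLM (fun n => ((√(gammaRatio α n))⁻¹ : ℂ)) _ (norm_inv_sqrt_gammaRatio_le hα)

theorem invSqrtDiag_apply {α : ℝ} (hα : 0 < α) (d : lp (fun _ : ℕ => ℂ) 2) (n : ℕ) :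
    invSqrtDiag hα d n = (√(gammaRatio α n) : ℂ)⁻¹ * d n := rfl

theorem norm_invSqrtDiag_le {α : ℝ} (hα : 0 < α) : ‖invSqrtDiag hα‖ ≤ (√(gammaRatio α 0))⁻¹ :=
  norm_diagCLM_le _

theorem isCompactOperator_invSqrtDiag {α : ℝ} (hα : 0 < α) :
    IsCompactOperator (invSqrtDiag hα) := by
  refine isCompactOperator_diagCLM _ ?_
  have h := (Real.tendsto_sqrt_atTop.comp (tendsto_gammaRatio hα)).inv_tendsto_atTop
  have h2 := (Complex.continuous_ofReal.tendsto 0).comp h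
  simpa [Function.comp_def] using h2

/-- The coefficients of the Riesz derivative of `u`. -/
def derivCoeff {α : ℝ} (hα : 0 < α) {u : ℝ → ℂ} (hu : MemHStar α u) : lp (fun _ : ℕ => ℂ) 2 :=
  fourierSeq (orthonormal_derivBasis hα) (rieszDeriv hα.le hu)

/-- The density in `L²(Λ)` whose product with `sqrtWeight` has given Riesz derivative. -/
def density {α : ℝ} (hα : 0 < α) : lp (fun _ : ℕ => ℂ) 2 →L[ℂ] Lp ℂ 2 (volume.restrict Lam) :=
  (fourierSum (orthonormal_eigenPoly hα)).toContinuousLinearMap.comp (invSqrtDiag hα)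

theorem density_apply {α : ℝ} (hα : 0 < α) (d : lp (fun _ : ℕ => ℂ) 2) :
    density hα d = fourierSum (orthonormal_eigenPoly hα) (invSqrtDiag hα d) := rfl

theorem norm_density {α : ℝ} (hα : 0 < α) (d : lp (fun _ : ℕ => ℂ) 2) :
    ‖density hα d‖ = ‖invSqrtDiag hα d‖ :=
  (fourierSum (orthonormal_eigenPoly hα)).norm_map _

theorem memLp_sqrtWeight_mul {α : ℝ} (hα : 0 < α) {g : ℝ → ℂ}
    (hg : MemLp g 2 (volume.restrict Lam)) :
    MemLp (fun x => (sqrtWeight α x : ℂ) * g x) 2 (volume.restrict Lam) := by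
  have hc := continuous_sqrtWeight hα
  refine hg.mono (AEStronglyMeasurable.mul (by fun_prop) hg.1) ?_
  filter_upwards [ae_restrict_mem measurableSet_Lam] with x hx
  rw [norm_mul, Complex.norm_real, Real.norm_of_nonneg (sqrtWeight_pos hx).le]
  exact mul_le_of_le_one_left (norm_nonneg _) (sqrtWeight_le_one hα hx)

/-- Both sides are square integrable and have the same moments against every eigenpolynomial, and
moments determine such a function. Since the density lies in $L^2(\Lambda)$, this is also why the
weighted norm of $u$ is finite. -/
theorem ae_eq_sqrtWeight_mul_density {α : ℝ} (hα : 0 < α) {u : ℝ → ℂ} (hu : MemHStar α u) :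
    u =ᵐ[volume.restrict Lam] fun x => (sqrtWeight α x : ℂ) * density hα (derivCoeff hα hu) x := by
  set g := density hα (derivCoeff hα hu) with hg
  have hgm := memLp_sqrtWeight_mul hα (Lp.memLp g)
  have h := ae_eq_zero_of_integral_mul_conj_eigenPoly_eq_zero hα (hu.memLp.sub hgm) fun n => ?_
  · filter_upwards [h] with x hx
    exact sub_eq_zero.1 hx
  · simp only [Pi.sub_apply, sub_mul]
    rw [integral_sub (integrable_mul_conj_eval hu.memLp _) (integrable_mul_conj_eval hgm _)]
    have h1 : inner ℂ (polyLp hα (eigenPoly hα n)) g =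
        ∫ x in Lam, u x * conj ((eigenPoly hα n).eval (x : ℂ)) := by
      have h2 := inner_fourierSum (orthonormal_eigenPoly hα) (invSqrtDiag hα (derivCoeff hα hu)) n
      rw [hg, density_apply, h2, invSqrtDiag_apply, derivCoeff, fourierSeq_apply,
        inner_derivBasis, inv_mul_cancel_left₀ (sqrt_gammaRatio_ne_zero hα n)]
    rw [← h1, L2.inner_def, sub_eq_zero]
    refine integral_congr_ae ?_
    filter_upwards [coeFn_polyLp hα (eigenPoly hα n)] with x hx
    rw [hx, RCLike.inner_apply, map_mul, Complex.conj_ofReal]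
    ring

theorem weight_neg_neg {α x : ℝ} (hx : x ∈ Lam) :
    weight (-α) (-α) x = (sqrtWeight α x ^ 2)⁻¹ := by
  obtain ⟨h1, h2⟩ := hx
  rw [sqrtWeight_sq ⟨h1, h2⟩, weight, ← Real.mul_rpow (by linarith) (by linarith),
    ← Real.rpow_neg (one_sub_sq_pos ⟨h1, h2⟩).le]
  congr 1
  ring

/-! ### The weighted norm and the Poincaré inequality. -/

section Density

variable {α : ℝ} {u : ℝ → ℂ} {g : Lp ℂ 2 (volume.restrict Lam)}

theorem sq_norm_mul_weight_ae_eq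
    (h : u =ᵐ[volume.restrict Lam] fun x => (sqrtWeight α x : ℂ) * g x) :
    (fun x => ‖u x‖ ^ 2 * weight (-α) (-α) x) =ᵐ[volume.restrict Lam] fun x => ‖g x‖ ^ 2 := by
  filter_upwards [h, ae_restrict_mem measurableSet_Lam] with x hx hxL
  have h1 := (sqrtWeight_pos (α := α) hxL).ne'
  rw [hx, weight_neg_neg hxL, norm_mul, Complex.norm_real, Real.norm_eq_abs, mul_pow, sq_abs]
  field_simp

theorem integrableOn_sq_norm (g : Lp ℂ 2 (volume.restrict Lam)) :
    IntegrableOn (fun x => ‖g x‖ ^ 2) Lam :=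
  (memLp_two_iff_integrable_sq_norm (Lp.memLp g).1).1 (Lp.memLp g)

theorem integrableOn_sq_norm_mul_weight
    (h : u =ᵐ[volume.restrict Lam] fun x => (sqrtWeight α x : ℂ) * g x) :
    IntegrableOn (fun x => ‖u x‖ ^ 2 * weight (-α) (-α) x) Lam :=
  (integrableOn_sq_norm g).congr (sq_norm_mul_weight_ae_eq h).symm

theorem sq_norm_eq_integral (g : Lp ℂ 2 (volume.restrict Lam)) :
    ‖g‖ ^ 2 = ∫ x in Lam, ‖g x‖ ^ 2 := by
  have h1 := inner_self_eq_norm_sq_to_K (𝕜 := ℂ) g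
  rw [L2.inner_def] at h1
  have h2 : ∫ x in Lam, inner ℂ (g x) (g x) = ((∫ x in Lam, ‖g x‖ ^ 2 : ℝ) : ℂ) := by
    rw [← integral_complex_ofReal]
    congr 1 with x
    rw [inner_self_eq_norm_sq_to_K]
    simp
  rw [h2] at h1
  exact Complex.ofReal_injective (by rw [Complex.ofReal_pow]; exact h1.symm)

theorem weightedNorm_eq_norm
    (h : u =ᵐ[volume.restrict Lam] fun x => (sqrtWeight α x : ℂ) * g x) :
    weightedNorm (-α) (-α) u = ‖g‖ := by
  rw [weightedNorm, integral_congr_ae (sq_norm_mul_weight_ae_eq h), ← sq_norm_eq_integral,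
    Real.sqrt_sq (norm_nonneg g)]

theorem l2Norm_lt_weightedNorm (hα : 0 < α) (hu : MemLp u 2 (volume.restrict Lam))
    (h0 : ¬ u =ᵐ[volume.restrict Lam] 0)
    (h : u =ᵐ[volume.restrict Lam] fun x => (sqrtWeight α x : ℂ) * g x) :
    l2Norm u < weightedNorm (-α) (-α) u := by
  rw [l2Norm, weightedNorm, integral_congr_ae (sq_norm_mul_weight_ae_eq h)]
  have hi1 : IntegrableOn (fun x => ‖u x‖ ^ 2) Lam :=
    (memLp_two_iff_integrable_sq_norm hu.1).1 hu
  have hi2 := integrableOn_sq_norm g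
  have hsq : ∀ᵐ x ∂(volume.restrict Lam), ‖u x‖ ^ 2 = sqrtWeight α x ^ 2 * ‖g x‖ ^ 2 := by
    filter_upwards [h] with x hx
    rw [hx, norm_mul, Complex.norm_real, Real.norm_eq_abs, mul_pow, sq_abs]
  have hnn : 0 ≤ᵐ[volume.restrict Lam] fun x => ‖g x‖ ^ 2 - ‖u x‖ ^ 2 := by
    filter_upwards [hsq, ae_restrict_mem measurableSet_Lam] with x hx hxL
    rw [Pi.zero_apply, hx]
    have h1 := sqrtWeight_le_one hα hxL
    have h2 := (sqrtWeight_pos (α := α) hxL).le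
    have h3 : sqrtWeight α x ^ 2 ≤ 1 := pow_le_one₀ h2 h1
    nlinarith [sq_nonneg ‖g x‖]
  refine Real.sqrt_lt_sqrt (integral_nonneg fun _ => by positivity) ?_
  rw [← sub_pos, ← integral_sub hi2 hi1]
  refine lt_of_le_of_ne (integral_nonneg_of_ae hnn) fun h3 => h0 ?_
  have h4 := (integral_eq_zero_iff_of_nonneg_ae hnn (hi2.sub hi1)).1 h3.symm
  -- The weight is below $1$ except at the origin, a null set, so equality of the two norms would
  -- force $u=0$.
  have hx0 : ∀ᵐ x : ℝ ∂(volume.restrict Lam), x ≠ 0 := ae_restrict_of_ae (Measure.ae_ne volume 0)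
  filter_upwards [h, h4, hsq, hx0, ae_restrict_mem measurableSet_Lam] with x hx h5 h6 h7 hxL
  have h8 : sqrtWeight α x ^ 2 < 1 := by
    rw [sqrtWeight_sq hxL]
    have : 0 < x ^ 2 := by positivity
    exact Real.rpow_lt_one (one_sub_sq_pos hxL).le (by linarith) hα
  rw [Pi.zero_apply, h6] at h5
  have h9 : ‖g x‖ ^ 2 = 0 := by
    have : (1 - sqrtWeight α x ^ 2) * ‖g x‖ ^ 2 = 0 := by linarith
    exact (mul_eq_zero.1 this).resolve_left (by linarith)
  have h10 : g x = 0 := by simpa using h9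
  rw [hx, h10, mul_zero, Pi.zero_apply]

end Density

section Poincare

variable {α : ℝ} {u : ℝ → ℂ}

theorem norm_derivCoeff_le (hα : 0 < α) (hu : MemHStar α u) :
    ‖derivCoeff hα hu‖ ≤ seminormStar α u := by
  rw [seminormStar_eq_norm hα.le hu]
  exact norm_fourierSeq_le _ _

theorem sqrt_gamma_mul_norm_invSqrtDiag_le (hα : 0 < α) (d : lp (fun _ : ℕ => ℂ) 2) :
    √(Real.Gamma (2 * α + 1)) * ‖invSqrtDiag hα d‖ ≤ ‖d‖ := by
  have h0 := Real.sqrt_pos.2 (gammaRatio_pos hα 0)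
  rw [← gammaRatio_zero, ← le_div_iff₀' h0, div_eq_inv_mul]
  exact (invSqrtDiag hα).le_of_opNorm_le (norm_invSqrtDiag_le hα) d

theorem weightedNorm_eq_norm_invSqrtDiag (hα : 0 < α) (hu : MemHStar α u) :
    weightedNorm (-α) (-α) u = ‖invSqrtDiag hα (derivCoeff hα hu)‖ := by
  rw [weightedNorm_eq_norm (ae_eq_sqrtWeight_mul_density hα hu), norm_density]

/-- The weighted norm is that of $(\lambda_n^{-1/2}d_n)$, which is at most $\lambda_0^{-1/2}\|d\|$;
Bessel's inequality bounds $\|d\|$ by the seminorm. -/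
theorem sqrt_gamma_mul_weightedNorm_le (hα : 0 < α) (hu : MemHStar α u) :
    √(Real.Gamma (2 * α + 1)) * weightedNorm (-α) (-α) u ≤ seminormStar α u := by
  rw [weightedNorm_eq_norm_invSqrtDiag hα hu]
  exact (sqrt_gamma_mul_norm_invSqrtDiag_le hα _).trans (norm_derivCoeff_le hα hu)

/-- The hypothesis makes a series with nonnegative terms $(1-\lambda_0/\lambda_k)|d_k|^2$ have
nonpositive sum, and the factor is positive for $k\ge1$. -/
theorem apply_eq_zero_of_norm_le (hα : 0 < α) {d : lp (fun _ : ℕ => ℂ) 2}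
    (h : ‖d‖ ≤ √(Real.Gamma (2 * α + 1)) * ‖invSqrtDiag hα d‖) {n : ℕ} (hn : n ≠ 0) :
    d n = 0 := by
  have hG : 0 ≤ Real.Gamma (2 * α + 1) := (gammaRatio_zero α ▸ gammaRatio_pos hα 0).le
  have h1 : ‖d‖ ^ 2 ≤ Real.Gamma (2 * α + 1) * ‖invSqrtDiag hα d‖ ^ 2 := by
    calc ‖d‖ ^ 2 ≤ (√(Real.Gamma (2 * α + 1)) * ‖invSqrtDiag hα d‖) ^ 2 := by gcongr
      _ = _ := by rw [mul_pow, Real.sq_sqrt hG]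
  have hs := (hasSum_sq_norm d).sub
    ((hasSum_sq_norm (invSqrtDiag hα d)).mul_left (Real.Gamma (2 * α + 1)))
  have hterm : ∀ k, ‖d k‖ ^ 2 - Real.Gamma (2 * α + 1) * ‖invSqrtDiag hα d k‖ ^ 2 =
      (1 - gammaRatio α 0 / gammaRatio α k) * ‖d k‖ ^ 2 := by
    intro k
    have hk := gammaRatio_pos hα k
    rw [invSqrtDiag_apply, norm_mul, norm_inv, Complex.norm_real, Real.norm_eq_abs, mul_pow,
      inv_pow, sq_abs, Real.sq_sqrt hk.le, gammaRatio_zero]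
    field_simp
  have hnn : ∀ k, 0 ≤ (1 - gammaRatio α 0 / gammaRatio α k) * ‖d k‖ ^ 2 := by
    intro k
    have : gammaRatio α 0 / gammaRatio α k ≤ 1 :=
      (div_le_one (gammaRatio_pos hα k)).2 ((gammaRatio_strictMono hα).monotone k.zero_le)
    exact mul_nonneg (by linarith) (by positivity)
  simp only [hterm] at hs
  have h2 : (1 - gammaRatio α 0 / gammaRatio α n) * ‖d n‖ ^ 2 ≤ 0 :=
    (le_hasSum hs n fun k _ => hnn k).trans (by linarith)
  have h3 : gammaRatio α 0 / gammaRatio α n < 1 :=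
    (div_lt_one (gammaRatio_pos hα n)).2 (gammaRatio_strictMono hα (Nat.pos_of_ne_zero hn))
  have h4 : ‖d n‖ ^ 2 ≤ 0 := by nlinarith
  simpa using le_antisymm h4 (by positivity)

theorem weightedPoly_C (α : ℝ) (c : ℂ) (x : ℝ) :
    weightedPoly α (Polynomial.C c) x = c * (((1 - x ^ 2) ^ α : ℝ) : ℂ) := by
  rw [weightedPoly, Polynomial.eval_C, mul_comm]

theorem exists_eq_const_mul_of_seminormStar_eq (hα : 0 < α) (hu : MemHStar α u)
    (h : seminormStar α u = √(Real.Gamma (2 * α + 1)) * weightedNorm (-α) (-α) u) :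
    ∃ c : ℂ, u =ᵐ[volume.restrict Lam] fun x => c * (((1 - x ^ 2) ^ α : ℝ) : ℂ) := by
  set d := derivCoeff hα hu with hd
  have hle : ‖d‖ ≤ √(Real.Gamma (2 * α + 1)) * ‖invSqrtDiag hα d‖ := by
    rw [← weightedNorm_eq_norm_invSqrtDiag hα hu, ← h]
    exact norm_derivCoeff_le hα hu
  have h0 : ∀ n, n ≠ 0 → invSqrtDiag hα d n • polyLp hα (eigenPoly hα n) = 0 := by
    intro n hn
    rw [invSqrtDiag_apply, apply_eq_zero_of_norm_le hα hle hn, mul_zero, zero_smul]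
  have h1 : density hα d = invSqrtDiag hα d 0 • polyLp hα (eigenPoly hα 0) :=
    (hasSum_fourierSum (orthonormal_eigenPoly hα) (invSqrtDiag hα d)).unique
      (hasSum_single 0 h0)
  obtain ⟨k, hk⟩ : ∃ k, eigenPoly hα 0 = Polynomial.C k := by
    have h2 := eigenPoly_mem_degreeLT hα 0
    rw [Polynomial.mem_degreeLT] at h2
    exact ⟨_, Polynomial.eq_C_of_degree_le_zero (by
      exact Nat.WithBot.lt_one_iff_le_zero.1 (by simpa using h2))⟩
  rw [hk, ← map_smul, Polynomial.smul_C, smul_eq_mul] at h1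
  refine ⟨invSqrtDiag hα d 0 * k, ?_⟩
  have h2 := ae_eq_sqrtWeight_mul_density hα hu
  rw [← hd, h1] at h2
  filter_upwards [h2, coeFn_polyLp hα (Polynomial.C (invSqrtDiag hα d 0 * k)),
    ae_restrict_mem measurableSet_Lam] with x h3 h4 hx
  rw [h3, h4, Polynomial.eval_C, ← sqrtWeight_sq hx]
  push_cast; ring

/-- Triangularity at degree $0$: the difference has degree below $0$, hence vanishes. This gives
equality for multiples of $w$. -/
theorem rieszOp_C (hα : 0 < α) (c : ℂ) :
    rieszOp α (Polynomial.C c) = (Real.Gamma (2 * α + 1) : ℂ) • Polynomial.C c := by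
  have h1 : Polynomial.C c ∈ Polynomial.degreeLT ℂ (0 + 1) := by
    rw [Polynomial.mem_degreeLT]
    exact Polynomial.degree_C_le.trans_lt (by simp)
  have h2 := rieszOp_sub_mem_degreeLT hα h1
  rw [Polynomial.mem_degreeLT] at h2
  rw [← gammaRatio_zero, ← sub_eq_zero, ← Polynomial.degree_eq_bot]
  simpa using h2

theorem seminormStar_eq_of_eq_const_mul (hα : 0 < α) (hu : MemHStar α u) {c : ℂ}
    (h : u =ᵐ[volume.restrict Lam] fun x => c * (((1 - x ^ 2) ^ α : ℝ) : ℂ)) :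
    seminormStar α u = √(Real.Gamma (2 * α + 1)) * weightedNorm (-α) (-α) u := by
  have hG : 0 ≤ Real.Gamma (2 * α + 1) := (gammaRatio_zero α ▸ gammaRatio_pos hα 0).le
  have h1 : rieszDeriv hα.le hu = polyDeriv hα (Polynomial.C c) := by
    rw [polyDeriv_apply]
    refine rieszDeriv_congr _ _ _ ?_
    filter_upwards [h] with x hx
    rw [hx, weightedPoly_C]
  have h2 : weightedNorm (-α) (-α) u = ‖polyLp hα (Polynomial.C c)‖ := by
    refine weightedNorm_eq_norm ?_
    filter_upwards [h, coeFn_polyLp hα (Polynomial.C c), ae_restrict_mem measurableSet_Lam]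
      with x h3 h4 hx
    rw [h3, h4, Polynomial.eval_C, ← sqrtWeight_sq hx]
    push_cast; ring
  have h3 : ‖polyDeriv hα (Polynomial.C c)‖ ^ 2 =
      Real.Gamma (2 * α + 1) * ‖polyLp hα (Polynomial.C c)‖ ^ 2 := by
    have h4 := inner_polyDeriv_polyDeriv hα (Polynomial.C c) (Polynomial.C c)
    rw [rieszOp_C hα, map_smul, inner_smul_left, Complex.conj_ofReal,
      inner_self_eq_norm_sq_to_K, inner_self_eq_norm_sq_to_K] at h4
    exact Complex.ofReal_injective (by
      rw [Complex.ofReal_mul, Complex.ofReal_pow, Complex.ofReal_pow]; exact h4)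
  rw [seminormStar_eq_norm hα.le hu, h1, h2, ← Real.sqrt_sq (norm_nonneg (polyDeriv hα _)), h3,
    Real.sqrt_mul hG, Real.sqrt_sq (norm_nonneg _)]

end Poincare

/-! ### Closedness of the Riesz derivative. -/

theorem memLp_exp_Lam (ξ : ℝ) :
    MemLp (fun x : ℝ => Complex.exp (Complex.I * ξ * x)) 2 (volume.restrict Lam) :=
  memLp_restrict_Lam_of_continuous (by fun_prop)

theorem hat_zeroExt_eq_inner (V : Lp ℂ 2 (volume.restrict Lam)) (ξ : ℝ) :
    hat (zeroExt V) ξ = inner ℂ ((memLp_exp_Lam ξ).toLp _) V := by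
  rw [hat_zeroExt, L2.inner_def]
  refine integral_congr_ae ?_
  filter_upwards [(memLp_exp_Lam ξ).coeFn_toLp] with x hx
  rw [hx, RCLike.inner_apply, ← Complex.exp_conj]
  simp

/-- Square integrability of the symbol implies membership in `H^s_*(Λ)`. -/
theorem memHStar_of_memLp_rieszSymbol {s : ℝ} (hs : 0 ≤ s) {u : ℝ → ℂ}
    (hu : MemLp u 2 (volume.restrict Lam))
    (h : MemLp (fun ξ : ℝ => rieszSymbol s u (2 * Real.pi * ξ)) 2) : MemHStar s u := by
  refine ⟨hu, ?_⟩
  have hint : Integrable (zeroExt u) :=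
    (integrable_indicator_iff measurableSet_Lam).2 (hu.integrable (by norm_num))
  have hc := continuous_hat hint
  have h1 := (memLp_two_iff_integrable_sq_norm h.1).1 h
  have h2 : Integrable fun ξ : ℝ => ‖rieszSymbol s u ξ‖ ^ 2 :=
    (integrable_comp_mul_left_iff (fun ξ : ℝ => ‖rieszSymbol s u ξ‖ ^ 2)
      (R := 2 * Real.pi) (by positivity)).1 h1
  set B := ∫ x, ‖zeroExt u x‖ with hB
  have hball : Integrable (indicator (Icc (-1 : ℝ) 1) fun _ => B ^ 2) :=
    (integrable_indicator_iff measurableSet_Icc).2 (integrableOn_const (by simp))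
  refine ((hball.add h2).const_mul (2 ^ s)).mono' ?_ (.of_forall fun ξ => ?_)
  · have h3 : Continuous fun ξ : ℝ => (1 + |ξ| ^ 2) ^ s :=
      (by fun_prop : Continuous fun ξ : ℝ => 1 + |ξ| ^ 2).rpow_const fun ξ => Or.inr hs
    have h4 : Continuous fun ξ : ℝ => (1 + |ξ| ^ 2) ^ s * ‖hat (zeroExt u) ξ‖ ^ 2 := by fun_prop
    exact h4.aestronglyMeasurable
  · have hsym : ‖rieszSymbol s u ξ‖ ^ 2 = (|ξ| ^ 2) ^ s * ‖hat (zeroExt u) ξ‖ ^ 2 := by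
      rw [rieszSymbol, norm_mul, norm_mul, Complex.norm_real, Real.norm_of_nonneg (by positivity),
        norm_zpow, norm_neg, norm_one, one_zpow, one_mul, mul_pow,
        ← Real.rpow_natCast (|ξ| ^ s), ← Real.rpow_natCast |ξ|, ← Real.rpow_mul (abs_nonneg ξ),
        ← Real.rpow_mul (abs_nonneg ξ), mul_comm s]
    rw [Real.norm_of_nonneg (by positivity), Pi.add_apply, hsym]
    -- Low frequencies are controlled by the bounded transform; for $|\xi|>1$ one has
    -- $1+|\xi|^2\le2|\xi|^2$, so the symbol controls the rest.
    by_cases hξ : ξ ∈ Icc (-1 : ℝ) 1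
    · rw [indicator_of_mem hξ]
      have h5 : |ξ| ^ 2 ≤ 1 := pow_le_one₀ (abs_nonneg ξ) (abs_le.2 hξ)
      calc (1 + |ξ| ^ 2) ^ s * ‖hat (zeroExt u) ξ‖ ^ 2 ≤ 2 ^ s * B ^ 2 := by
            gcongr
            · linarith
            · exact norm_hat_le ξ
        _ ≤ _ := by
            gcongr
            exact le_add_of_nonneg_right (by positivity)
    · rw [indicator_of_notMem hξ, zero_add, ← mul_assoc, ← Real.mul_rpow (by norm_num)
        (by positivity)]
      have h5 : 1 ≤ |ξ| ^ 2 := by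
        refine one_le_pow₀ ?_
        by_contra hlt
        exact hξ (abs_le.1 (not_le.1 hlt).le)
      gcongr
      linarith

/-- The Riesz derivative is a closed operator in `L²(Λ)`. -/
theorem memHStar_of_tendsto {s : ℝ} (hs : 0 ≤ s) {v : ℕ → ℝ → ℂ} (hv : ∀ N, MemHStar s (v N))
    {U : Lp ℂ 2 (volume.restrict Lam)}
    (hU : Filter.Tendsto (fun N => (hv N).memLp.toLp) Filter.atTop (nhds U))
    {G : Lp ℂ 2 (volume : Measure ℝ)}
    (hG : Filter.Tendsto (fun N => rieszDeriv hs (hv N)) Filter.atTop (nhds G)) :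
    ∃ h : MemHStar s U, rieszDeriv hs h = G := by
  have hhat : ∀ ξ, Filter.Tendsto (fun N => hat (zeroExt (v N)) ξ) Filter.atTop
      (nhds (hat (zeroExt U) ξ)) := by
    intro ξ
    rw [hat_zeroExt_eq_inner]
    have h1 : Filter.Tendsto (fun N => inner ℂ ((memLp_exp_Lam ξ).toLp _) (hv N).memLp.toLp)
        Filter.atTop (nhds (inner ℂ ((memLp_exp_Lam ξ).toLp _) U)) :=
      tendsto_const_nhds.inner hU
    refine h1.congr fun N => ?_
    rw [← hat_zeroExt_eq_inner, hat_zeroExt_congr (hv N).memLp.coeFn_toLp]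
  have hsym : ∀ ξ, Filter.Tendsto (fun N => rieszSymbol s (v N) ξ) Filter.atTop
      (nhds (rieszSymbol s U ξ)) := fun ξ => (hhat ξ).const_mul _
  have hF : Filter.Tendsto (fun N => ((hv N).memLp_rieszSymbol hs).toLp) Filter.atTop
      (nhds (𝓕 G)) := by
    have h1 := ((Lp.fourierTransformₗᵢ ℝ ℂ).continuous.tendsto G).comp hG
    refine h1.congr fun N => ?_
    exact (Lp.fourierTransformₗᵢ ℝ ℂ).apply_symm_apply _
  -- Convergence in $L^2(\Lambda)$ gives pointwise convergence of the transforms, since each value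
  -- is an inner product with an exponential. An almost everywhere convergent subsequence of the
  -- symbols then identifies the two limits.
  obtain ⟨ns, hns, hae⟩ := (tendstoInMeasure_of_tendsto_Lp hF).exists_seq_tendsto_ae
  have hall : ∀ᵐ ξ : ℝ, ∀ N, ((hv N).memLp_rieszSymbol hs).toLp _ ξ =
      rieszSymbol s (v N) (2 * Real.pi * ξ) :=
    ae_all_iff.2 fun N => ((hv N).memLp_rieszSymbol hs).coeFn_toLp
  have heq : (𝓕 G : Lp ℂ 2 (volume : Measure ℝ)) =ᵐ[volume]
      fun ξ : ℝ => rieszSymbol s U (2 * Real.pi * ξ) := by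
    filter_upwards [hae, hall] with ξ h1 h2
    refine tendsto_nhds_unique h1 ?_
    refine ((hsym (2 * Real.pi * ξ)).comp hns.tendsto_atTop).congr fun k => ?_
    exact (h2 (ns k)).symm
  have hm : MemHStar s U :=
    memHStar_of_memLp_rieszSymbol hs (Lp.memLp U) ((memLp_congr_ae heq).1 (Lp.memLp _))
  refine ⟨hm, ?_⟩
  have h3 : (hm.memLp_rieszSymbol hs).toLp = 𝓕 G :=
    Lp.ext ((hm.memLp_rieszSymbol hs).coeFn_toLp.trans heq.symm)
  rw [rieszDeriv, h3, FourierTransform.fourierInv_fourier_eq]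

/-! ### The space $H^\alpha_*(\Lambda)$ in $\ell^2$ coordinates and the compact embedding. -/

/-- Multiplication by `sqrtWeight` in `L²(Λ)`. -/
def mulSqrtWeight {α : ℝ} (hα : 0 < α) :
    Lp ℂ 2 (volume.restrict Lam) →L[ℂ] Lp ℂ 2 (volume.restrict Lam) :=
  LinearMap.mkContinuous
    { toFun := fun g => (memLp_sqrtWeight_mul hα (Lp.memLp g)).toLp
      map_add' := fun g h => by
        rw [← MemLp.toLp_add]
        refine MemLp.toLp_congr _ _ ?_
        filter_upwards [Lp.coeFn_add g h] with x hx
        simp only [hx, Pi.add_apply, mul_add]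
      map_smul' := fun c g => by
        rw [RingHom.id_apply, ← MemLp.toLp_const_smul]
        refine MemLp.toLp_congr _ _ ?_
        filter_upwards [Lp.coeFn_smul c g] with x hx
        simp only [hx, Pi.smul_apply, smul_eq_mul, mul_left_comm] } 1 fun g => by
    rw [one_mul]
    refine Lp.norm_le_norm_of_ae_le ?_
    filter_upwards [(memLp_sqrtWeight_mul hα (Lp.memLp g)).coeFn_toLp,
      ae_restrict_mem measurableSet_Lam] with x hx hxL
    refine (congrArg norm hx).trans_le ?_
    rw [norm_mul, Complex.norm_real, Real.norm_of_nonneg (sqrtWeight_pos hxL).le]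
    exact mul_le_of_le_one_left (norm_nonneg _) (sqrtWeight_le_one hα hxL)

theorem coeFn_mulSqrtWeight {α : ℝ} (hα : 0 < α) (g : Lp ℂ 2 (volume.restrict Lam)) :
    mulSqrtWeight hα g =ᵐ[volume.restrict Lam] fun x => (sqrtWeight α x : ℂ) * g x :=
  (memLp_sqrtWeight_mul hα (Lp.memLp g)).coeFn_toLp

/-- The element of `H^α_*(Λ)` with given coefficients of the Riesz derivative. -/
def embed {α : ℝ} (hα : 0 < α) : lp (fun _ : ℕ => ℂ) 2 →L[ℂ] Lp ℂ 2 (volume.restrict Lam) :=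
  (mulSqrtWeight hα).comp (density hα)

theorem isCompactOperator_embed {α : ℝ} (hα : 0 < α) : IsCompactOperator (embed hα) :=
  ((isCompactOperator_invSqrtDiag hα).clm_comp
    (fourierSum (orthonormal_eigenPoly hα)).toContinuousLinearMap).clm_comp (mulSqrtWeight hα)

theorem embed_injective {α : ℝ} (hα : 0 < α) : Function.Injective (embed hα) := by
  rw [injective_iff_map_eq_zero]
  intro d hd
  have h1 := coeFn_mulSqrtWeight hα (density hα d)
  have h2 : density hα d = 0 := by
    have hz : mulSqrtWeight hα (density hα d) = 0 := hd
    rw [hz] at h1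
    rw [Lp.eq_zero_iff_ae_eq_zero]
    filter_upwards [h1, Lp.coeFn_zero ℂ 2 (volume.restrict Lam), ae_restrict_mem measurableSet_Lam]
      with x h2 h3 hx
    rw [h3, Pi.zero_apply] at h2
    have h4 := (sqrtWeight_pos (α := α) hx).ne'
    exact (mul_eq_zero.1 h2.symm).resolve_left (by exact_mod_cast h4)
  have h3 : invSqrtDiag hα d = 0 := by
    rw [← norm_eq_zero, ← norm_density, h2, norm_zero]
  ext n
  have h4 : invSqrtDiag hα d n = 0 := by rw [h3]; rfl
  rw [invSqrtDiag_apply] at h4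
  exact (mul_eq_zero.1 h4).resolve_left (inv_ne_zero (sqrt_gammaRatio_ne_zero hα n))

theorem ae_eq_embed_derivCoeff {α : ℝ} (hα : 0 < α) {u : ℝ → ℂ} (hu : MemHStar α u) :
    u =ᵐ[volume.restrict Lam] embed hα (derivCoeff hα hu) :=
  (ae_eq_sqrtWeight_mul_density hα hu).trans (coeFn_mulSqrtWeight hα _).symm

/-- Partial sums are weighted polynomials, where the identity is linear algebra. They and their
Riesz derivatives converge in $L^2$, and closedness passes to the limit; so every square summable
sequence is realised. -/
theorem exists_rieszDeriv_embed {α : ℝ} (hα : 0 < α) (d : lp (fun _ : ℕ => ℂ) 2) :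
    ∃ h : MemHStar α (embed hα d),
      rieszDeriv hα.le h = fourierSum (orthonormal_derivBasis hα) d := by
  set p : ℕ → Polynomial ℂ := fun N =>
    ∑ k ∈ Finset.range N, invSqrtDiag hα d k • eigenPoly hα k with hp
  refine memHStar_of_tendsto hα.le (fun N => memHStar_weightedPoly hα (p N)) ?_ ?_
  · have h1 := (hasSum_fourierSum (orthonormal_eigenPoly hα) (invSqrtDiag hα d)).tendsto_sum_nat
    have h2 := ((mulSqrtWeight hα).continuous.tendsto _).comp h1
    refine h2.congr fun N => ?_
    have h3 : ∑ k ∈ Finset.range N, invSqrtDiag hα d k • polyLp hα (eigenPoly hα k) =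
        polyLp hα (p N) := by
      rw [hp, map_sum]
      simp only [map_smul]
    rw [Function.comp_apply, h3]
    refine Lp.ext ?_
    filter_upwards [coeFn_mulSqrtWeight hα (polyLp hα (p N)), coeFn_polyLp hα (p N),
      (memHStar_weightedPoly hα (p N)).memLp.coeFn_toLp, ae_restrict_mem measurableSet_Lam]
      with x h4 h5 h6 hx
    rw [h4, h5, h6, weightedPoly, ← sqrtWeight_sq hx]
    push_cast; ring
  · have h1 := (hasSum_fourierSum (orthonormal_derivBasis hα) d).tendsto_sum_nat
    refine h1.congr fun N => ?_
    rw [← polyDeriv_apply, hp, map_sum]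
    refine Finset.sum_congr rfl fun k _ => ?_
    rw [map_smul, derivBasis, smul_smul, invSqrtDiag_apply, mul_comm]

/-- The element built from the coefficients of $u$ agrees with $u$ almost everywhere, so the Riesz
derivative lies in the closed span of `derivBasis`. Bessel's inequality thereby becomes Parseval's
identity. -/
theorem rieszDeriv_eq_fourierSum {α : ℝ} (hα : 0 < α) {u : ℝ → ℂ} (hu : MemHStar α u) :
    rieszDeriv hα.le hu = fourierSum (orthonormal_derivBasis hα) (derivCoeff hα hu) := by
  obtain ⟨h, h1⟩ := exists_rieszDeriv_embed hα (derivCoeff hα hu)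
  rw [← h1]
  exact rieszDeriv_congr _ _ _ (ae_eq_embed_derivCoeff hα hu)

theorem formA_eq_inner_derivCoeff {α : ℝ} (hα : 0 < α) {u v : ℝ → ℂ} (hu : MemHStar α u)
    (hv : MemHStar α v) :
    formA hα.le hu hv = inner ℂ (derivCoeff hα hv) (derivCoeff hα hu) := by
  rw [formA_eq_inner, rieszDeriv_eq_fourierSum hα hu, rieszDeriv_eq_fourierSum hα hv,
    LinearIsometry.inner_map_map]

theorem formB_eq_inner_embed {α : ℝ} (hα : 0 < α) {u v : ℝ → ℂ} (hu : MemHStar α u)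
    (hv : MemHStar α v) :
    formB u v = inner ℂ (embed hα (derivCoeff hα hv)) (embed hα (derivCoeff hα hu)) := by
  rw [L2.inner_def, formB]
  refine integral_congr_ae ?_
  filter_upwards [ae_eq_embed_derivCoeff hα hu, ae_eq_embed_derivCoeff hα hv] with x h1 h2
  rw [RCLike.inner_apply, ← h1, ← h2]

theorem derivCoeff_embed {α : ℝ} (hα : 0 < α) (d : lp (fun _ : ℕ => ℂ) 2)
    (h : MemHStar α (embed hα d)) : derivCoeff hα h = d := by
  obtain ⟨h', h1⟩ := exists_rieszDeriv_embed hα d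
  ext n
  rw [derivCoeff, fourierSeq_apply, h1, inner_fourierSum]

/-! ### The smallest eigenvalue. -/

/-- The largest singular value of a nonzero compact operator is attained. -/
theorem exists_norm_sq_mul_inner_eq {H E : Type*} [NormedAddCommGroup H] [InnerProductSpace ℂ H]
    [CompleteSpace H] [NormedAddCommGroup E] [InnerProductSpace ℂ E] [CompleteSpace E]
    {R : H →L[ℂ] E} (hR : IsCompactOperator R) (h0 : R ≠ 0) :
    ∃ d ≠ 0, ∀ e, inner ℂ (R e) (R d) = (‖R‖ ^ 2 : ℝ) * inner ℂ e d := by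
  have hnt : Nontrivial H := by
    by_contra hn
    rw [not_nontrivial_iff_subsingleton] at hn
    exact h0 (by ext x; simp [Subsingleton.elim x 0])
  set K : H →L[ℂ] H := (ContinuousLinearMap.adjoint R).comp R with hK
  have hKc : IsCompactOperator K := hR.clm_comp (ContinuousLinearMap.adjoint R)
  have hKn : ‖K‖ = ‖R‖ ^ 2 := by
    rw [hK, ContinuousLinearMap.norm_adjoint_comp_self, sq]
  have hpos : 0 < ‖R‖ := norm_pos_iff.2 h0
  have hKin : ∀ e x, inner ℂ e (K x) = inner ℂ (R e) (R x) := fun e x => by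
    rw [hK, ContinuousLinearMap.comp_apply, ContinuousLinearMap.adjoint_inner_right]
  have hne : algebraMap ℝ ℂ ‖K‖ ≠ 0 := by
    rw [hKn]; simp [h0]
  rcases IsCompactOperator.hasEigenvalue_or_mem_resolventSet hKc hne with h | h
  · obtain ⟨d, hd⟩ := h.exists_hasEigenvector
    refine ⟨d, hd.2, fun e => ?_⟩
    have h1 : K d = algebraMap ℝ ℂ ‖K‖ • d := hd.apply_eq_smul
    rw [← hKin, h1, inner_smul_right, hKn]
    rfl
  -- If $\|K\|$ lay in the resolvent set, the Rayleigh quotients of $K=R^*R$ would stay below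
  -- $\|R\|^2-\varepsilon$, and then $\|R\|^2\le\|R\|^2-\varepsilon$.
  · exfalso
    obtain ⟨ε, hε, hle⟩ := K.rayleighQuotient_le_of_norm_mem_resolventSet h
    have h1 : ∀ x, ‖R x‖ ^ 2 ≤ (‖R‖ ^ 2 - ε) * ‖x‖ ^ 2 := by
      intro x
      rcases eq_or_ne x 0 with rfl | hx
      · simp
      have hx2 : 0 < ‖x‖ ^ 2 := by positivity
      have h2 := hle x
      rw [ContinuousLinearMap.rayleighQuotient, div_le_iff₀ hx2, hKn,
        ContinuousLinearMap.reApplyInnerSelf_apply, inner_re_symm, hKin,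
        inner_self_eq_norm_sq] at h2
      exact h2
    obtain ⟨x0, hx0⟩ : ∃ x, R x ≠ 0 := by
      by_contra hn
      push Not at hn
      exact h0 (ContinuousLinearMap.ext hn)
    have hc : 0 ≤ ‖R‖ ^ 2 - ε := by
      by_contra hneg
      have h3 : 0 < ‖R x0‖ ^ 2 := by positivity
      nlinarith [h1 x0, sq_nonneg ‖x0‖]
    have h4 : ‖R‖ ≤ √(‖R‖ ^ 2 - ε) := by
      refine R.opNorm_le_bound (Real.sqrt_nonneg _) fun x => ?_
      refine (sq_le_sq₀ (norm_nonneg _) (by positivity)).1 ?_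
      rw [mul_pow, Real.sq_sqrt hc]
      exact h1 x
    have h5 := Real.sq_sqrt hc
    nlinarith [Real.sqrt_nonneg (‖R‖ ^ 2 - ε)]

section Eigenvalue

variable {α : ℝ}

theorem embed_ne_zero (hα : 0 < α) : embed hα ≠ 0 := by
  intro h
  have h1 : (lp.single 2 0 1 : lp (fun _ : ℕ => ℂ) 2) = 0 :=
    embed_injective hα (by rw [h]; rfl)
  have h2 := congrArg norm h1
  rw [lp.norm_single (by norm_num)] at h2
  simp at h2

theorem embed_derivCoeff_ne_zero (hα : 0 < α) {u : ℝ → ℂ} (hu : MemHStar α u)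
    (h0 : ¬ u =ᵐ[volume.restrict Lam] 0) : embed hα (derivCoeff hα hu) ≠ 0 := by
  intro h
  refine h0 ((ae_eq_embed_derivCoeff hα hu).trans ?_)
  rw [h]
  exact Lp.coeFn_zero _ _ _

theorem sq_norm_derivCoeff_eq (hα : 0 < α) {lam : ℝ} {u : ℝ → ℂ} (hu : MemHStar α u)
    (h : formA hα.le hu hu = (lam : ℂ) * formB u u) :
    ‖derivCoeff hα hu‖ ^ 2 = lam * ‖embed hα (derivCoeff hα hu)‖ ^ 2 := by
  rw [formA_eq_inner_derivCoeff, formB_eq_inner_embed hα hu hu, inner_self_eq_norm_sq_to_K,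
    inner_self_eq_norm_sq_to_K] at h
  exact Complex.ofReal_injective (by
    rw [Complex.ofReal_mul, Complex.ofReal_pow, Complex.ofReal_pow]; exact h)

/-- In coordinates the problem is $\langle e,d\rangle=\lambda\langle Te,Td\rangle$ for all $e$, with
$T$ = `embed hα`. A top singular vector of $T$ solves it with $\lambda=\|T\|^{-2}$. For any
eigenvalue, testing with the eigenfunction gives $\|d\|^2=\lambda\|Td\|^2$, and
$\|Td\|\le\|T\|\|d\|$ shows that none is smaller. -/
theorem isLeast_isEigenvalue (hα : 0 < α) :
    IsLeast {lam : ℝ | IsEigenvalue hα.le lam} (‖embed hα‖ ^ 2)⁻¹ := by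
  have hpos : 0 < ‖embed hα‖ := norm_pos_iff.2 (embed_ne_zero hα)
  constructor
  · obtain ⟨d, hd, h⟩ := exists_norm_sq_mul_inner_eq (isCompactOperator_embed hα)
      (embed_ne_zero hα)
    obtain ⟨hm, -⟩ := exists_rieszDeriv_embed hα d
    refine ⟨embed hα d, hm, fun h0 => ?_, fun v hv => ?_⟩
    · rw [Lp.eq_zero_iff_ae_eq_zero.symm] at h0
      exact hd (embed_injective hα (by rw [h0, map_zero]))
    · rw [formA_eq_inner_derivCoeff, formB_eq_inner_embed hα hm hv, derivCoeff_embed, h,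
        ← mul_assoc, ← Complex.ofReal_mul, inv_mul_cancel₀ (by positivity), Complex.ofReal_one,
        one_mul]
  · rintro lam ⟨u, hu, h0, h⟩
    have h1 := sq_norm_derivCoeff_eq hα hu (h u hu)
    have h2 : 0 < ‖embed hα (derivCoeff hα hu)‖ := norm_pos_iff.2 (embed_derivCoeff_ne_zero hα hu h0)
    have h3 : ‖embed hα (derivCoeff hα hu)‖ ^ 2 ≤ (‖embed hα‖ * ‖derivCoeff hα hu‖) ^ 2 := by
      gcongr
      exact (embed hα).le_opNorm _
    rw [mul_pow, h1] at h3
    rw [inv_le_iff_one_le_mul₀' (by positivity)]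
    have h4 : 1 * ‖embed hα (derivCoeff hα hu)‖ ^ 2 ≤
        ‖embed hα‖ ^ 2 * lam * ‖embed hα (derivCoeff hα hu)‖ ^ 2 := by linarith
    exact le_of_mul_le_mul_right h4 (by positivity)

theorem l2Norm_eq_norm_embed (hα : 0 < α) {u : ℝ → ℂ} (hu : MemHStar α u) :
    l2Norm u = ‖embed hα (derivCoeff hα hu)‖ := by
  rw [← Real.sqrt_sq (norm_nonneg (embed hα _)), sq_norm_eq_integral, l2Norm]
  congr 1
  refine integral_congr_ae ?_
  filter_upwards [ae_eq_embed_derivCoeff hα hu] with x hx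
  rw [← hx]

theorem sqrt_gamma_mul_l2Norm_lt (hα : 0 < α) {u : ℝ → ℂ} (hu : MemHStar α u)
    (h0 : ¬ u =ᵐ[volume.restrict Lam] 0) :
    √(Real.Gamma (2 * α + 1)) * l2Norm u <
      √(Real.Gamma (2 * α + 1)) * weightedNorm (-α) (-α) u := by
  refine mul_lt_mul_of_pos_left ?_ (Real.sqrt_pos.2 (Real.Gamma_pos_of_pos (by positivity)))
  exact l2Norm_lt_weightedNorm hα hu.memLp h0 (ae_eq_sqrtWeight_mul_density hα hu)

/-- An eigenfunction satisfies $|u|_{\alpha,*}^2=\lambda\|u\|^2$, and the strict end-to-end Poincaré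
inequality compares this with $\Gamma(2\alpha+1)\|u\|^2$. -/
theorem gamma_lt_of_isEigenvalue (hα : 0 < α) {lam : ℝ} (h : IsEigenvalue hα.le lam) :
    Real.Gamma (2 * α + 1) < lam := by
  obtain ⟨u, hu, h0, h⟩ := h
  have hG : 0 ≤ Real.Gamma (2 * α + 1) := (Real.Gamma_pos_of_pos (by positivity)).le
  have h1 := sq_norm_derivCoeff_eq hα hu (h u hu)
  have h2 := (sqrt_gamma_mul_l2Norm_lt hα hu h0).trans_le (sqrt_gamma_mul_weightedNorm_le hα hu)
  rw [seminormStar_eq_norm hα.le hu, rieszDeriv_eq_fourierSum hα hu, LinearIsometry.norm_map,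
    l2Norm_eq_norm_embed hα hu] at h2
  have h3 := pow_lt_pow_left₀ h2 (by positivity) two_ne_zero
  rw [mul_pow, Real.sq_sqrt hG, h1] at h3
  exact lt_of_mul_lt_mul_right h3 (by positivity)

end Eigenvalue

end RieszEigen

end

theorem mainTheorem4 (α : ℝ) (hα : 0 < α) :
    (∀ u : ℝ → ℂ, RieszEigen.MemHStar α u → ¬ u =ᵐ[volume.restrict RieszEigen.Lam] 0 →
      IntegrableOn (fun x => ‖u x‖ ^ 2 * RieszEigen.weight (-α) (-α) x) RieszEigen.Lam ∧
      √(Real.Gamma (2 * α + 1)) * RieszEigen.weightedNorm (-α) (-α) u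
        ≤ RieszEigen.seminormStar α u ∧
      (RieszEigen.seminormStar α u
          = √(Real.Gamma (2 * α + 1)) * RieszEigen.weightedNorm (-α) (-α) u ↔
        ∃ c : ℂ, u =ᵐ[volume.restrict RieszEigen.Lam]
          fun x => c * (((1 - x ^ 2) ^ α : ℝ) : ℂ)) ∧
      √(Real.Gamma (2 * α + 1)) * RieszEigen.l2Norm u
        < √(Real.Gamma (2 * α + 1)) * RieszEigen.weightedNorm (-α) (-α) u) ∧
    ∃ lam₁ : ℝ, IsLeast {lam : ℝ | RieszEigen.IsEigenvalue hα.le lam} lam₁ ∧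
      Real.Gamma (2 * α + 1) < lam₁ := by
  have hl := RieszEigen.isLeast_isEigenvalue hα
  refine ⟨fun u hu h0 => ⟨?_, RieszEigen.sqrt_gamma_mul_weightedNorm_le hα hu, ⟨?_, ?_⟩,
    RieszEigen.sqrt_gamma_mul_l2Norm_lt hα hu h0⟩, _, hl,
    RieszEigen.gamma_lt_of_isEigenvalue hα hl.1⟩
  · exact RieszEigen.integrableOn_sq_norm_mul_weight (RieszEigen.ae_eq_sqrtWeight_mul_density hα hu)
  · exact RieszEigen.exists_eq_const_mul_of_seminormStar_eq hα hu
  · rintro ⟨c, hc⟩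
    exact RieszEigen.seminormStar_eq_of_eq_const_mul hα hu hc
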